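/- Work in homotopy type theory (intensional Martin-Löf type theory with $\Pi$, $\Sigma$, $+$, $\mathbf 0$, $\mathbf 1$, $\mathbb N$, lists, identity types, a cumulative hierarchy of univalent universes $\mathcal U_0,\mathcal U_1,\dots$, function extensionality, and the two higher inductive types below). For a type $A$, let the free $\infty$-group $\mathbf F(A)$ be the (untruncated) higher inductive type with constructors $\mathsf{unit}:\mathbf F(A)$, $\mathsf{cons},\mathsf{icons}:A\to\mathbf F(A)\to\mathbf F(A)$, $\mu_1(a,x):\mathsf{icons}_a(\mathsf{cons}_a(x))=x$, $\mu_2(a,x):\mathsf{cons}_a(\mathsf{icons}_a(x))=x$ and $\mu(a,x):\mathsf{ap}_{\mathsf{cons}_a}(\mu_1(a,x))=\mu_2(a,\mathsf{cons}_a(x))$; that is, it is generated by $\mathsf{unit}$ and by the requirement that every $\mathsf{cons}_a$ is a half-adjoint equivalence. Let $\mathbf F_0(A)$ be the set-truncated free group of the HoTT book: the higher inductive type generated by a map $\eta:A\to\mathbf F_0(A)$, a multiplication $m$, a unit $e$ and an inversion $i$, by equalities for associativity and for the left and right unit and inverse laws, and by a $0$-truncation constructor. For every universe level $i$ the following are derivable,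 that is, the types expressing them have closed inhabitants. Let $A:\mathcal U_i$ be a type with decidable equality, i.e. let an element of $\Pi(a_1,a_2:A).\ (a_1=a_2)+((a_1=a_2)\to\mathbf 0)$ be given. 1. $\mathbf F(A)$ has decidable equality. 2. $\mathbf F(A)$ is canonically equivalent to $\mathbf F_0(A)$: there is an equivalence $h:\mathbf F(A)\to\mathbf F_0(A)$ with $h(\mathsf{unit})=e$ and $h(\mathsf{cons}_a(x))=m(\eta(a),h(x))$ for all $a:A$ and $x:\mathbf F(A)$. 3. Both are presented by lists in normal form. Write $A^{\pm}:=A+A$, and $\bar s$ for $s:A^{\pm}$ with its sign changed. A list $w$ over $A^{\pm}$ is in normal form if it is not of the form $x\,s\,\bar s\,y$ with lists $x,y$ and $s:A^{\pm}$. The map from the type of lists in normal form to $\mathbf F(A)$ that sends the empty list to $\mathsf{unit}$, prepending $\mathsf{inl}(a)$ to $\mathsf{cons}_a$, and prepending $\mathsf{inr}(a)$ to $\mathsf{icons}_a$, is an equivalence. (Composed with $h$ it is an equivalence from lists in normal form to $\mathbf F_0(A)$.) -/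

import Mathlib

/-!
Homotopy type theory as a formal system (Martin-Löf type theory with a cumulative hierarchy of
univalent universes, function extensionality and higher inductive types), presented through
raw terms, an untyped convertibility relation, and a typing judgement.  Everything
except universes, `Π`, `λ` and application is a constant with a closed type, together with
defining equations (computation rules) that are part of convertibility.
-/

namespace HoTT

/-! ### Raw terms -/

/-- The constants of the theory. -/
inductive Const : Type
  | empty | emptyElim
  | unit | star | unitElim
  | nat | zero | succ | natElim
  | sum | inl | inr | sumElim
  | sigma | pair | sigmaElim
  | id | refl | idElim
  | list | nil | cons | listElim
  | funext
  | univalence (l : ℕ)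
  -- the free infinity-group `F A`
  | F | funit | fcons | ficons | fmu1 | fmu2 | fmu
  | fElim | fElimMu1 | fElimMu2 | fElimMu
  -- the set-truncated free group `FG A`
  | FG | geta | gmul | gone | ginv
  | gassoc | gmulOne | goneMul | gmulInv | ginvMul | gtrunc
  | gElim

/-- Raw terms, with de Bruijn indices. -/
inductive Tm : Type
  | var (n : ℕ)
  | univ (l : ℕ)
  | pi (A B : Tm)
  | lam (b : Tm)
  | app (f a : Tm)
  | const (c : Const)

namespace Tm

/-- Extension of a renaming under a binder. -/
def upr (r : ℕ → ℕ) : ℕ → ℕ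
  | 0 => 0
  | n + 1 => r n + 1

def rename : (ℕ → ℕ) → Tm → Tm
  | r, var n => var (r n)
  | _, univ l => univ l
  | r, pi A B => pi (rename r A) (rename (upr r) B)
  | r, lam b => lam (rename (upr r) b)
  | r, app f a => app (rename r f) (rename r a)
  | _, const c => const c

/-- Extension of a substitution under a binder. -/
def ups (s : ℕ → Tm) : ℕ → Tm
  | 0 => var 0
  | n + 1 => rename Nat.succ (s n)

def subst : (ℕ → Tm) → Tm → Tm
  | s, var n => s n
  | _, univ l => univ l
  | s, pi A B => pi (subst s A) (subst (ups s) B)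
  | s, lam b => lam (subst (ups s) b)
  | s, app f a => app (subst s f) (subst s a)
  | _, const c => const c

/-- The substitution of `a` for the variable `0`. -/
def single (a : Tm) : ℕ → Tm
  | 0 => a
  | n + 1 => var n

/-- `b[a / 0]`. -/
def inst (b a : Tm) : Tm := subst (single a) b

/-- Application of a constant to a list of arguments. -/
def apps (c : Const) (as : List Tm) : Tm := as.foldl app (const c)

end Tm

/-! ### Convertibility -/

open Tm HoTT.Const in
/-- The computation rules of the constants.  (The parameters that a constructor carries are not
compared with those of the eliminator: in a well-typed redex they agree anyway.) -/
inductive Comp : Tm → Tm → Prop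
  | unit (C c) : Comp (apps unitElim [C, c, const star]) c
  | zero (C z s) : Comp (apps natElim [C, z, s, const zero]) z
  | succ (C z s n) : Comp (apps natElim [C, z, s, app (const succ) n])
      (app (app s n) (apps natElim [C, z, s, n]))
  | inl (A B C l r A' B' a) : Comp (apps sumElim [A, B, C, l, r, apps inl [A', B', a]]) (app l a)
  | inr (A B C l r A' B' b) : Comp (apps sumElim [A, B, C, l, r, apps inr [A', B', b]]) (app r b)
  | pair (A B C g A' B' a b) :
      Comp (apps sigmaElim [A, B, C, g, apps pair [A', B', a, b]]) (app (app g a) b)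
  | refl (A a C d x A' a') : Comp (apps idElim [A, a, C, d, x, apps refl [A', a']]) d
  | nil (A C n c A') : Comp (apps listElim [A, C, n, c, apps nil [A']]) n
  | cons (A C n c A' a l) : Comp (apps listElim [A, C, n, c, apps cons [A', a, l]])
      (app (app (app c a) l) (apps listElim [A, C, n, c, l]))
  | funit (A P u c d m1 m2 m A') :
      Comp (apps fElim [A, P, u, c, d, m1, m2, m, apps funit [A']]) u
  | fcons (A P u c d m1 m2 m A' a x) :
      Comp (apps fElim [A, P, u, c, d, m1, m2, m, apps fcons [A', a, x]])
        (app (app (app c a) x) (apps fElim [A, P, u, c, d, m1, m2, m, x]))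
  | ficons (A P u c d m1 m2 m A' a x) :
      Comp (apps fElim [A, P, u, c, d, m1, m2, m, apps ficons [A', a, x]])
        (app (app (app d a) x) (apps fElim [A, P, u, c, d, m1, m2, m, x]))
  | geta (A P S h m e i p1 p2 p3 p4 p5 A' a) :
      Comp (apps gElim [A, P, S, h, m, e, i, p1, p2, p3, p4, p5, apps geta [A', a]]) (app h a)
  | gmul (A P S h m e i p1 p2 p3 p4 p5 A' x y) :
      Comp (apps gElim [A, P, S, h, m, e, i, p1, p2, p3, p4, p5, apps gmul [A', x, y]])
        (app (app (app (app m x) y)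
          (apps gElim [A, P, S, h, m, e, i, p1, p2, p3, p4, p5, x]))
          (apps gElim [A, P, S, h, m, e, i, p1, p2, p3, p4, p5, y]))
  | gone (A P S h m e i p1 p2 p3 p4 p5 A') :
      Comp (apps gElim [A, P, S, h, m, e, i, p1, p2, p3, p4, p5, apps gone [A']]) e
  | ginv (A P S h m e i p1 p2 p3 p4 p5 A' x) :
      Comp (apps gElim [A, P, S, h, m, e, i, p1, p2, p3, p4, p5, apps ginv [A', x]])
        (app (app i x) (apps gElim [A, P, S, h, m, e, i, p1, p2, p3, p4, p5, x]))

/-- Convertibility: the congruence generated by `β`, `η` and the computation rules. -/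
inductive Conv : Tm → Tm → Prop
  | rfl (t) : Conv t t
  | symm {t u} : Conv t u → Conv u t
  | trans {t u v} : Conv t u → Conv u v → Conv t v
  | pi {A A' B B'} : Conv A A' → Conv B B' → Conv (.pi A B) (.pi A' B')
  | lam {b b'} : Conv b b' → Conv (.lam b) (.lam b')
  | app {f f' a a'} : Conv f f' → Conv a a' → Conv (.app f a) (.app f' a')
  | beta (b a) : Conv (.app (.lam b) a) (b.inst a)
  | eta (t : Tm) : Conv (.lam (.app (t.rename Nat.succ) (.var 0))) t
  | comp {t u} : Comp t u → Conv t u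

/-! ### Writing terms with named binders

A `Bld` is a term that is given for every number `d` of enclosing binders; the variable bound by
the binder number `d` has the index `e - (d + 1)` below `e` binders. -/

abbrev Bld : Type := ℕ → Tm

namespace Bld

def U (l : ℕ) : Bld := fun _ => .univ l
def cst (c : Const) : Bld := fun _ => .const c
def ap (f a : Bld) : Bld := fun d => .app (f d) (a d)
def bound (d : ℕ) : Bld := fun e => .var (e - (d + 1))
/-- `Lam fun x => b` is `λ x. b`. -/
def Lam (b : Bld → Bld) : Bld := fun d => .lam (b (bound d) (d + 1))
/-- `Pi A fun x => B` is `Π (x : A), B`. -/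
def Pi (A : Bld) (B : Bld → Bld) : Bld := fun d => .pi (A d) (B (bound d) (d + 1))
def arr (A B : Bld) : Bld := Pi A fun _ => B

end Bld

local infixl:100 " ⬝ " => Bld.ap
local infixr:60 " ⇾ " => Bld.arr

open Bld

/-! ### Basic notions inside the theory

Here `A`, `B`, `P`, `f`, … are terms; a type family over `A` is a term of type `A → U`. -/

/-- `Sig A fun x => B` is `Σ (x : A), B`. -/
def Sig (A : Bld) (B : Bld → Bld) : Bld := cst .sigma ⬝ A ⬝ Lam B
def Prod (A B : Bld) : Bld := Sig A fun _ => B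
def Pair (A : Bld) (B : Bld → Bld) (a b : Bld) : Bld := cst .pair ⬝ A ⬝ Lam B ⬝ a ⬝ b
/-- The first projection from `Σ (x : A), B`. -/
def Fst (A : Bld) (B : Bld → Bld) (p : Bld) : Bld :=
  cst .sigmaElim ⬝ A ⬝ Lam B ⬝ (Lam fun _ => A) ⬝ (Lam fun a => Lam fun _ => a) ⬝ p

/-- The identity type `x =_A y`. -/
def Id (A x y : Bld) : Bld := cst .id ⬝ A ⬝ x ⬝ y
def Refl (A x : Bld) : Bld := cst .refl ⬝ A ⬝ x
/-- Based path induction: from `d : C x refl` to `C y p`, for `p : x =_A y`. -/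
def IdElim (A x : Bld) (C : Bld → Bld → Bld) (d y p : Bld) : Bld :=
  cst .idElim ⬝ A ⬝ x ⬝ (Lam fun y => Lam fun p => C y p) ⬝ d ⬝ y ⬝ p

/-- The composite `x = z` of `p : x =_A y` and `q : y =_A z`. -/
def concat (A x y z p q : Bld) : Bld := IdElim A y (fun z _ => Id A x z) p z q
/-- `ap_f(p) : f x =_B f y` for `f : A → B` and `p : x =_A y`. -/
def apf (A B f x y p : Bld) : Bld :=
  IdElim A x (fun y _ => Id B (f ⬝ x) (f ⬝ y)) (Refl B (f ⬝ x)) y p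
/-- The transport of `u : P x` to `P y` along `p : x =_A y`. -/
def tr (A P x y p u : Bld) : Bld := IdElim A x (fun y _ => P ⬝ y) u y p
/-- The type of paths from `u : P x` to `v : P y` over `p : x =_A y`. -/
def PathOver (A P x y p u v : Bld) : Bld := Id (P ⬝ y) (tr A P x y p u) v
/-- `apd_f(p)`, a path from `f x` to `f y` over `p`, for `f : Π (x : A), P x`. -/
def apd (A P f x y p : Bld) : Bld :=
  IdElim A x (fun y p => PathOver A P x y p (f ⬝ x) (f ⬝ y)) (Refl (P ⬝ x) (f ⬝ x)) y p

def IsSet (A : Bld) : Bld :=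
  Pi A fun x => Pi A fun y => Pi (Id A x y) fun p => Pi (Id A x y) fun q => Id (Id A x y) p q

/-- `Π (x y : A), (x = y) + ((x = y) → 0)`. -/
def DecEq (A : Bld) : Bld :=
  Pi A fun x => Pi A fun y => cst .sum ⬝ Id A x y ⬝ (Id A x y ⇾ cst .empty)

/-! Half-adjoint equivalences. -/

/-- `Π (x : A), ap_f(η x) = ε (f x)`. -/
def HalfAdj (A B f g η ε : Bld) : Bld :=
  Pi A fun x => Id (Id B (f ⬝ (g ⬝ (f ⬝ x))) (f ⬝ x))
    (apf A B f (g ⬝ (f ⬝ x)) x (η ⬝ x)) (ε ⬝ (f ⬝ x))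
def LeftInv (A f g : Bld) : Bld := Pi A fun x => Id A (g ⬝ (f ⬝ x)) x
def RightInv (B f g : Bld) : Bld := Pi B fun y => Id B (f ⬝ (g ⬝ y)) y

/-- `f : A → B` is a (half-adjoint) equivalence. -/
def IsEquiv (A B f : Bld) : Bld :=
  Sig (B ⇾ A) fun g => Sig (LeftInv A f g) fun η => Sig (RightInv B f g) fun ε =>
    HalfAdj A B f g η ε

/-- `A ≃ B`. -/
def Equivalence (A B : Bld) : Bld := Sig (A ⇾ B) fun f => IsEquiv A B f

/-- The identity equivalence `A ≃ A`. -/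
def idEquivalence (A : Bld) : Bld :=
  let f := Lam fun x => x
  let r := Lam fun x => Refl A x
  Pair (A ⇾ A) (fun f => IsEquiv A A f) f <|
    Pair (A ⇾ A) (fun g => Sig (LeftInv A f g) fun η => Sig (RightInv A f g) fun ε =>
      HalfAdj A A f g η ε) f <|
    Pair (LeftInv A f f) (fun η => Sig (RightInv A f f) fun ε => HalfAdj A A f f η ε) r <|
    Pair (RightInv A f f) (fun ε => HalfAdj A A f f r ε) r <|
    Lam fun x => Refl (Id A x x) (Refl A x)

/-- The canonical map `(A =_U B) → (A ≃ B)`. -/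
def idToEquivalence (l : ℕ) (A B : Bld) : Bld :=
  Lam fun p => IdElim (U l) A (fun B _ => Equivalence A B) (idEquivalence A) B p

/-- The canonical map from `f = g` to `Π (x : A), f x = g x`. -/
def happly (A B f g : Bld) : Bld :=
  Lam fun p => Lam fun x =>
    IdElim (Pi A fun x => B ⬝ x) f (fun g _ => Id (B ⬝ x) (f ⬝ x) (g ⬝ x))
      (Refl (B ⬝ x) (f ⬝ x)) g p

/-! ### The free infinity-group: constructors and induction principle -/

def FF (A : Bld) : Bld := cst .F ⬝ A
def Funit (A : Bld) : Bld := cst .funit ⬝ A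
def Fcons (A a x : Bld) : Bld := cst .fcons ⬝ A ⬝ a ⬝ x
def Ficons (A a x : Bld) : Bld := cst .ficons ⬝ A ⬝ a ⬝ x
/-- `icons_a (cons_a x) = x`. -/
def Fmu1 (A a x : Bld) : Bld := cst .fmu1 ⬝ A ⬝ a ⬝ x
/-- `cons_a (icons_a x) = x`. -/
def Fmu2 (A a x : Bld) : Bld := cst .fmu2 ⬝ A ⬝ a ⬝ x
/-- `ap_{cons_a}(μ₁(a, x)) = μ₂(a, cons_a x)`. -/
def Fmu (A a x : Bld) : Bld := cst .fmu ⬝ A ⬝ a ⬝ x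

/-- `ap_{cons_a}(p)`, for `p : x =_{F A} y`. -/
def apCons (A a x y p : Bld) : Bld := apf (FF A) (FF A) (cst .fcons ⬝ A ⬝ a) x y p

/-- Let `c a x : P x → P (cons_a x)`.  A path `q` from `w : P x` to `y : P z` over `p : x = z`
is mapped by `c` to a path from `c a x w` to `c a z y` over `ap_{cons_a}(p)`. -/
def consOver (A P c a x z p w y q : Bld) : Bld :=
  IdElim (FF A) x
    (fun z p => Pi (P ⬝ z) fun y => PathOver (FF A) P x z p w y ⇾
      PathOver (FF A) P (Fcons A a x) (Fcons A a z) (apCons A a x z p)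
        (c ⬝ a ⬝ x ⬝ w) (c ⬝ a ⬝ z ⬝ y))
    (Lam fun y => Lam fun q => apf (P ⬝ x) (P ⬝ Fcons A a x) (c ⬝ a ⬝ x) w y q)
    z p ⬝ y ⬝ q

/-- For a path `q` from `w` to `v` over `ap_{cons_a}(μ₁(a, x))`, the corresponding path over
`μ₂(a, cons_a x)`, obtained by transport along `μ(a, x)`. -/
def trMu (A P a x w v q : Bld) : Bld :=
  let y := Fcons A a x
  let z := Fcons A a (Ficons A a y)
  tr (Id (FF A) z y) (Lam fun p => PathOver (FF A) P z y p w v)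
    (apCons A a (Ficons A a y) x (Fmu1 A a x)) (Fmu2 A a y) (Fmu A a x) q

/-- The hypotheses of the induction principle of `F A` for a family `P` over `F A`, followed by the
type `k A P u c d m₁ m₂ m`. -/
def fHyps (i j : ℕ) (k : Bld → Bld → Bld → Bld → Bld → Bld → Bld → Bld → Bld) : Bld :=
  Pi (U i) fun A =>
  Pi (FF A ⇾ U j) fun P =>
  Pi (P ⬝ Funit A) fun u =>
  Pi (Pi A fun a => Pi (FF A) fun x => P ⬝ x ⇾ P ⬝ Fcons A a x) fun c =>
  Pi (Pi A fun a => Pi (FF A) fun x => P ⬝ x ⇾ P ⬝ Ficons A a x) fun d =>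
  Pi (Pi A fun a => Pi (FF A) fun x => Pi (P ⬝ x) fun y =>
    PathOver (FF A) P (Ficons A a (Fcons A a x)) x (Fmu1 A a x)
      (d ⬝ a ⬝ Fcons A a x ⬝ (c ⬝ a ⬝ x ⬝ y)) y) fun m1 =>
  Pi (Pi A fun a => Pi (FF A) fun x => Pi (P ⬝ x) fun y =>
    PathOver (FF A) P (Fcons A a (Ficons A a x)) x (Fmu2 A a x)
      (c ⬝ a ⬝ Ficons A a x ⬝ (d ⬝ a ⬝ x ⬝ y)) y) fun m2 =>
  Pi (Pi A fun a => Pi (FF A) fun x => Pi (P ⬝ x) fun y =>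
    let x' := Ficons A a (Fcons A a x)
    let y' := d ⬝ a ⬝ Fcons A a x ⬝ (c ⬝ a ⬝ x ⬝ y)
    Id (PathOver (FF A) P (Fcons A a x') (Fcons A a x) (Fmu2 A a (Fcons A a x))
          (c ⬝ a ⬝ x' ⬝ y') (c ⬝ a ⬝ x ⬝ y))
      (trMu A P a x (c ⬝ a ⬝ x' ⬝ y') (c ⬝ a ⬝ x ⬝ y)
        (consOver A P c a x' x (Fmu1 A a x) y' y (m1 ⬝ a ⬝ x ⬝ y)))
      (m2 ⬝ a ⬝ Fcons A a x ⬝ (c ⬝ a ⬝ x ⬝ y))) fun m =>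
  k A P u c d m1 m2 m

def fElimType (i j : ℕ) : Bld :=
  fHyps i j fun A P _ _ _ _ _ _ => Pi (FF A) fun x => P ⬝ x

/-- The function defined by induction. -/
def Find (A P u c d m1 m2 m : Bld) : Bld := cst .fElim ⬝ A ⬝ P ⬝ u ⬝ c ⬝ d ⬝ m1 ⬝ m2 ⬝ m

/-- Computation rule for `μ₁`: `apd_f(μ₁(a, x)) = m₁ a x (f x)`. -/
def fElimMu1Type (i j : ℕ) : Bld :=
  fHyps i j fun A P u c d m1 m2 m =>
    let f := Find A P u c d m1 m2 m
    Pi A fun a => Pi (FF A) fun x =>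
      let x' := Ficons A a (Fcons A a x)
      Id (PathOver (FF A) P x' x (Fmu1 A a x) (f ⬝ x') (f ⬝ x))
        (apd (FF A) P f x' x (Fmu1 A a x)) (m1 ⬝ a ⬝ x ⬝ (f ⬝ x))

/-- Computation rule for `μ₂`: `apd_f(μ₂(a, x)) = m₂ a x (f x)`. -/
def fElimMu2Type (i j : ℕ) : Bld :=
  fHyps i j fun A P u c d m1 m2 m =>
    let f := Find A P u c d m1 m2 m
    Pi A fun a => Pi (FF A) fun x =>
      let x' := Fcons A a (Ficons A a x)
      Id (PathOver (FF A) P x' x (Fmu2 A a x) (f ⬝ x') (f ⬝ x))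
        (apd (FF A) P f x' x (Fmu2 A a x)) (m2 ⬝ a ⬝ x ⬝ (f ⬝ x))

/-- `consOver (apd_f(p)) = apd_f(ap_{cons_a}(p))`, for a function `f` with
`f (cons_a x) ≡ c a x (f x)`. -/
def consOverApd (A P c f a x z p : Bld) : Bld :=
  IdElim (FF A) x
    (fun z p => Id
      (PathOver (FF A) P (Fcons A a x) (Fcons A a z) (apCons A a x z p)
        (f ⬝ Fcons A a x) (f ⬝ Fcons A a z))
      (consOver A P c a x z p (f ⬝ x) (f ⬝ z) (apd (FF A) P f x z p))
      (apd (FF A) P f (Fcons A a x) (Fcons A a z) (apCons A a x z p)))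
    (Refl (Id (P ⬝ Fcons A a x) (f ⬝ Fcons A a x) (f ⬝ Fcons A a x))
      (Refl (P ⬝ Fcons A a x) (f ⬝ Fcons A a x)))
    z p

/-- Computation rule for `μ`: up to the computation rules for `μ₁` and `μ₂`, the action of `f` on
`μ(a, x)` is `m a x (f x)`. -/
def fElimMuType (i j : ℕ) : Bld :=
  fHyps i j fun A P u c d m1 m2 m =>
    let f := Find A P u c d m1 m2 m
    Pi A fun a => Pi (FF A) fun x =>
      let y := Fcons A a x
      let x' := Ficons A a y
      let y' := Fcons A a x'
      let p1 := Fmu1 A a x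
      let p2 := Fmu2 A a y
      let over1 := PathOver (FF A) P x' x p1 (f ⬝ x') (f ⬝ x)
      let overAp := PathOver (FF A) P y' y (apCons A a x' x p1) (f ⬝ y') (f ⬝ y)
      let over2 := PathOver (FF A) P y' y p2 (f ⬝ y') (f ⬝ y)
      let T := fun q => trMu A P a x (f ⬝ y') (f ⬝ y) q
      let Tc := fun q => T (consOver A P c a x' x p1 (f ⬝ x') (f ⬝ x) q)
      let apd1 := apd (FF A) P f x' x p1
      let apdAp := apd (FF A) P f y' y (apCons A a x' x p1)
      let apd2 := apd (FF A) P f y' y p2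
      let r1 := m1 ⬝ a ⬝ x ⬝ (f ⬝ x)
      let r2 := m2 ⬝ a ⬝ y ⬝ (f ⬝ y)
      let beta1 := cst .fElimMu1 ⬝ A ⬝ P ⬝ u ⬝ c ⬝ d ⬝ m1 ⬝ m2 ⬝ m ⬝ a ⬝ x
      let beta2 := cst .fElimMu2 ⬝ A ⬝ P ⬝ u ⬝ c ⬝ d ⬝ m1 ⬝ m2 ⬝ m ⬝ a ⬝ y
      -- the action of `f` on `μ(a, x)`, a path from `Tc apd1` to `apd2`
      let act := concat over2 (Tc apd1) (T apdAp) apd2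
        (apf overAp over2 (Lam T) (consOver A P c a x' x p1 (f ⬝ x') (f ⬝ x) apd1) apdAp
          (consOverApd A P c f a x' x p1))
        (apd (Id (FF A) y' y) (Lam fun p => PathOver (FF A) P y' y p (f ⬝ y') (f ⬝ y))
          (Lam fun p => apd (FF A) P f y' y p) (apCons A a x' x p1) p2 (Fmu A a x))
      Id (Id over2 (Tc apd1) r2)
        (concat over2 (Tc apd1) (Tc r1) r2
          (apf over1 over2 (Lam Tc) apd1 r1 beta1) (m ⬝ a ⬝ x ⬝ (f ⬝ x)))
        (concat over2 (Tc apd1) apd2 r2 act beta2)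

/-! ### The set-truncated free group: constructors and induction principle -/

def GG (A : Bld) : Bld := cst .FG ⬝ A
def Geta (A a : Bld) : Bld := cst .geta ⬝ A ⬝ a
def Gmul (A x y : Bld) : Bld := cst .gmul ⬝ A ⬝ x ⬝ y
def Gone (A : Bld) : Bld := cst .gone ⬝ A
def Ginv (A x : Bld) : Bld := cst .ginv ⬝ A ⬝ x

/-- Induction into families of sets. -/
def gElimType (i j : ℕ) : Bld :=
  Pi (U i) fun A =>
  Pi (GG A ⇾ U j) fun P =>
  Pi (Pi (GG A) fun x => IsSet (P ⬝ x)) fun _ =>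
  Pi (Pi A fun a => P ⬝ Geta A a) fun _ =>
  Pi (Pi (GG A) fun x => Pi (GG A) fun y => P ⬝ x ⇾ P ⬝ y ⇾ P ⬝ Gmul A x y) fun m =>
  Pi (P ⬝ Gone A) fun e =>
  Pi (Pi (GG A) fun x => P ⬝ x ⇾ P ⬝ Ginv A x) fun i =>
  Pi (Pi (GG A) fun x => Pi (GG A) fun y => Pi (GG A) fun z =>
    Pi (P ⬝ x) fun u => Pi (P ⬝ y) fun v => Pi (P ⬝ z) fun w =>
    PathOver (GG A) P (Gmul A x (Gmul A y z)) (Gmul A (Gmul A x y) z)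
      (cst .gassoc ⬝ A ⬝ x ⬝ y ⬝ z)
      (m ⬝ x ⬝ Gmul A y z ⬝ u ⬝ (m ⬝ y ⬝ z ⬝ v ⬝ w))
      (m ⬝ Gmul A x y ⬝ z ⬝ (m ⬝ x ⬝ y ⬝ u ⬝ v) ⬝ w)) fun _ =>
  Pi (Pi (GG A) fun x => Pi (P ⬝ x) fun u =>
    PathOver (GG A) P (Gmul A x (Gone A)) x (cst .gmulOne ⬝ A ⬝ x)
      (m ⬝ x ⬝ Gone A ⬝ u ⬝ e) u) fun _ =>
  Pi (Pi (GG A) fun x => Pi (P ⬝ x) fun u =>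
    PathOver (GG A) P (Gmul A (Gone A) x) x (cst .goneMul ⬝ A ⬝ x)
      (m ⬝ Gone A ⬝ x ⬝ e ⬝ u) u) fun _ =>
  Pi (Pi (GG A) fun x => Pi (P ⬝ x) fun u =>
    PathOver (GG A) P (Gmul A x (Ginv A x)) (Gone A) (cst .gmulInv ⬝ A ⬝ x)
      (m ⬝ x ⬝ Ginv A x ⬝ u ⬝ (i ⬝ x ⬝ u)) e) fun _ =>
  Pi (Pi (GG A) fun x => Pi (P ⬝ x) fun u =>
    PathOver (GG A) P (Gmul A (Ginv A x) x) (Gone A) (cst .ginvMul ⬝ A ⬝ x)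
      (m ⬝ Ginv A x ⬝ x ⬝ (i ⬝ x ⬝ u) ⬝ u) e) fun _ =>
  Pi (GG A) fun x => P ⬝ x

/-! ### The types of the constants -/

/-- The type of a constant; `i` is the level of its parameters and `j` that of the family into
which an eliminator eliminates. -/
def constType (i j : ℕ) : Const → Bld
  | .empty => U i
  | .emptyElim => Pi (cst .empty ⇾ U j) fun C => Pi (cst .empty) fun x => C ⬝ x
  | .unit => U i
  | .star => cst .unit
  | .unitElim => Pi (cst .unit ⇾ U j) fun C => C ⬝ cst .star ⇾ Pi (cst .unit) fun x => C ⬝ x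
  | .nat => U i
  | .zero => cst .nat
  | .succ => cst .nat ⇾ cst .nat
  | .natElim => Pi (cst .nat ⇾ U j) fun C => C ⬝ cst .zero ⇾
      (Pi (cst .nat) fun n => C ⬝ n ⇾ C ⬝ (cst .succ ⬝ n)) ⇾ Pi (cst .nat) fun n => C ⬝ n
  | .sum => U i ⇾ U i ⇾ U i
  | .inl => Pi (U i) fun A => Pi (U i) fun B => A ⇾ cst .sum ⬝ A ⬝ B
  | .inr => Pi (U i) fun A => Pi (U i) fun B => B ⇾ cst .sum ⬝ A ⬝ B
  | .sumElim => Pi (U i) fun A => Pi (U i) fun B => Pi (cst .sum ⬝ A ⬝ B ⇾ U j) fun C =>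
      (Pi A fun a => C ⬝ (cst .inl ⬝ A ⬝ B ⬝ a)) ⇾
      (Pi B fun b => C ⬝ (cst .inr ⬝ A ⬝ B ⬝ b)) ⇾ Pi (cst .sum ⬝ A ⬝ B) fun x => C ⬝ x
  | .sigma => Pi (U i) fun A => (A ⇾ U i) ⇾ U i
  | .pair => Pi (U i) fun A => Pi (A ⇾ U i) fun B => Pi A fun a => B ⬝ a ⇾ cst .sigma ⬝ A ⬝ B
  | .sigmaElim => Pi (U i) fun A => Pi (A ⇾ U i) fun B => Pi (cst .sigma ⬝ A ⬝ B ⇾ U j) fun C =>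
      (Pi A fun a => Pi (B ⬝ a) fun b => C ⬝ (cst .pair ⬝ A ⬝ B ⬝ a ⬝ b)) ⇾
      Pi (cst .sigma ⬝ A ⬝ B) fun p => C ⬝ p
  | .id => Pi (U i) fun A => A ⇾ A ⇾ U i
  | .refl => Pi (U i) fun A => Pi A fun x => Id A x x
  | .idElim => Pi (U i) fun A => Pi A fun x => Pi (Pi A fun y => Id A x y ⇾ U j) fun C =>
      C ⬝ x ⬝ Refl A x ⇾ Pi A fun y => Pi (Id A x y) fun p => C ⬝ y ⬝ p
  | .list => U i ⇾ U i
  | .nil => Pi (U i) fun A => cst .list ⬝ A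
  | .cons => Pi (U i) fun A => A ⇾ cst .list ⬝ A ⇾ cst .list ⬝ A
  | .listElim => Pi (U i) fun A => Pi (cst .list ⬝ A ⇾ U j) fun C => C ⬝ (cst .nil ⬝ A) ⇾
      (Pi A fun a => Pi (cst .list ⬝ A) fun l => C ⬝ l ⇾ C ⬝ (cst .cons ⬝ A ⬝ a ⬝ l)) ⇾
      Pi (cst .list ⬝ A) fun l => C ⬝ l
  | .funext => Pi (U i) fun A => Pi (A ⇾ U i) fun B =>
      Pi (Pi A fun x => B ⬝ x) fun f => Pi (Pi A fun x => B ⬝ x) fun g =>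
      IsEquiv (Id (Pi A fun x => B ⬝ x) f g) (Pi A fun x => Id (B ⬝ x) (f ⬝ x) (g ⬝ x))
        (happly A B f g)
  | .univalence l => Pi (U l) fun A => Pi (U l) fun B =>
      IsEquiv (Id (U l) A B) (Equivalence A B) (idToEquivalence l A B)
  | .F => U i ⇾ U i
  | .funit => Pi (U i) fun A => FF A
  | .fcons => Pi (U i) fun A => A ⇾ FF A ⇾ FF A
  | .ficons => Pi (U i) fun A => A ⇾ FF A ⇾ FF A
  | .fmu1 => Pi (U i) fun A => Pi A fun a => Pi (FF A) fun x =>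
      Id (FF A) (Ficons A a (Fcons A a x)) x
  | .fmu2 => Pi (U i) fun A => Pi A fun a => Pi (FF A) fun x =>
      Id (FF A) (Fcons A a (Ficons A a x)) x
  | .fmu => Pi (U i) fun A => Pi A fun a => Pi (FF A) fun x =>
      Id (Id (FF A) (Fcons A a (Ficons A a (Fcons A a x))) (Fcons A a x))
        (apCons A a (Ficons A a (Fcons A a x)) x (Fmu1 A a x)) (Fmu2 A a (Fcons A a x))
  | .fElim => fElimType i j
  | .fElimMu1 => fElimMu1Type i j
  | .fElimMu2 => fElimMu2Type i j
  | .fElimMu => fElimMuType i j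
  | .FG => U i ⇾ U i
  | .geta => Pi (U i) fun A => A ⇾ GG A
  | .gmul => Pi (U i) fun A => GG A ⇾ GG A ⇾ GG A
  | .gone => Pi (U i) fun A => GG A
  | .ginv => Pi (U i) fun A => GG A ⇾ GG A
  | .gassoc => Pi (U i) fun A => Pi (GG A) fun x => Pi (GG A) fun y => Pi (GG A) fun z =>
      Id (GG A) (Gmul A x (Gmul A y z)) (Gmul A (Gmul A x y) z)
  | .gmulOne => Pi (U i) fun A => Pi (GG A) fun x => Id (GG A) (Gmul A x (Gone A)) x
  | .goneMul => Pi (U i) fun A => Pi (GG A) fun x => Id (GG A) (Gmul A (Gone A) x) x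
  | .gmulInv => Pi (U i) fun A => Pi (GG A) fun x => Id (GG A) (Gmul A x (Ginv A x)) (Gone A)
  | .ginvMul => Pi (U i) fun A => Pi (GG A) fun x => Id (GG A) (Gmul A (Ginv A x) x) (Gone A)
  | .gtrunc => Pi (U i) fun A => IsSet (GG A)
  | .gElim => gElimType i j

/-! ### The typing judgement -/

/-- `HasType Γ t A` is the judgement `Γ ⊢ t : A`.  The last entry of a context stands at the head
of the list.  Contexts that arise in a derivation from the empty context are well formed. -/
inductive HasType : List Tm → Tm → Tm → Prop
  | var {Γ : List Tm} {n : ℕ} {A : Tm} :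
      Γ[n]? = some A → HasType Γ (.var n) (A.rename (· + (n + 1)))
  | const {Γ : List Tm} (c : Const) (i j : ℕ) : HasType Γ (.const c) (constType i j c 0)
  | univ {Γ : List Tm} (l : ℕ) : HasType Γ (.univ l) (.univ (l + 1))
  | cumul {Γ : List Tm} {A : Tm} {l : ℕ} : HasType Γ A (.univ l) → HasType Γ A (.univ (l + 1))
  | pi {Γ : List Tm} {A B : Tm} {l : ℕ} :
      HasType Γ A (.univ l) → HasType (A :: Γ) B (.univ l) → HasType Γ (.pi A B) (.univ l)
  | lam {Γ : List Tm} {A B b : Tm} {l : ℕ} :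
      HasType Γ A (.univ l) → HasType (A :: Γ) b B → HasType Γ (.lam b) (.pi A B)
  | app {Γ : List Tm} {A B f a : Tm} :
      HasType Γ f (.pi A B) → HasType Γ a A → HasType Γ (.app f a) (B.inst a)
  | conv {Γ : List Tm} {A B t : Tm} {l : ℕ} :
      HasType Γ t A → HasType Γ B (.univ l) → Conv A B → HasType Γ t B

/-- The type `T` is inhabited: `⊢ t : T` is derivable for some closed term `t`. -/
def Provable (T : Bld) : Prop := ∃ t : Tm, HasType [] t (T 0)

/-! ### Lists in normal form -/

/-- Elements of `A` with a sign; `inl a` stands for `a`, and `inr a` for its inverse. -/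
def Signed (A : Bld) : Bld := cst .sum ⬝ A ⬝ A

/-- Change of sign. -/
def flip (A s : Bld) : Bld :=
  cst .sumElim ⬝ A ⬝ A ⬝ (Lam fun _ => Signed A) ⬝ (Lam fun a => cst .inr ⬝ A ⬝ A ⬝ a) ⬝
    (Lam fun a => cst .inl ⬝ A ⬝ A ⬝ a) ⬝ s

def Words (A : Bld) : Bld := cst .list ⬝ Signed A
def consWord (A s w : Bld) : Bld := cst .cons ⬝ Signed A ⬝ s ⬝ w

/-- Concatenation `v w`. -/
def append (A v w : Bld) : Bld :=
  cst .listElim ⬝ Signed A ⬝ (Lam fun _ => Words A) ⬝ w ⬝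
    (Lam fun s => Lam fun _ => Lam fun r => consWord A s r) ⬝ v

/-- `w` contains no redex: it is not of the form `x s s⁻¹ y`. -/
def IsNormal (A w : Bld) : Bld :=
  Pi (Words A) fun x => Pi (Signed A) fun s => Pi (Words A) fun y =>
    Id (Words A) w (append A x (consWord A s (consWord A (flip A s) y))) ⇾ cst .empty

/-- The type of lists in normal form. -/
def NormalWords (A : Bld) : Bld := Sig (Words A) fun w => IsNormal A w

/-- The element of `F A` that a list represents. -/
def evalWord (A w : Bld) : Bld :=
  cst .listElim ⬝ Signed A ⬝ (Lam fun _ => FF A) ⬝ Funit A ⬝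
    (Lam fun s => Lam fun _ => Lam fun r =>
      cst .sumElim ⬝ A ⬝ A ⬝ (Lam fun _ => FF A) ⬝ (Lam fun a => Fcons A a r) ⬝
        (Lam fun a => Ficons A a r) ⬝ s) ⬝ w

/-- The map from lists in normal form to `F A`. -/
def evalNormal (A : Bld) : Bld :=
  Lam fun p => evalWord A (Fst (Words A) (fun w => IsNormal A w) p)

/-! ### The canonical equivalence -/

/-- The type of triples: a map `h : F A → FG A` that is an equivalence, with proofs of
`h unit = e` and of `h (cons_a x) = η(a) · h x`. -/
def CanonicalEquivalence (A : Bld) : Bld :=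
  Sig (FF A ⇾ GG A) fun h =>
    Prod (IsEquiv (FF A) (GG A) h)
      (Prod (Id (GG A) (h ⬝ Funit A) (Gone A))
        (Pi A fun a => Pi (FF A) fun x =>
          Id (GG A) (h ⬝ Fcons A a x) (Gmul A (Geta A a) (h ⬝ x))))

end HoTT

/-!
# Decidable equality and normal forms for the free infinity-group

The type theory is given by the inductive relation `HasType`. We prove that it is closed under
substitution and under raising universe levels, and write a type checker that is sound for it. Then
we write the proofs in the type theory as terms, from path induction to the equivalence of the free
infinity-group with the free group; each term is accepted by the type checker, which the kernel
evaluates. The proofs concern types in the lowest universe, and are transferred to the others by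
raising levels.
-/

namespace HoTT

namespace Tm

/-! ### Renaming and substitution -/

/-! The difficulty is that `F A` is untruncated, so an identity between its elements cannot be
proved by merely checking constructors: every choice of paths must respect `μ`. The argument
compares `F A` with normal words before knowing that it is a set.

A letter acts on words by `step`, which cancels it against the first letter or prepends it; deciding
which requires decidable equality. The action preserves normal forms, and there the actions of a
letter and of its inverse are mutually inverse (`stepStep`). Normal words inherit decidable
equality, hence form a set by Hedberg's argument (`isSetOfConst`, `isSetOfDecEq`). In a set the
clause for `μ` is automatic (`setMu`), so recursion yields the map `normalForm` from `F A` to normal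
words. Evaluating a normal word and normalising returns the word, by induction on it.

For the other composite, let `P x` be the type of paths from the evaluated normal form of `x` to
`x`. Evaluation turns `step` into the action of the letter (`evalStep`), and `cons_a` is an
equivalence, so univalence identifies `P x` with `P (cons_a x)`. The induction principle
`freeIndOfPath` then needs only an element of `P unit`. It comes from `freeInd`: if the maps `P x →
P (cons_a x)` are split surjective, also on paths, all remaining data for induction can be chosen,
with `m₁` and `m` obtained together by lifting `m₂` back through `μ`. No coherence is computed by
hand.

Thus `F A` is a retract of normal words, so it has decidable equality and is a set, and evaluation
is an equivalence. Concatenation and inversion, defined by recursion, make it a group; the universal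
maps to and from `F₀ A` are homomorphisms and mutually inverse, because it suffices to compare them
on generators and operations.

For derivability in the formal system, the proofs are raw terms verified by a checker proved sound
(`typing_sound`). The types indexing `Pf` are only annotations; `Pf.cast` adds no assumption, since
the checker examines the underlying term. Proved lemmas become variables of a growing context, so
later checks do not unfold them, and are eliminated at the end by β-redexes
(`Derivable.exists_hasType`). Raising levels (`HasType.shift`) transfers the result from the lowest
universe to all others. -/

theorem upr_comp (r s : ℕ → ℕ) : upr r ∘ upr s = upr (r ∘ s) := by
  funext n; cases n <;> rfl

theorem rename_rename (r s : ℕ → ℕ) (t : Tm) : (t.rename s).rename r = t.rename (r ∘ s) := by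
  induction t generalizing r s with
  | pi A B hA hB => simp [rename, hA, hB, upr_comp]
  | lam b hb => simp [rename, hb, upr_comp]
  | app f a hf ha => simp [rename, hf, ha]
  | _ => simp [rename]

theorem ups_comp_upr (s : ℕ → Tm) (r : ℕ → ℕ) : ups s ∘ upr r = ups (s ∘ r) := by
  funext n; cases n <;> rfl

theorem subst_rename (s : ℕ → Tm) (r : ℕ → ℕ) (t : Tm) :
    (t.rename r).subst s = t.subst (s ∘ r) := by
  induction t generalizing r s with
  | pi A B hA hB => simp [rename, subst, hA, hB, ups_comp_upr]
  | lam b hb => simp [rename, subst, hb, ups_comp_upr]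
  | app f a hf ha => simp [rename, subst, hf, ha]
  | _ => simp [rename, subst]

theorem rename_ups (r : ℕ → ℕ) (s : ℕ → Tm) :
    (fun n => (ups s n).rename (upr r)) = ups fun n => (s n).rename r := by
  funext n
  cases n with
  | zero => rfl
  | succ n => simp only [ups, rename_rename]; rfl

theorem rename_subst (r : ℕ → ℕ) (s : ℕ → Tm) (t : Tm) :
    (t.subst s).rename r = t.subst fun n => (s n).rename r := by
  induction t generalizing r s with
  | pi A B hA hB => simp [rename, subst, hA, hB, rename_ups]
  | lam b hb => simp [rename, subst, hb, rename_ups]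
  | app f a hf ha => simp [rename, subst, hf, ha]
  | _ => simp [rename, subst]

theorem subst_ups (s u : ℕ → Tm) :
    (fun n => (ups u n).subst (ups s)) = ups fun n => (u n).subst s := by
  funext n
  cases n with
  | zero => rfl
  | succ n => simp only [ups, subst_rename, rename_subst]; rfl

theorem subst_subst (s u : ℕ → Tm) (t : Tm) :
    (t.subst u).subst s = t.subst fun n => (u n).subst s := by
  induction t generalizing u s with
  | pi A B hA hB => simp [subst, hA, hB, subst_ups]
  | lam b hb => simp [subst, hb, subst_ups]
  | app f a hf ha => simp [subst, hf, ha]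
  | _ => simp [subst]

theorem ups_var : ups var = var := by
  funext n; cases n <;> rfl

theorem subst_var (t : Tm) : t.subst var = t := by
  induction t <;> simp_all [subst, ups_var]

theorem upr_eq_ups (r : ℕ → ℕ) : (fun n => var (upr r n)) = ups fun n => var (r n) := by
  funext n; cases n <;> rfl

theorem rename_eq_subst (r : ℕ → ℕ) (t : Tm) : t.rename r = t.subst fun n => var (r n) := by
  induction t generalizing r <;> simp_all [subst, rename, upr_eq_ups]

theorem inst_rename_succ (t a : Tm) : (t.rename Nat.succ).inst a = t := by
  rw [inst, subst_rename]; exact subst_var t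

theorem subst_inst (b a : Tm) (s : ℕ → Tm) :
    (b.inst a).subst s = (b.subst (ups s)).inst (a.subst s) := by
  rw [inst, inst, subst_subst, subst_subst]
  congr 1; funext n
  cases n with
  | zero => rfl
  | succ n => exact (inst_rename_succ (s n) _).symm

theorem subst_rename_succ (t : Tm) (s : ℕ → Tm) :
    (t.rename Nat.succ).subst (ups s) = (t.subst s).rename Nat.succ := by
  rw [subst_rename, rename_subst]; rfl

theorem subst_foldl (s : ℕ → Tm) (as : List Tm) (t : Tm) :
    (as.foldl app t).subst s = (as.map (subst s)).foldl app (t.subst s) := by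
  induction as generalizing t with
  | nil => rfl
  | cons a as h => exact h _

theorem subst_apps (s : ℕ → Tm) (c : Const) (as : List Tm) :
    (apps c as).subst s = apps c (as.map (subst s)) := subst_foldl s as _

/-! ### Closed terms -/

/-- All free variables are less than `k`. -/
def closedAt : ℕ → Tm → Bool
  | k, var n => Nat.ble (n + 1) k
  | _, univ _ => true
  | k, pi A B => closedAt k A && closedAt (k + 1) B
  | k, lam b => closedAt (k + 1) b
  | k, app f a => closedAt k f && closedAt k a
  | _, const _ => true

theorem subst_of_closedAt {k : ℕ} {t : Tm} (h : closedAt k t = true) {s : ℕ → Tm}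
    (hs : ∀ n < k, s n = var n) : t.subst s = t := by
  have up : ∀ {k : ℕ} {s : ℕ → Tm}, (∀ n < k, s n = var n) → ∀ n < k + 1, ups s n = var n := by
    intro k s hs n hn
    cases n with
    | zero => rfl
    | succ n => simp [ups, hs n (by omega), rename]
  induction t generalizing k s with
  | var n => exact hs n (by simpa [closedAt] using h)
  | pi A B hA hB =>
    simp only [closedAt, Bool.and_eq_true] at h
    simp [subst, hA h.1 hs, hB h.2 (up hs)]
  | lam b hb => simp [subst, hb h (up hs)]
  | app f a hf ha =>
    simp only [closedAt, Bool.and_eq_true] at h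
    simp [subst, hf h.1 hs, ha h.2 hs]
  | _ => rfl

end Tm

open Tm

theorem constType_closed (i j : ℕ) (c : Const) : closedAt 0 (constType i j c 0) = true := by
  cases c <;> rfl

/-- Closedness makes the typing rule for constants stable under renaming and substitution. -/
theorem constType_subst (i j : ℕ) (c : Const) (s : ℕ → Tm) :
    (constType i j c 0).subst s = constType i j c 0 :=
  subst_of_closedAt (constType_closed i j c) fun _ h => absurd h (Nat.not_lt_zero _)

theorem Comp.subst {t u : Tm} (h : Comp t u) (s : ℕ → Tm) : Comp (t.subst s) (u.subst s) := by
  cases h <;> simp only [Tm.subst, subst_apps, List.map] <;> constructor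

theorem Conv.subst {t u : Tm} (h : Conv t u) (s : ℕ → Tm) : Conv (t.subst s) (u.subst s) := by
  induction h generalizing s with
  | rfl t => exact .rfl _
  | symm _ h => exact .symm (h s)
  | trans _ _ h₁ h₂ => exact .trans (h₁ s) (h₂ s)
  | pi _ _ h₁ h₂ => exact .pi (h₁ s) (h₂ _)
  | lam _ h => exact .lam (h _)
  | app _ _ h₁ h₂ => exact .app (h₁ s) (h₂ s)
  | beta b a => rw [subst_inst]; exact .beta _ _
  | eta t =>
    have := Conv.eta (t.subst s)
    rwa [← subst_rename_succ] at this
  | comp h => exact .comp (h.subst s)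

/-! ### Substitution preserves typing -/

/-- `r` renames the variables of `Γ` to variables of `Δ` of the same type. -/
def Renames (r : ℕ → ℕ) (Γ Δ : List Tm) : Prop :=
  ∀ n A, Γ[n]? = some A → ∃ A', Δ[r n]? = some A' ∧
    A'.rename (· + (r n + 1)) = (A.rename (· + (n + 1))).rename r

theorem Renames.upr {r : ℕ → ℕ} {Γ Δ : List Tm} (h : Renames r Γ Δ) (A : Tm) :
    Renames (upr r) (A :: Γ) (A.rename r :: Δ) := by
  rintro (_ | n) B hB
  · obtain rfl : A = B := by simpa using hB
    refine ⟨A.rename r, rfl, ?_⟩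
    rw [rename_rename, rename_rename]; rfl
  · obtain ⟨B', h₁, h₂⟩ := h n B (by simpa using hB)
    refine ⟨B', by simpa [Tm.upr] using h₁, ?_⟩
    have := congrArg (rename Nat.succ) h₂
    simp only [rename_rename] at this ⊢
    exact this

/-- Renaming has to precede substitution: a substitution pushed under a binder has its values
weakened, and `Substs.ups` needs these to remain well typed. -/
theorem HasType.rename {Γ : List Tm} {t A : Tm} (h : HasType Γ t A) {r : ℕ → ℕ} {Δ : List Tm}
    (hr : Renames r Γ Δ) : HasType Δ (t.rename r) (A.rename r) := by
  induction h generalizing r Δ with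
  | var h =>
    obtain ⟨A', h₁, h₂⟩ := hr _ _ h
    rw [← h₂]; exact .var h₁
  | const c i j => rw [rename_eq_subst r (constType i j c 0), constType_subst]; exact .const c i j
  | univ l => exact .univ l
  | cumul _ h => exact .cumul (h hr)
  | pi _ _ h₁ h₂ => exact .pi (h₁ hr) (h₂ (hr.upr _))
  | lam _ _ h₁ h₂ => exact .lam (h₁ hr) (h₂ (hr.upr _))
  | app _ _ h₁ h₂ =>
    have := HasType.app (h₁ hr) (h₂ hr)
    simpa only [rename_eq_subst, subst_inst, upr_eq_ups, Tm.subst] using this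
  | conv _ _ h h₁ h₂ => exact .conv (h₁ hr) (h₂ hr) (by simpa only [rename_eq_subst] using h.subst _)

theorem HasType.weaken {Γ : List Tm} {t A : Tm} (h : HasType Γ t A) (B : Tm) :
    HasType (B :: Γ) (t.rename Nat.succ) (A.rename Nat.succ) :=
  h.rename fun n C hC => ⟨C, by simpa using hC, by rw [rename_rename]; rfl⟩

/-- `s` substitutes terms in context `Δ` for the variables of `Γ`. -/
def Substs (s : ℕ → Tm) (Γ Δ : List Tm) : Prop :=
  ∀ n A, Γ[n]? = some A → HasType Δ (s n) ((A.rename (· + (n + 1))).subst s)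

theorem Substs.ups {s : ℕ → Tm} {Γ Δ : List Tm} (h : Substs s Γ Δ) (A : Tm) :
    Substs (ups s) (A :: Γ) (A.subst s :: Δ) := by
  rintro (_ | n) B hB
  · obtain rfl : A = B := by simpa using hB
    have := subst_rename_succ A s
    rw [show (fun x : ℕ => x + (0 + 1)) = Nat.succ from rfl, this]
    exact HasType.var (n := 0) rfl
  · have := (h n B (by simpa using hB)).weaken (A.subst s)
    rw [← subst_rename_succ, rename_rename] at this
    exact this

theorem HasType.subst {Γ : List Tm} {t A : Tm} (h : HasType Γ t A) {s : ℕ → Tm} {Δ : List Tm}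
    (hs : Substs s Γ Δ) : HasType Δ (t.subst s) (A.subst s) := by
  induction h generalizing s Δ with
  | var h => exact hs _ _ h
  | const c i j => rw [constType_subst]; exact .const c i j
  | univ l => exact .univ l
  | cumul _ h => exact .cumul (h hs)
  | pi _ _ h₁ h₂ => exact .pi (h₁ hs) (h₂ (hs.ups _))
  | lam _ _ h₁ h₂ => exact .lam (h₁ hs) (h₂ (hs.ups _))
  | app _ _ h₁ h₂ => rw [subst_inst]; exact .app (h₁ hs) (h₂ hs)
  | conv _ _ h h₁ h₂ => exact .conv (h₁ hs) (h₂ hs) (h.subst s)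

theorem HasType.inst {Γ : List Tm} {A t T a : Tm} (h : HasType (A :: Γ) t T)
    (ha : HasType Γ a A) : HasType Γ (t.inst a) (T.inst a) := by
  refine h.subst ?_
  rintro (_ | n) B hB
  · obtain rfl : A = B := by simpa using hB
    rw [subst_rename]
    exact (subst_var A).symm ▸ ha
  · rw [subst_rename]
    have := HasType.var (Γ := Γ) (n := n) (A := B) (by simpa using hB)
    rw [rename_eq_subst] at this
    exact this

/-! ### Well-formed types and contexts -/

/-- `A` is a type in context `Γ`. -/
def IsType (Γ : List Tm) (A : Tm) : Prop := ∃ l, HasType Γ A (.univ l)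

inductive WfCtx : List Tm → Prop
  | nil : WfCtx []
  | cons {Γ A} : WfCtx Γ → IsType Γ A → WfCtx (A :: Γ)

theorem HasType.cumul_le {Γ : List Tm} {A : Tm} {l m : ℕ} (h : HasType Γ A (.univ l))
    (hlm : l ≤ m) : HasType Γ A (.univ m) := by
  induction hlm with
  | refl => exact h
  | step _ ih => exact ih.cumul

/-- The rules `cumul` and `conv` change only the type and leave the term alone, so every derivation
for a `Π` contains an application of the formation rule to the same two components. -/
theorem HasType.pi_inv {Γ : List Tm} {A B T : Tm} (h : HasType Γ (.pi A B) T) :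
    IsType Γ A ∧ IsType (A :: Γ) B := by
  generalize ht : Tm.pi A B = t at h
  induction h with
  | pi h₁ h₂ => cases ht; exact ⟨⟨_, h₁⟩, ⟨_, h₂⟩⟩
  | cumul _ h => exact h ht
  | conv _ _ _ h _ => exact h ht
  | _ => cases ht

theorem IsType.univ (Γ : List Tm) (l : ℕ) : IsType Γ (.univ l) := ⟨_, .univ l⟩

theorem IsType.inst {Γ : List Tm} {A B a : Tm} (h : IsType (A :: Γ) B) (ha : HasType Γ a A) :
    IsType Γ (B.inst a) := h.imp fun _ h => h.inst ha

theorem WfCtx.isType {Γ : List Tm} (h : WfCtx Γ) {n : ℕ} {A : Tm} (hA : Γ[n]? = some A) :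
    IsType Γ (A.rename (· + (n + 1))) := by
  induction h generalizing n with
  | nil => simp at hA
  | @cons Γ B hΓ hB ih =>
    cases n with
    | zero =>
      obtain rfl : B = A := by simpa using hA
      exact hB.imp fun _ h => h.weaken B
    | succ n =>
      refine (ih (n := n) (by simpa using hA)).imp fun _ h => ?_
      have := h.weaken B
      rw [rename_rename] at this
      exact this

/-- A type in the empty context is a type in every context. -/
theorem IsType.of_nil {A : Tm} (h : IsType [] A) (Γ : List Tm) :
    IsType Γ A := by
  obtain ⟨l, h⟩ := h
  refine ⟨l, ?_⟩
  have := h.subst (s := Tm.var) (Δ := Γ) (fun n A h => by simp at h)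
  rwa [subst_var A] at this

/-! ### Shifting universe levels -/

/-- Raise the universe levels of a constant by `s`. -/
def Const.shift (s : ℕ) : Const → Const
  | .univalence l => .univalence (s + l)
  | c => c

namespace Tm

/-- Raise all universe levels by `s`. -/
def shift (s : ℕ) : Tm → Tm
  | var n => var n
  | univ l => univ (s + l)
  | pi A B => pi (shift s A) (shift s B)
  | lam b => lam (shift s b)
  | app f a => app (shift s f) (shift s a)
  | const c => const (c.shift s)

theorem shift_rename (s : ℕ) (r : ℕ → ℕ) (t : Tm) : (t.rename r).shift s = (t.shift s).rename r := by
  induction t generalizing r <;> simp_all [shift, rename]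

theorem shift_ups (s : ℕ) (f : ℕ → Tm) : (fun n => (ups f n).shift s) = ups fun n => (f n).shift s := by
  funext n
  cases n with
  | zero => rfl
  | succ n => exact shift_rename s _ _

theorem shift_subst (s : ℕ) (f : ℕ → Tm) (t : Tm) :
    (t.subst f).shift s = (t.shift s).subst fun n => (f n).shift s := by
  induction t generalizing f <;> simp_all [shift, subst, shift_ups]

theorem shift_inst (s : ℕ) (b a : Tm) : (b.inst a).shift s = (b.shift s).inst (a.shift s) := by
  rw [inst, shift_subst, inst]
  congr 1; funext n; cases n <;> rfl

end Tm

/-- Besides its two level parameters, the only level in the type of a constant is that of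
`univalence`, and this is what `Const.shift` adjusts. -/
theorem constType_shift (s i j : ℕ) (c : Const) :
    (constType i j c 0).shift s = constType (s + i) (s + j) (c.shift s) 0 := by
  cases c <;> rfl

theorem Comp.shift {t u : Tm} (h : Comp t u) (s : ℕ) : Comp (t.shift s) (u.shift s) := by
  cases h <;> simp only [Tm.shift, apps, List.foldl, Const.shift] <;> constructor

theorem Conv.shift {t u : Tm} (h : Conv t u) (s : ℕ) : Conv (t.shift s) (u.shift s) := by
  induction h with
  | rfl t => exact .rfl _
  | symm _ h => exact .symm h
  | trans _ _ h₁ h₂ => exact .trans h₁ h₂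
  | pi _ _ h₁ h₂ => exact .pi h₁ h₂
  | lam _ h => exact .lam h
  | app _ _ h₁ h₂ => exact .app h₁ h₂
  | beta b a => rw [shift_inst]; exact .beta _ _
  | eta t =>
    have := Conv.eta (t.shift s)
    rwa [← shift_rename] at this
  | comp h => exact .comp (h.shift s)

theorem HasType.shift {Γ : List Tm} {t A : Tm} (h : HasType Γ t A) (s : ℕ) :
    HasType (Γ.map (Tm.shift s)) (t.shift s) (A.shift s) := by
  induction h with
  | var h => rw [shift_rename]; exact .var (by simp [h])
  | const c i j => rw [constType_shift]; exact .const _ _ _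
  -- Since `s` is added on the left, `s + (l + 1)` is `(s + l) + 1` by definition; the same holds in
  -- the next case.
  | univ l => exact .univ _
  | cumul _ h => exact .cumul h
  | pi _ _ h₁ h₂ => exact .pi h₁ h₂
  | lam _ _ h₁ h₂ => exact .lam h₁ h₂
  | app _ _ h₁ h₂ => rw [shift_inst]; exact .app h₁ h₂
  | conv _ _ h h₁ h₂ => exact .conv h₁ h₂ (h.shift s)

/-! ### A type checker -/

open Tm

/-! ### Codes and ranks of the constants -/

namespace Const

/-- A numbering of the constants. -/
def code : Const → ℕ
  | empty => 0 | emptyElim => 1 | unit => 2 | star => 3 | unitElim => 4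
  | nat => 5 | zero => 6 | succ => 7 | natElim => 8
  | sum => 9 | inl => 10 | inr => 11 | sumElim => 12
  | sigma => 13 | pair => 14 | sigmaElim => 15
  | id => 16 | refl => 17 | idElim => 18
  | list => 19 | nil => 20 | cons => 21 | listElim => 22
  | funext => 23
  | F => 24 | funit => 25 | fcons => 26 | ficons => 27 | fmu1 => 28 | fmu2 => 29 | fmu => 30
  | fElim => 31 | fElimMu1 => 32 | fElimMu2 => 33 | fElimMu => 34
  | FG => 35 | geta => 36 | gmul => 37 | gone => 38 | ginv => 39
  | gassoc => 40 | gmulOne => 41 | goneMul => 42 | gmulInv => 43 | ginvMul => 44 | gtrunc => 45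
  | gElim => 46
  | univalence l => l + 47

def decode (n : ℕ) : Const :=
  [empty, emptyElim, unit, star, unitElim, nat, zero, succ, natElim, sum, inl, inr, sumElim,
    sigma, pair, sigmaElim, id, refl, idElim, list, nil, cons, listElim, funext,
    F, funit, fcons, ficons, fmu1, fmu2, fmu, fElim, fElimMu1, fElimMu2, fElimMu,
    FG, geta, gmul, gone, ginv, gassoc, gmulOne, goneMul, gmulInv, ginvMul, gtrunc,
    gElim].getD n (univalence (n - 47))

/-- Constants can therefore be compared through their numerical codes. -/
theorem decode_code (c : Const) : decode c.code = c := by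
  cases c <;> rfl

/-- The constants that occur in the type of `c` have a smaller rank. -/
def rank : Const → ℕ
  | empty | unit | nat | sum | sigma | id | list | F | FG => 0
  | star | zero | succ | inl | inr | pair | refl | nil | cons => 1
  | funit | fcons | ficons | geta | gmul | gone | ginv => 1
  | emptyElim | unitElim | natElim | sumElim | sigmaElim | idElim | listElim => 2
  | funext | univalence _ | fmu1 | fmu2 => 3
  | gassoc | gmulOne | goneMul | gmulInv | ginvMul | gtrunc => 3
  | fmu => 4
  | fElim | gElim => 5
  | fElimMu1 | fElimMu2 | fElimMu => 6

/-- The constants that the type checker accepts. -/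
def usable : Const → Bool
  | univalence l => Nat.beq l 0
  | fElimMu1 | fElimMu2 | fElimMu => false
  | _ => true

end Const

namespace Tm

def beq : Tm → Tm → Bool
  | var m, var n => Nat.beq m n
  | univ l, univ m => Nat.beq l m
  | pi A B, pi A' B' => beq A A' && beq B B'
  | lam b, lam b' => beq b b'
  | app f a, app f' a' => beq f f' && beq a a'
  | const c, const d => Nat.beq c.code d.code
  | _, _ => false

theorem eq_of_beq {t u : Tm} (h : beq t u = true) : t = u := by
  induction t generalizing u with
  | var n => cases u <;> simp_all [beq]
  | univ n => cases u <;> simp_all [beq]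
  | pi A B hA hB =>
    cases u <;> simp only [beq, Bool.and_eq_true, Bool.false_eq_true] at h
    rw [hA h.1, hB h.2]
  | lam b hb =>
    cases u <;> simp only [beq, Bool.false_eq_true] at h
    rw [hb h]
  | app f a hf ha =>
    cases u <;> simp only [beq, Bool.and_eq_true, Bool.false_eq_true] at h
    rw [hf h.1, ha h.2]
  | const c =>
    cases u <;> simp only [beq, Bool.false_eq_true] at h
    rw [← c.decode_code, Nat.eq_of_beq_eq_true h, Const.decode_code]

/-- Add `n` to the variables from `k` on. -/
def lift (n : ℕ) : ℕ → Tm → Tm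
  | k, var m => match Nat.ble k m with
    | true => var (m + n)
    | false => var m
  | _, univ l => univ l
  | k, pi A B => pi (lift n k A) (lift n (k + 1) B)
  | k, lam b => lam (lift n (k + 1) b)
  | k, app f a => app (lift n k f) (lift n k a)
  | _, const c => const c

/-- The checker carries a numerical cutoff under binders instead of a function on variables; this
and `instAt_eq_subst` relate its operations to those of the typing rules. -/
theorem lift_eq_rename (n k : ℕ) (t : Tm) :
    lift n k t = t.rename fun m => match Nat.ble k m with | true => m + n | false => m := by
  have up : ∀ k, (fun m => match Nat.ble (k + 1) m with | true => m + n | false => m) =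
      upr fun m => match Nat.ble k m with | true => m + n | false => m := by
    intro k; funext m
    cases m with
    | zero => rfl
    | succ m =>
      rw [upr, show Nat.ble (k + 1) (m + 1) = Nat.ble k m from rfl]
      cases Nat.ble k m
      · rfl
      · exact Nat.add_right_comm m 1 n
  induction t generalizing k with
  | var m => rw [lift, rename]; cases Nat.ble k m <;> rfl
  | pi A B hA hB => rw [lift, rename, hA, hB, up]
  | lam b hb => rw [lift, rename, hb, up]
  | app f a hf ha => rw [lift, rename, hf, ha]
  | _ => rfl

theorem lift_zero (n : ℕ) (t : Tm) : lift n 0 t = t.rename (· + n) := by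
  rw [lift_eq_rename]; rfl

/-- The substitution of `a` for the variable `k`. -/
def instAt (a : Tm) : ℕ → Tm → Tm
  | k, var m => match Nat.ble k m with
    | true => match Nat.beq m k with
      | true => lift k 0 a
      | false => var (m - 1)
    | false => var m
  | _, univ l => univ l
  | k, pi A B => pi (instAt a k A) (instAt a (k + 1) B)
  | k, lam b => lam (instAt a (k + 1) b)
  | k, app f b => app (instAt a k f) (instAt a k b)
  | _, const c => const c

theorem instAt_eq_subst (a : Tm) (k : ℕ) (t : Tm) : instAt a k t = t.subst (ups^[k] (single a)) := by
  induction t generalizing k with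
  | var m =>
    rw [instAt, subst, lift_zero]
    induction k generalizing m with
    | zero =>
      cases m with
      | zero => rw [rename_eq_subst]; exact subst_var a
      | succ m => rfl
    | succ k ih =>
      rw [Function.iterate_succ_apply']
      cases m with
      | zero => rfl
      | succ m =>
        rw [ups, ← ih m, show Nat.ble (k + 1) (m + 1) = Nat.ble k m from rfl,
          show Nat.beq (m + 1) (k + 1) = Nat.beq m k from rfl]
        rcases h : Nat.ble k m with _ | _
        · rfl
        · rcases h' : Nat.beq m k with _ | _
          · have h₁ : k ≤ m := Nat.le_of_ble_eq_true h
            have h₂ : m ≠ k := fun e => by simp [e] at h'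
            change var m = var (m - 1 + 1)
            -- From `k ≤ m` and `m ≠ k` it follows that `m` is positive.
            rw [Nat.sub_add_cancel (by omega)]
          · exact (rename_rename _ _ _).symm
  | pi A B hA hB => rw [instAt, subst, hA, hB, Function.iterate_succ_apply']
  | lam b hb => rw [instAt, subst, hb, Function.iterate_succ_apply']
  | app f a hf ha => rw [instAt, subst, hf, ha]
  | _ => rfl

theorem instAt_zero (b a : Tm) : instAt a 0 b = b.inst a := instAt_eq_subst a 0 b

end Tm

/-- Contract the redex with the eliminator `c` at its head, where `W` computes a weak head normal
form, presented as a head with a list of arguments. -/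
def reduct (W : Tm → Tm × List Tm) : Const → List Tm → Option (Tm × List Tm)
  | .unitElim, _ :: c :: t :: as =>
    match W t with
    | (.const .star, []) => some (c, as)
    | _ => none
  | .natElim, C :: z :: s :: t :: as =>
    match W t with
    | (.const .zero, []) => some (z, as)
    | (.const .succ, [n]) => some (s, n :: apps .natElim [C, z, s, n] :: as)
    | _ => none
  | .sumElim, _ :: _ :: _ :: l :: r :: t :: as =>
    match W t with
    | (.const .inl, [_, _, a]) => some (l, a :: as)
    | (.const .inr, [_, _, b]) => some (r, b :: as)
    | _ => none
  | .sigmaElim, _ :: _ :: _ :: g :: t :: as =>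
    match W t with
    | (.const .pair, [_, _, a, b]) => some (g, a :: b :: as)
    | _ => none
  | .idElim, _ :: _ :: _ :: d :: _ :: t :: as =>
    match W t with
    | (.const .refl, [_, _]) => some (d, as)
    | _ => none
  | .listElim, A :: C :: n :: c :: t :: as =>
    match W t with
    | (.const .nil, [_]) => some (n, as)
    | (.const .cons, [_, a, l]) => some (c, a :: l :: apps .listElim [A, C, n, c, l] :: as)
    | _ => none
  | .fElim, A :: P :: u :: c :: d :: m1 :: m2 :: m :: t :: as =>
    match W t with
    | (.const .funit, [_]) => some (u, as)
    | (.const .fcons, [_, a, x]) => some (c, a :: x :: apps .fElim [A, P, u, c, d, m1, m2, m, x] :: as)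
    | (.const .ficons, [_, a, x]) => some (d, a :: x :: apps .fElim [A, P, u, c, d, m1, m2, m, x] :: as)
    | _ => none
  | .gElim, A :: P :: S :: h :: m :: e :: i :: p1 :: p2 :: p3 :: p4 :: p5 :: t :: as =>
    match W t with
    | (.const .geta, [_, a]) => some (h, a :: as)
    | (.const .gmul, [_, x, y]) => some (m, x :: y ::
        apps .gElim [A, P, S, h, m, e, i, p1, p2, p3, p4, p5, x] ::
        apps .gElim [A, P, S, h, m, e, i, p1, p2, p3, p4, p5, y] :: as)
    | (.const .gone, [_]) => some (e, as)
    | (.const .ginv, [_, x]) =>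
      some (i, x :: apps .gElim [A, P, S, h, m, e, i, p1, p2, p3, p4, p5, x] :: as)
    | _ => none
  | _, _ => none

/-- The weak head normal form of `t` applied to a list of arguments. -/
def whnf : ℕ → Tm → List Tm → Tm × List Tm
  | 0, t, as => (t, as)
  | n + 1, t, as =>
    match t with
    | .app f a => whnf n f (a :: as)
    | .lam b =>
      match as with
      | [] => (.lam b, [])
      | a :: as => whnf n (instAt a 0 b) as
    | .const c =>
      match reduct (fun t => whnf n t []) c as with
      | some (t, as) => whnf n t as
      | none => (.const c, as)
    | t => (t, as)

theorem Conv.apps {t u : Tm} (h : Conv t u) (as : List Tm) :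
    Conv (as.foldl Tm.app t) (as.foldl Tm.app u) := by
  induction as generalizing t u with
  | nil => exact h
  | cons a as ih => exact ih (.app h (.rfl a))

theorem conv_of_reduct {W : Tm → Tm × List Tm}
    (hW : ∀ t, Conv t ((W t).2.foldl app (W t).1)) {c : Const} {as bs : List Tm} {t : Tm}
    (h : reduct W c as = some (t, bs)) : Conv (as.foldl app (.const c)) (bs.foldl app t) := by
  unfold reduct at h
  split at h
  -- The last branch, in which no rule applies, is dealt with first.
  rotate_right
  · cases h
  all_goals
    rename_i u as
    have hu := hW u
    split at h <;> cases h
  all_goals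
    rename_i hw
    rw [hw] at hu
    -- The eliminated argument is converted to constructor form, after which one computation rule
    -- applies; the surplus arguments are carried along.
    refine Conv.apps (.trans (.app (.rfl _) hu) (.comp ?_)) _
    constructor

/-- Each transition of the machine is a conversion, and exhausted fuel returns the current state. So
the result is sound for every amount of fuel, and no termination argument is needed. -/
theorem conv_whnf (n : ℕ) (t : Tm) (as : List Tm) :
    Conv (as.foldl app t) ((whnf n t as).2.foldl app (whnf n t as).1) := by
  induction n generalizing t as with
  | zero => exact .rfl _
  | succ n ih =>
    cases t with
    | app f a => exact ih f (a :: as)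
    | lam b =>
      cases as with
      | nil => exact .rfl _
      | cons a as =>
        refine .trans (Conv.apps (.beta _ _) _) ?_
        rw [← instAt_zero]
        exact ih _ _
    | const c =>
      simp only [whnf]
      split
      · rename_i h
        exact .trans (conv_of_reduct (fun t => ih t []) h) (ih _ _)
      · exact .rfl _
    | _ => exact .rfl _

/-! ### Testing convertibility -/

def convArgs (f : Tm → Tm → Bool) : List Tm → List Tm → Bool
  | [], [] => true
  | a :: as, b :: bs => f a b && convArgs f as bs
  | _, _ => false

/-- Is `t` convertible to `u`? -/
def conv : ℕ → Tm → Tm → Bool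
  | 0, _, _ => false
  | n + 1, t, u =>
    match beq t u with
    | true => true
    | false =>
      match whnf n t [], whnf n u [] with
      | (.lam b, []), (.lam b', []) => conv n b b'
      | (.lam b, []), (h, as) => conv n b (.app (lift 1 0 (as.foldl app h)) (.var 0))
      | (h, as), (.lam b, []) => conv n (.app (lift 1 0 (as.foldl app h)) (.var 0)) b
      | (.pi A B, []), (.pi A' B', []) => conv n A A' && conv n B B'
      | (h, as), (h', as') => beq h h' && convArgs (conv n) as as'

theorem conv_of_convArgs {f : Tm → Tm → Bool} (hf : ∀ t u, f t u = true → Conv t u) {t u : Tm}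
    (htu : Conv t u) {as bs : List Tm} (h : convArgs f as bs = true) :
    Conv (as.foldl app t) (bs.foldl app u) := by
  induction as generalizing t u bs with
  | nil => cases bs <;> simp_all [convArgs]
  | cons a as ih =>
    cases bs with
    | nil => simp [convArgs] at h
    | cons b bs =>
      simp only [convArgs, Bool.and_eq_true] at h
      exact ih (.app htu (hf _ _ h.1)) h.2

theorem Conv.eta_lift (t : Tm) : Conv (.lam (.app (lift 1 0 t) (.var 0))) t := by
  rw [lift_zero]; exact .eta t

/-- Convertibility is untyped, so reduction, `η` and comparison of components are all sound without
typing hypotheses. Only a positive answer is claimed to be meaningful. -/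
theorem conv_sound {n : ℕ} {t u : Tm} (h : conv n t u = true) : Conv t u := by
  induction n generalizing t u with
  | zero => simp [conv] at h
  | succ n ih =>
    rw [conv] at h
    split at h
    · rename_i h'
      rw [eq_of_beq h']; exact .rfl u
    · have ht := conv_whnf n t []
      have hu := conv_whnf n u []
      split at h <;> rename_i h₁ h₂ <;> rw [h₁] at ht <;> rw [h₂] at hu <;>
        refine .trans ht (.trans ?_ hu.symm)
      · exact .lam (ih h)
      -- Only one side is an abstraction; the other has been `η`-expanded.
      · exact .trans (.lam (ih h)) (.eta_lift _)
      · exact .trans (.symm (.eta_lift _)) (.lam (ih h))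
      · rw [Bool.and_eq_true] at h
        exact .pi (ih h.1) (ih h.2)
      · rw [Bool.and_eq_true] at h
        exact conv_of_convArgs (fun _ _ => ih) (eq_of_beq h.1 ▸ .rfl _) h.2

/-- Is `T` convertible to `T'`, or a universe contained in the universe `T'`? -/
def subtype (n : ℕ) (T T' : Tm) : Bool :=
  match beq T T' with
  | true => true
  | false =>
    match T, T' with
    | .univ l, .univ m => Nat.ble l m
    | T, T' => conv n T T'

theorem HasType.of_subtype {Γ : List Tm} {t T T' : Tm} {n : ℕ} (h : HasType Γ t T)
    (hT' : IsType Γ T') (hs : subtype n T T' = true) : HasType Γ t T' := by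
  unfold subtype at hs
  split at hs
  · rename_i h'
    rwa [← eq_of_beq h']
  · split at hs
    · exact h.cumul_le (Nat.le_of_ble_eq_true hs)
    · obtain ⟨l, hl⟩ := hT'
      exact h.conv hl (conv_sound hs)

/-! ### Inferring and checking types -/

def lookup : List Tm → ℕ → Option Tm
  | [], _ => none
  | A :: _, 0 => some A
  | _ :: Γ, n + 1 => lookup Γ n

theorem lookup_eq (Γ : List Tm) (n : ℕ) : lookup Γ n = Γ[n]? := by
  induction Γ generalizing n with
  | nil => simp [lookup]
  | cons A Γ ih => cases n <;> simp [lookup, ih]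

def unapp : Tm → List Tm → Tm × List Tm
  | .app f a, as => unapp f (a :: as)
  | t, as => (t, as)

theorem unapp_eq (t : Tm) (as : List Tm) :
    (unapp t as).2.foldl app (unapp t as).1 = as.foldl app t := by
  induction t generalizing as with
  | app f a hf _ => exact hf (a :: as)
  | _ => rfl

/-- The level of the universe `T`. -/
def toUniv (n : ℕ) : Tm → Option ℕ
  | .univ l => some l
  | T =>
    match whnf n T [] with
    | (.univ l, []) => some l
    | _ => none

/-- Domain and codomain of a function type `T`, where `sort` decides whether a term is a type. -/
def toPi (n : ℕ) (sort : Tm → Bool) : Tm → Option (Tm × Tm)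
  | .pi A B => some (A, B)
  | T =>
    match whnf n T [] with
    | (.pi A B, []) =>
      match sort (.pi A B) with
      | true => some (A, B)
      | false => none
    | _ => none

/-- The type of `f as` for a function `f` of type `T`. -/
def spine (pi? : Tm → Option (Tm × Tm)) (check : Tm → Tm → Bool) : Tm → List Tm → Option Tm
  | T, [] => some T
  | T, a :: as =>
    match pi? T with
    | some (A, B) =>
      match check a A with
      | true => spine pi? check (instAt a 0 B) as
      | false => none
    | none => none

/-- Try the universe levels from `l` on. -/
def firstSome (f : ℕ → Option Tm) : ℕ → Option Tm
  | 0 =>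
    match f 0 with
    | some t => some t
    | none => f 1
  | _ => f 1

/-- The type checker.  It infers the type of `t`, or checks that `t` has a given type.  Only
constants whose rank is less than `r` are accepted. -/
def typing (r : ℕ) : ℕ → List Tm → Tm → Option Tm → Option Tm
  | 0, _, _, _ => none
  | n + 1, Γ, t, expected =>
    let isType (T : Tm) : Bool :=
      match typing r n Γ T none with
      | some S => (toUniv n S).isSome
      | none => false
    let check (a A : Tm) : Bool := (typing r n Γ a (some A)).isSome
    match expected with
    | some T =>
      match t with
      | .lam b =>
        match toPi n isType T with
        | some (A, B) =>
          match typing r n (A :: Γ) b (some B) with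
          | some _ => some T
          | none => none
        | none => none
      | t =>
        match typing r n Γ t none with
        | some T' =>
          match subtype n T' T with
          | true => some T
          | false => none
        | none =>
          match t with
          -- When inference fails, a β-redex acts as a local definition: its body is checked against
          -- the weakened expected type.
          | .app (.lam b) a =>
            match typing r n Γ a none with
            | some A =>
              match typing r n (A :: Γ) b (some (lift 1 0 T)) with
              | some _ => some T
              | none => none
            | none => none
          | _ => none
    | none =>
      match t with
      | .var k =>
        match lookup Γ k with
        | some A => some (lift (k + 1) 0 A)
        | none => none
      | .univ l => some (.univ (l + 1))
      | .pi A B =>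
        match typing r n Γ A none with
        | some S =>
          match toUniv n S with
          | some l =>
            match typing r n (A :: Γ) B none with
            | some S' =>
              match toUniv n S' with
              | some l' => some (.univ (max l l'))
              | none => none
            | none => none
          | none => none
        | none => none
      | t =>
        match unapp t [] with
        | (.const c, as) =>
          match Nat.blt c.rank r && c.usable with
          | true =>
            -- Terms do not record the levels of constants. If the first parameter is a type, its
            -- inferred level bounds the search from below; otherwise the search starts at `0`.
            match constType 0 0 c 0, as with
            | .pi (.univ _) _, a :: as =>
              match typing r n Γ a none with
              | some S =>
                match toUniv n S with
                | some l =>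
                  firstSome (fun i =>
                    match constType i i c 0 with
                    | .pi (.univ k) B =>
                      match Nat.ble l k with
                      | true => spine (toPi n isType) check (instAt a 0 B) as
                      | false => none
                    | _ => none) l
                | none => none
              | none => none
            | _, as => firstSome (fun i => spine (toPi n isType) check (constType i i c 0) as) 0
          | false => none
        | (.lam b, a :: as) =>
          match typing r n Γ a none with
          | some A =>
            match typing r n (A :: Γ) b none with
            | some B => spine (toPi n isType) check (instAt a 0 B) as
            | none => none
          | none => none
        | (.var k, as) =>
          match typing r n Γ (.var k) none with
          | some T => spine (toPi n isType) check T as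
          | none => none
        | _ => none
/-! ### Soundness of the type checker -/

theorem HasType.of_toUniv {Γ : List Tm} {A S : Tm} {n l : ℕ} (h : HasType Γ A S)
    (hS : toUniv n S = some l) : HasType Γ A (.univ l) := by
  unfold toUniv at hS
  split at hS
  · cases hS; exact h
  · split at hS <;> try cases hS
    rename_i h'
    have := conv_whnf n S []
    rw [h'] at this
    exact h.conv (.univ l) this

/-- The argument does not rely on subject reduction: a weak head normal form is known to be
convertible to the original type, but not to be well typed. Hence a `Π` that was found by reduction
is verified anew by `sort`. -/
theorem toPi_sound {Γ : List Tm} {T A B : Tm} {n : ℕ} {sort : Tm → Bool}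
    (hsort : ∀ T, sort T = true → IsType Γ T) (hT : IsType Γ T) (h : toPi n sort T = some (A, B)) :
    Conv T (.pi A B) ∧ IsType Γ (.pi A B) := by
  unfold toPi at h
  split at h
  · cases h; exact ⟨.rfl _, hT⟩
  · split at h <;> try cases h
    rename_i h'
    split at h <;> cases h
    rename_i h''
    have := conv_whnf n T []
    rw [h'] at this
    exact ⟨this, hsort _ h''⟩

/-- The invariant along the arguments is that the type reached so far is well formed; inversion of
`Π` and instantiation of the codomain preserve it. -/
theorem spine_sound {Γ : List Tm} {pi? : Tm → Option (Tm × Tm)} {check : Tm → Tm → Bool}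
    (hpi : ∀ T A B, IsType Γ T → pi? T = some (A, B) → Conv T (.pi A B) ∧ IsType Γ (.pi A B))
    (hc : ∀ a A, IsType Γ A → check a A = true → HasType Γ a A) {as : List Tm} {t T U : Tm}
    (ht : HasType Γ t T) (hT : IsType Γ T) (h : spine pi? check T as = some U) :
    HasType Γ (as.foldl app t) U ∧ IsType Γ U := by
  induction as generalizing t T with
  | nil => cases h; exact ⟨ht, hT⟩
  | cons a as ih =>
    rw [spine] at h
    split at h <;> try cases h
    rename_i A B hAB
    split at h <;> try cases h
    rename_i ha
    obtain ⟨hconv, l, hl⟩ := hpi _ _ _ hT hAB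
    obtain ⟨hA, hB⟩ := hl.pi_inv
    rw [instAt_zero] at h
    exact ih (.app (ht.conv hl hconv) (hc _ _ hA ha)) (hB.inst (hc _ _ hA ha)) h

theorem firstSome_eq {f : ℕ → Option Tm} {l : ℕ} {t : Tm} (h : firstSome f l = some t) :
    ∃ i ≤ 1, f i = some t := by
  unfold firstSome at h
  split at h
  · split at h
    · exact ⟨0, by simp, by simp_all⟩
    · exact ⟨1, by simp, h⟩
  · exact ⟨1, by simp, h⟩

/-- The types of the constants that the type checker accepts are types. -/
def ConstsTyped (r : ℕ) : Prop :=
  ∀ c i, i ≤ 1 → c.rank < r → c.usable = true → IsType [] (constType i i c 0)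

/-- Both modes call each other with less fuel, so they are treated in one induction. Inference also
delivers that the inferred type is well formed, which checking presupposes for the type it is given.
-/
theorem typing_sound {r : ℕ} (hr : ConstsTyped r) (n : ℕ) {Γ : List Tm} (hΓ : WfCtx Γ) (t : Tm) :
    (∀ T, typing r n Γ t none = some T → HasType Γ t T ∧ IsType Γ T) ∧
    ∀ T T', IsType Γ T → typing r n Γ t (some T) = some T' → HasType Γ t T := by
  induction n generalizing Γ t with
  | zero => exact ⟨fun _ h => by simp [typing] at h, fun _ _ _ h => by simp [typing] at h⟩
  | succ n ih =>
    have infer {Γ} (hΓ : WfCtx Γ) {t T : Tm} := (ih hΓ t).1 T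
    have check {Γ} (hΓ : WfCtx Γ) {t T T' : Tm} := (ih hΓ t).2 T T'
    have isType {Γ} (hΓ : WfCtx Γ) {T S : Tm} {l : ℕ} (h : typing r n Γ T none = some S)
        (hS : toUniv n S = some l) : HasType Γ T (.univ l) := (infer hΓ h).1.of_toUniv hS
    have hsort (T : Tm) (h : (match typing r n Γ T none with
        | some S => (toUniv n S).isSome
        | none => false) = true) : IsType Γ T := by
      split at h
      · rename_i hS
        obtain ⟨l, hl⟩ := Option.isSome_iff_exists.mp h
        exact ⟨l, isType hΓ hS hl⟩
      · cases h
    have hpi (T A B : Tm) (hT : IsType Γ T) (h : toPi n (fun T => match typing r n Γ T none with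
        | some S => (toUniv n S).isSome
        | none => false) T = some (A, B)) : Conv T (.pi A B) ∧ IsType Γ (.pi A B) :=
      toPi_sound hsort hT h
    have hc (a A : Tm) (hA : IsType Γ A) (h : (typing r n Γ a (some A)).isSome = true) :
        HasType Γ a A := by
      obtain ⟨_, h⟩ := Option.isSome_iff_exists.mp h
      exact check hΓ hA h
    constructor
    · intro T h
      simp only [typing] at h
      split at h
      · split at h <;> cases h
        rename_i h'
        rw [lookup_eq] at h'
        rw [lift_zero]
        exact ⟨.var h', hΓ.isType h'⟩
      · cases h; exact ⟨.univ _, .univ _ _⟩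
      · repeat' (split at h <;> try cases h)
        rename_i h₁ _ _ h₂ _ _ h₃ _ _ h₄
        have hA := isType hΓ h₁ h₂
        have hB := isType (hΓ.cons ⟨_, hA⟩) h₃ h₄
        exact ⟨.pi (hA.cumul_le (le_max_left _ _)) (hB.cumul_le (le_max_right _ _)), .univ _ _⟩
      · have ht := unapp_eq t []
        split at h
        · rename_i c as h'
          rw [h'] at ht
          split at h <;> try cases h
          rename_i h''
          rw [Bool.and_eq_true] at h''
          have hconst (i : ℕ) (hi : i ≤ 1) := (hr _ i hi (by simpa [Nat.blt] using h''.1) h''.2).of_nil Γ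
          split at h
          · rename_i a as _
            split at h <;> try cases h
            rename_i hS
            split at h <;> try cases h
            rename_i hl
            obtain ⟨i, hi, h⟩ := firstSome_eq h
            split at h <;> try cases h
            rename_i hi'
            split at h <;> try cases h
            rename_i hk
            have ha := (isType hΓ hS hl).cumul_le (Nat.le_of_ble_eq_true hk)
            rw [instAt_zero] at h
            have hC := hconst i hi
            rw [hi'] at hC
            have hct := HasType.const (Γ := Γ) c i i
            rw [hi'] at hct
            have := spine_sound hpi hc (.app hct ha)
              (hC.choose_spec.pi_inv.2.inst ha) h
            rwa [show as.foldl app (.app (.const c) a) = t from ht] at this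
          · obtain ⟨i, hi, h⟩ := firstSome_eq h
            have := spine_sound hpi hc (.const _ i i) (hconst i hi) h
            rwa [ht] at this
        · rename_i b a as h'
          rw [h'] at ht
          repeat' (split at h <;> try cases h)
          rename_i h₁ _ _ h₂
          obtain ⟨ha, hA⟩ := infer hΓ h₁
          obtain ⟨hb, hB⟩ := infer (hΓ.cons hA) h₂
          rw [instAt_zero] at h
          obtain ⟨l, hl⟩ := hA
          -- In a head redex the argument supplies the domain of the abstraction, which raw terms do
          -- not record.
          have := spine_sound hpi hc (.app (.lam hl hb) ha) (hB.inst ha) h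
          rwa [show as.foldl app (.app (.lam b) a) = t from ht] at this
        · rename_i h'
          rw [h'] at ht
          split at h <;> try cases h
          rename_i h₁
          have := spine_sound hpi hc (infer hΓ h₁).1 (infer hΓ h₁).2 h
          rwa [ht] at this
        · cases h
    · intro T T' hT h
      simp only [typing] at h
      split at h
      · split at h <;> try cases h
        rename_i h₁
        split at h <;> cases h
        rename_i h₂
        obtain ⟨hconv, hl⟩ := hpi _ _ _ hT h₁
        obtain ⟨hA, hB⟩ := hl.choose_spec.pi_inv
        obtain ⟨l, hl⟩ := hT
        exact .conv (.lam hA.choose_spec (check (hΓ.cons hA) hB h₂)) hl hconv.symm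
      · split at h
        · rename_i h₁
          split at h <;> cases h
          rename_i h₂
          exact (infer hΓ h₁).1.of_subtype hT h₂
        · split at h <;> try cases h
          split at h <;> try cases h
          rename_i h₁
          split at h <;> cases h
          rename_i h₂
          obtain ⟨ha, l, hA⟩ := infer hΓ h₁
          obtain ⟨m, hm⟩ := hT
          rw [lift_zero] at h₂
          have := HasType.app (.lam hA (check (hΓ.cons ⟨l, hA⟩) ⟨m, hm.weaken _⟩ h₂)) ha
          -- The expected type was weakened for the body, so instantiating it gives it back.
          exact (inst_rename_succ T _ ▸ this : HasType Γ (.app (.lam _) _) T)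

/-- `T` is a type in context `Γ`, according to the type checker. -/
def checkType (r : ℕ) (Γ : List Tm) (T : Tm) : Bool :=
  match typing r 1000000 Γ T none with
  | some S => (toUniv 1000000 S).isSome
  | none => false

theorem isType_of_checkType {r : ℕ} (hr : ConstsTyped r) {Γ : List Tm} (hΓ : WfCtx Γ) {T : Tm}
    (h : checkType r Γ T = true) : IsType Γ T := by
  unfold checkType at h
  split at h
  · rename_i hS
    obtain ⟨l, hl⟩ := Option.isSome_iff_exists.mp h
    exact ⟨l, ((typing_sound hr _ hΓ _).1 _ hS).1.of_toUniv hl⟩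
  · cases h

def checkConst (c : Const) : Bool :=
  checkType c.rank [] (constType 0 0 c 0) && checkType c.rank [] (constType 1 1 c 0)

theorem checkConst_eq (c : Const) (h : c.usable = true) : checkConst c = true := by
  cases c
  case univalence l =>
    obtain rfl : l = 0 := Nat.eq_of_beq_eq_true h
    decide +kernel
  case fElimMu1 => cases h
  case fElimMu2 => cases h
  case fElimMu => cases h
  all_goals decide +kernel

/-- Soundness of the checker presupposes that types of constants are well formed, which is itself
established by the checker. The circle is broken by rank: the type of a constant is checked with
constants of smaller rank only. -/
theorem constsTyped (r : ℕ) : ConstsTyped r := by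
  induction r using Nat.strong_induction_on with
  | _ r ih =>
    intro c i hi hc h
    have hcheck := checkConst_eq c h
    rw [checkConst, Bool.and_eq_true] at hcheck
    interval_cases i
    · exact isType_of_checkType (ih _ hc) .nil hcheck.1
    · exact isType_of_checkType (ih _ hc) .nil hcheck.2

/-! ### Collecting lemmas in a context

The lemmas are proved in a context that starts with a type `A` and a proof of `DecEq A`; every
lemma that is proved extends the context by its statement. -/

def baseCtx : List Tm := [DecEq (Bld.bound 0) 1, .univ 0]

/-- `Γ` extends `baseCtx` by `n` types, each of which is inhabited in the context before it; a type
with an element and a property of that element may be added together. -/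
inductive Derivable : ℕ → List Tm → Prop
  | base : Derivable 0 baseCtx
  | step {n Γ T t} : Derivable n Γ → IsType Γ T → HasType Γ t T → Derivable (n + 1) (T :: Γ)
  | define {n Γ A B a b} : Derivable n Γ → IsType Γ A → HasType Γ a A → IsType (A :: Γ) B →
      HasType Γ b (B.inst a) → Derivable (n + 2) (B :: A :: Γ)

/-- The bound `6` excludes just the propositional computation rules of `fElim`, which have rank `6`.
-/
def checks (Γ : List Tm) (t T : Tm) : Bool :=
  checkType 6 Γ T && (typing 6 1000000 Γ t (some T)).isSome

theorem hasType_of_checks {Γ : List Tm} (hΓ : WfCtx Γ) {t T : Tm} (h : checks Γ t T = true) :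
    IsType Γ T ∧ HasType Γ t T := by
  rw [checks, Bool.and_eq_true] at h
  have hT := isType_of_checkType (constsTyped _) hΓ h.1
  obtain ⟨_, h⟩ := Option.isSome_iff_exists.mp h.2
  exact ⟨hT, (typing_sound (constsTyped _) _ hΓ t).2 _ _ hT h⟩

theorem wfCtx_baseCtx : WfCtx baseCtx :=
  .cons (.cons .nil (.univ _ _))
    (isType_of_checkType (constsTyped 6) (.cons .nil (.univ _ _)) (by decide +kernel))

theorem Derivable.wfCtx {n : ℕ} {Γ : List Tm} (h : Derivable n Γ) : WfCtx Γ := by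
  induction h with
  | base => exact wfCtx_baseCtx
  | step _ hT _ ih => exact ih.cons hT
  | define _ hA _ hB _ ih => exact (ih.cons hA).cons hB

theorem Derivable.check {n : ℕ} {Γ : List Tm} (h : Derivable n Γ) {T : Tm} (t : Tm)
    (ht : checks Γ t T = true) : Derivable (n + 1) (T :: Γ) :=
  have := hasType_of_checks h.wfCtx ht
  h.step this.1 this.2

/-- Is `a` an element of `A` that has the property `B`, by the proof `b`? -/
def checksDef (Γ : List Tm) (a A b B : Tm) : Bool :=
  checks Γ a A && (checkType 6 (A :: Γ) B && (typing 6 1000000 Γ b (some (instAt a 0 B))).isSome)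

/-- Add an element `a` of `A` to the context and forget everything but the property `B` of `a`. -/
theorem Derivable.opaqueDef {n : ℕ} {Γ : List Tm} (h : Derivable n Γ) {A B : Tm} (a b : Tm)
    (hab : checksDef Γ a A b B = true) : Derivable (n + 2) (B :: A :: Γ) := by
  rw [checksDef, Bool.and_eq_true, Bool.and_eq_true] at hab
  obtain ⟨ha, hB, hb⟩ := hab
  obtain ⟨hA, ha⟩ := hasType_of_checks h.wfCtx ha
  have hB := isType_of_checkType (constsTyped _) (h.wfCtx.cons hA) hB
  obtain ⟨_, hb⟩ := Option.isSome_iff_exists.mp hb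
  rw [instAt_zero] at hb
  exact h.define hA ha hB ((typing_sound (constsTyped _) _ h.wfCtx b).2 _ _ (hB.inst ha) hb)

/-- An added entry is removed by abstracting over it and applying the abstraction to its proof. The
type in question is weakened past all entries, so the application does not change it. For an opaque
definition two abstractions are applied, to the value and to the proof of its property. -/
theorem Derivable.exists_hasType {n : ℕ} {Γ : List Tm} (h : Derivable n Γ) {t T : Tm}
    (ht : HasType Γ t (T.rename (· + n))) : ∃ t, HasType baseCtx t T := by
  induction h generalizing t with
  | base => exact ⟨t, by rwa [rename_eq_subst, show (fun m => var (m + 0)) = var from rfl,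
      subst_var] at ht⟩
  | @step n Γ U u _ hU hu ih =>
    obtain ⟨l, hl⟩ := hU
    refine ih (t := .app (.lam t) u) ?_
    have := HasType.app (.lam hl ht) hu
    rwa [show (fun m => m + (n + 1)) = Nat.succ ∘ fun m => m + n from rfl, ← rename_rename,
      inst_rename_succ] at this
  | @define n Γ A B a b _ hA ha hB hb ih =>
    obtain ⟨l, hl⟩ := hA
    obtain ⟨m, hm⟩ := hB
    refine ih (t := .app (.app (.lam (.lam t)) a) b) ?_
    have h := HasType.app (.lam hl (.lam hm ht)) ha
    rw [Tm.inst, Tm.subst] at h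
    have h := HasType.app h hb
    rw [subst_rename] at h
    change HasType Γ _ ((T.subst fun k => var (k + n + 1)).inst b) at h
    rwa [← rename_eq_subst, show (fun k => k + n + 1) = Nat.succ ∘ (· + n) from rfl,
      ← rename_rename, inst_rename_succ] at h

theorem Derivable.exists_of_checks {n : ℕ} {Γ : List Tm} (h : Derivable n Γ) {T : Tm} (t : Tm)
    (ht : checks Γ t (lift n 0 T) = true) : ∃ t, HasType baseCtx t T :=
  h.exists_hasType (lift_zero n T ▸ (hasType_of_checks h.wfCtx ht).2)

/-! ### Writing proofs

For a lemma `foo`, `fooStmt` is the statement, `fooProof` the proof, `fooCtx` the context that ends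
with the statement, and `fooVar` the variable that stands for the lemma in the proofs after it. A
definition `bar` has a type `barType`, a value `barValue` and a characteristic property `barSpec`;
later proofs use it as a variable `barFn` with the property `barEq`. -/

/-- A term that is meant to be a proof of `P`. -/
structure Pf (P : Bld) where
  tm : Bld

instance (P : Bld) : CoeOut (Pf P) Bld := ⟨Pf.tm⟩

local infixl:100 " ⬝ " => Bld.ap
local infixr:60 " ⇾ " => Bld.arr

open Bld

namespace Pf

variable {P Q X Y x y z : Bld} {B : Bld → Bld}

/-- Generalisation. -/
def all (f : (x : Bld) → Pf (B x)) : Pf (Pi X B) := ⟨Lam fun x => (f x).tm⟩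
/-- Implication, where the conclusion may depend on the proof of the hypothesis. -/
def intro (f : (p : Pf P) → Pf (B p.tm)) : Pf (Pi P B) := ⟨Lam fun x => (f ⟨x⟩).tm⟩
def app (f : Pf (Pi X B)) (x : Bld) : Pf (B x) := ⟨f.tm ⬝ x⟩
def mp (f : Pf (P ⇾ Q)) (p : Pf P) : Pf Q := ⟨f.tm ⬝ p.tm⟩
/-- A proof of `P` as a proof of a convertible type. -/
def cast (p : Pf P) : Pf Q := ⟨p.tm⟩
/-- `x = y`, for convertible terms `x` and `y`. -/
def rfl : Pf (Id X x y) := ⟨Refl X x⟩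

/-- Path induction. -/
def pathInd (C : Bld → Bld → Bld) (d : Pf (C x (Refl X x))) (p : Pf (Id X x y)) : Pf (C y p.tm) :=
  ⟨IdElim X x C d.tm y p.tm⟩

end Pf

set_option linter.unusedVariables false

/-! ### Identity types -/

abbrev symmStmt : Bld :=
  Pi (U 0) fun X => Pi X fun x => Pi X fun y => Id X x y ⇾ Id X y x

def symmProof : Pf symmStmt :=
  .all fun X => .all fun x => .all fun y => .intro fun p => .pathInd (fun y _ => Id X y x) .rfl p

def symmCtx : List Tm :=
  symmStmt 2 :: baseCtx

theorem symm_derivable : Derivable 1 symmCtx :=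
  Derivable.base.check (symmProof.tm 2)
    (by decide +kernel)

def symmVar : Pf symmStmt := ⟨bound 2⟩

abbrev transStmt : Bld :=
  Pi (U 0) fun X => Pi X fun x => Pi X fun y => Pi X fun z => Id X x y ⇾ Id X y z ⇾ Id X x z

def transProof : Pf transStmt :=
  .all fun X => .all fun x => .all fun y => .all fun z => .intro fun p => .intro fun q =>
    .pathInd (fun z _ => Id X x z) p q

def transCtx : List Tm :=
  transStmt 3 :: symmCtx

theorem trans_derivable : Derivable 2 transCtx :=
  symm_derivable.check (transProof.tm 3)
    (by decide +kernel)

def transVar : Pf transStmt := ⟨bound 3⟩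

abbrev congrStmt : Bld :=
  Pi (U 0) fun X => Pi (U 0) fun Y => Pi (X ⇾ Y) fun f => Pi X fun x => Pi X fun y =>
    Id X x y ⇾ Id Y (f ⬝ x) (f ⬝ y)

def congrProof : Pf congrStmt :=
  .all fun X => .all fun Y => .all fun f => .all fun x => .all fun y => .intro fun p =>
    .pathInd (fun y _ => Id Y (f ⬝ x) (f ⬝ y)) .rfl p

def congrCtx : List Tm :=
  congrStmt 4 :: transCtx

theorem congr_derivable : Derivable 3 congrCtx :=
  trans_derivable.check (congrProof.tm 4)
    (by decide +kernel)

def congrVar : Pf congrStmt := ⟨bound 4⟩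

abbrev transportStmt : Bld :=
  Pi (U 0) fun X => Pi (X ⇾ U 0) fun P => Pi X fun x => Pi X fun y =>
    Id X x y ⇾ P ⬝ x ⇾ P ⬝ y

def transportProof : Pf transportStmt :=
  .all fun X => .all fun P => .all fun x => .all fun y => .intro fun p => .intro fun u =>
    .pathInd (fun y _ => P ⬝ y) u p

def transportCtx : List Tm :=
  transportStmt 5 :: congrCtx

theorem transport_derivable : Derivable 4 transportCtx :=
  congr_derivable.check (transportProof.tm 5)
    (by decide +kernel)

def transportVar : Pf transportStmt := ⟨bound 5⟩

abbrev pointwiseStmt : Bld :=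
  Pi (U 0) fun X => Pi (X ⇾ U 0) fun B =>
    Pi (Pi X fun x => B ⬝ x) fun f => Pi (Pi X fun x => B ⬝ x) fun g =>
    (Pi X fun x => Id (B ⬝ x) (f ⬝ x) (g ⬝ x)) ⇾ Id (Pi X fun x => B ⬝ x) f g

def pointwiseProof : Pf pointwiseStmt :=
  .all fun X => .all fun B => .all fun f => .all fun g =>
    let S := Id (Pi X fun x => B ⬝ x) f g
    let T := Pi X fun x => Id (B ⬝ x) (f ⬝ x) (g ⬝ x)
    let h := happly X B f g
    ⟨Fst (T ⇾ S) (fun k => Sig (LeftInv S h k) fun η => Sig (RightInv T h k) fun ε =>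
      HalfAdj S T h k η ε) (cst .funext ⬝ X ⬝ B ⬝ f ⬝ g)⟩

def pointwiseCtx : List Tm :=
  pointwiseStmt 6 :: transportCtx

theorem pointwise_derivable : Derivable 5 pointwiseCtx :=
  transport_derivable.check (pointwiseProof.tm 6)
    (by decide +kernel)

def pointwiseVar : Pf pointwiseStmt := ⟨bound 6⟩

namespace Pf

variable {X Y x y z : Bld}

def symm (p : Pf (Id X x y)) : Pf (Id X y x) :=
  (symmVar.app X |>.app x |>.app y).mp p

def trans (p : Pf (Id X x y)) (q : Pf (Id X y z)) : Pf (Id X x z) :=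
  ((transVar.app X |>.app x |>.app y |>.app z).mp p).mp q

def congr (f : Bld → Bld) (p : Pf (Id X x y)) : Pf (Id Y (f x) (f y)) :=
  ⟨congrVar.tm ⬝ X ⬝ Y ⬝ Lam f ⬝ x ⬝ y ⬝ p.tm⟩

def transport (P : Bld → Bld) (p : Pf (Id X x y)) (u : Pf (P x)) : Pf (P y) :=
  ⟨transportVar.tm ⬝ X ⬝ Lam P ⬝ x ⬝ y ⬝ p.tm ⬝ u.tm⟩

def funext {B : Bld → Bld} {f g : Bld} (h : (x : Bld) → Pf (Id (B x) (f ⬝ x) (g ⬝ x))) :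
    Pf (Id (Pi X B) f g) :=
  ⟨pointwiseVar.tm ⬝ X ⬝ Lam B ⬝ f ⬝ g ⬝ Lam fun x => (h x).tm⟩

end Pf

/-! ### Sums, dependent sums and lists -/

abbrev Empty : Bld := cst .empty
abbrev Not (P : Bld) : Bld := P ⇾ Empty
def Sum (X Y : Bld) : Bld := cst .sum ⬝ X ⬝ Y
def Inl (X Y x : Bld) : Bld := cst .inl ⬝ X ⬝ Y ⬝ x
def Inr (X Y y : Bld) : Bld := cst .inr ⬝ X ⬝ Y ⬝ y
def SumElim (X Y : Bld) (C l r : Bld → Bld) (s : Bld) : Bld :=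
  cst .sumElim ⬝ X ⬝ Y ⬝ Lam C ⬝ Lam l ⬝ Lam r ⬝ s
abbrev Dec (P : Bld) : Bld := Sum P (Not P)
def PairOf (X P x p : Bld) : Bld := Pair X (fun x => P ⬝ x) x p
def Snd (X : Bld) (P : Bld → Bld) (p : Bld) : Bld :=
  cst .sigmaElim ⬝ X ⬝ Lam P ⬝ (Lam fun p => P (Fst X P p)) ⬝ (Lam fun _ => Lam fun b => b) ⬝ p
def List' (X : Bld) : Bld := cst .list ⬝ X
def Nil (X : Bld) : Bld := cst .nil ⬝ X
def Cons (X a l : Bld) : Bld := cst .cons ⬝ X ⬝ a ⬝ l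
def ListElim (X : Bld) (C : Bld → Bld) (n : Bld) (c : Bld → Bld → Bld → Bld) (l : Bld) : Bld :=
  cst .listElim ⬝ X ⬝ Lam C ⬝ n ⬝ (Lam fun a => Lam fun l => Lam fun r => c a l r) ⬝ l

namespace Pf

variable {P Q X Y x y : Bld}

def absurd (p : Pf Empty) : Pf P := ⟨cst .emptyElim ⬝ (Lam fun _ => P) ⬝ p.tm⟩

def inl (p : Pf P) : Pf (Sum P Q) := ⟨Inl P Q p.tm⟩

def inr (q : Pf Q) : Pf (Sum P Q) := ⟨Inr P Q q.tm⟩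

/-- Case distinction. -/
def cases (s : Pf (Sum P Q)) (C : Bld → Bld) (l : (p : Pf P) → Pf (C (Inl P Q p.tm)))
    (r : (q : Pf Q) → Pf (C (Inr P Q q.tm))) : Pf (C s.tm) :=
  ⟨SumElim P Q C (fun p => (l ⟨p⟩).tm) (fun q => (r ⟨q⟩).tm) s.tm⟩

def sumInd (C : Bld → Bld) (l : (a : Bld) → Pf (C (Inl X Y a))) (r : (b : Bld) → Pf (C (Inr X Y b)))
    (s : Bld) : Pf (C s) :=
  ⟨SumElim X Y C (fun p => (l p).tm) (fun q => (r q).tm) s⟩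

def sigInd {B : Bld → Bld} (C : Bld → Bld) (g : (a b : Bld) → Pf (C (Pair X B a b))) (p : Bld) :
    Pf (C p) :=
  ⟨cst .sigmaElim ⬝ X ⬝ Lam B ⬝ Lam C ⬝ (Lam fun a => Lam fun b => (g a b).tm) ⬝ p⟩

def and (p : Pf P) (q : Pf Q) : Pf (Prod P Q) := ⟨Pair P (fun _ => Q) p.tm q.tm⟩

def fst (p : Pf (Prod P Q)) : Pf P := ⟨Fst P (fun _ => Q) p.tm⟩

def snd (p : Pf (Prod P Q)) : Pf Q := ⟨Snd P (fun _ => Q) p.tm⟩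

def listInd (C : Bld → Bld) (n : Pf (C (Nil X)))
    (c : (a l : Bld) → Pf (C l) → Pf (C (Cons X a l))) (l : Bld) : Pf (C l) :=
  ⟨ListElim X C n.tm (fun a l r => (c a l ⟨r⟩).tm) l⟩

end Pf

/-! ### Sets and decidable equality -/

def IsProp (X : Bld) : Bld := Pi X fun x => Pi X fun y => Id X x y

/-- The composite of the inverse of `r : x = y` and `q : x = z`. -/
def cancel (X x y z r q : Bld) : Bld := IdElim X x (fun y _ => Id X y z) q y r

abbrev cancelSelfStmt : Bld :=
  Pi (U 0) fun X => Pi X fun x => Pi X fun y => Pi (Id X x y) fun r =>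
    Id (Id X y y) (cancel X x y y r r) (Refl X y)

def cancelSelfProof : Pf cancelSelfStmt :=
  .all fun X => .all fun x => .all fun y => .intro fun r =>
    .pathInd (fun y r => Id (Id X y y) (cancel X x y y r r) (Refl X y)) .rfl r

def cancelSelfCtx : List Tm :=
  cancelSelfStmt 7 :: pointwiseCtx

theorem cancelSelf_derivable : Derivable 6 cancelSelfCtx :=
  pointwise_derivable.check (cancelSelfProof.tm 7)
    (by decide +kernel)

def cancelSelfVar : Pf cancelSelfStmt := ⟨bound 7⟩

/-- Hedberg's argument: a constant endomap `k` of path types reconstructs `p` as the composite of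
the inverse of `k refl` with `k p`. The right side does not depend on `p`, so any two parallel paths
agree. -/
abbrev isSetOfConstStmt : Bld :=
  Pi (U 0) fun X => Pi (Pi X fun x => Pi X fun y => Id X x y ⇾ Id X x y) fun k =>
    (Pi X fun x => Pi X fun y => Pi (Id X x y) fun p => Pi (Id X x y) fun q =>
      Id (Id X x y) (k ⬝ x ⬝ y ⬝ p) (k ⬝ x ⬝ y ⬝ q)) ⇾ IsSet X

def isSetOfConstProof : Pf isSetOfConstStmt :=
  .all fun X => .all fun k => .intro fun hk => .all fun x => .all fun y =>
    .intro fun p => .intro fun q =>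
    let K (y p : Bld) := cancel X x x y (k ⬝ x ⬝ x ⬝ Refl X x) (k ⬝ x ⬝ y ⬝ p)
    let h (p : Pf (Id X x y)) : Pf (Id (Id X x y) (K y p.tm) p.tm) :=
      -- At `refl` both factors are `k refl`, and they cancel.
      .pathInd (fun y p => Id (Id X x y) (K y p) p)
        (cancelSelfVar.app X |>.app x |>.app x |>.app (k ⬝ x ⬝ x ⬝ Refl X x)).cast p
    .trans (.symm (h p)) (.trans
      (.congr (cancel X x x y (k ⬝ x ⬝ x ⬝ Refl X x)) (hk.app x |>.app y |>.app p.tm |>.app q.tm))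
      (h q))

def isSetOfConstCtx : List Tm :=
  isSetOfConstStmt 8 :: cancelSelfCtx

theorem isSetOfConst_derivable : Derivable 7 isSetOfConstCtx :=
  cancelSelf_derivable.check (isSetOfConstProof.tm 8)
    (by decide +kernel)

def isSetOfConstVar : Pf isSetOfConstStmt := ⟨bound 8⟩

abbrev isSetOfIsPropStmt : Bld :=
  Pi (U 0) fun X => IsProp X ⇾ IsSet X

def isSetOfIsPropProof : Pf isSetOfIsPropStmt :=
  .all fun X => .intro fun h => .mp
    (isSetOfConstVar.app X |>.app (Lam fun x => Lam fun y => Lam fun _ => h.tm ⬝ x ⬝ y))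
    (.all fun x => .all fun y => .all fun _ => .all fun _ =>
      .cast (.rfl : Pf (Id (Id X x y) (h.tm ⬝ x ⬝ y) (h.tm ⬝ x ⬝ y))))

def isSetOfIsPropCtx : List Tm :=
  isSetOfIsPropStmt 9 :: isSetOfConstCtx

theorem isSetOfIsProp_derivable : Derivable 8 isSetOfIsPropCtx :=
  isSetOfConst_derivable.check (isSetOfIsPropProof.tm 9)
    (by decide +kernel)

def isSetOfIsPropVar : Pf isSetOfIsPropStmt := ⟨bound 9⟩

/-- The constant endomap replaces a given path by the one that the decision procedure returns; a
negative decision contradicts the given path. -/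
abbrev isSetOfDecEqStmt : Bld :=
  Pi (U 0) fun X => DecEq X ⇾ IsSet X

def isSetOfDecEqProof : Pf isSetOfDecEqStmt :=
  .all fun X => .intro fun D =>
    let k (x y d p : Bld) :=
      SumElim (Id X x y) (Not (Id X x y)) (fun _ => Id X x y) (fun q => q)
        (fun n => (.absurd ⟨n ⬝ p⟩ : Pf (Id X x y)).tm) d
    .mp (isSetOfConstVar.app X |>.app (Lam fun x => Lam fun y => Lam fun p => k x y (D.tm ⬝ x ⬝ y) p))
      (.all fun x => .all fun y => .intro fun p => .intro fun q =>
        .cast (.cases (D.app x |>.app y : Pf (Dec (Id X x y)))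
          (fun d => Id (Id X x y) (k x y d p.tm) (k x y d q.tm))
          (fun _ => .rfl) (fun n => .absurd (n.mp p))))

def isSetOfDecEqCtx : List Tm :=
  isSetOfDecEqStmt 10 :: isSetOfIsPropCtx

theorem isSetOfDecEq_derivable : Derivable 9 isSetOfDecEqCtx :=
  isSetOfIsProp_derivable.check (isSetOfDecEqProof.tm 10)
    (by decide +kernel)

def isSetOfDecEqVar : Pf isSetOfDecEqStmt := ⟨bound 10⟩

/-- Path induction reduces equality of pairs to equality of the second components over one point,
which holds because the fibres are propositions. -/
abbrev sigEqStmt : Bld :=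
  Pi (U 0) fun X => Pi (X ⇾ U 0) fun P => (Pi X fun x => IsProp (P ⬝ x)) ⇾
    let S := Sig X fun x => P ⬝ x
    Pi S fun u => Pi S fun v => Id X (Fst X (fun x => P ⬝ x) u) (Fst X (fun x => P ⬝ x) v) ⇾ Id S u v

def sigEqProof : Pf sigEqStmt :=
  .all fun X => .all fun P => .intro fun hP =>
    let S := Sig X fun x => P ⬝ x
    let F := Fst X fun x => P ⬝ x
    .all fun u => .all fun v => .sigInd (fun u => Id X (F u) (F v) ⇾ Id S u v) (fun x p =>
      .sigInd (fun v => Id X (F (PairOf X P x p)) (F v) ⇾ Id S (PairOf X P x p) v) (fun y q =>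
        .intro fun e => .app (B := fun q => Id S (PairOf X P x p) (PairOf X P y q))
          (.pathInd (fun y _ => Pi (P ⬝ y) fun q => Id S (PairOf X P x p) (PairOf X P y q))
            (.all fun q => .congr (PairOf X P x) (hP.app x |>.app p |>.app q))
            (e.cast : Pf (Id X x y))) q) v) u

def sigEqCtx : List Tm :=
  sigEqStmt 11 :: isSetOfDecEqCtx

theorem sigEq_derivable : Derivable 10 sigEqCtx :=
  isSetOfDecEq_derivable.check (sigEqProof.tm 11)
    (by decide +kernel)

def sigEqVar : Pf sigEqStmt := ⟨bound 11⟩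

/-! ### Injectivity and disjointness of constructors -/

abbrev inlInjStmt : Bld :=
  Pi (U 0) fun X => Pi X fun a => Pi X fun b => Id (Sum X X) (Inl X X a) (Inl X X b) ⇾ Id X a b

def inlInjProof : Pf inlInjStmt :=
  .all fun X => .all fun _ => .all fun _ => .intro fun p =>
    .cast (.congr (Y := X) (SumElim X X (fun _ => X) (fun a => a) (fun a => a)) p)

def inlInjCtx : List Tm :=
  inlInjStmt 12 :: sigEqCtx

theorem inlInj_derivable : Derivable 11 inlInjCtx :=
  sigEq_derivable.check (inlInjProof.tm 12)
    (by decide +kernel)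

def inlInjVar : Pf inlInjStmt := ⟨bound 12⟩

abbrev inrInjStmt : Bld :=
  Pi (U 0) fun X => Pi X fun a => Pi X fun b => Id (Sum X X) (Inr X X a) (Inr X X b) ⇾ Id X a b

def inrInjProof : Pf inrInjStmt :=
  .all fun X => .all fun _ => .all fun _ => .intro fun p =>
    .cast (.congr (Y := X) (SumElim X X (fun _ => X) (fun a => a) (fun a => a)) p)

def inrInjCtx : List Tm :=
  inrInjStmt 13 :: inlInjCtx

theorem inrInj_derivable : Derivable 12 inrInjCtx :=
  inlInj_derivable.check (inrInjProof.tm 13)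
    (by decide +kernel)

def inrInjVar : Pf inrInjStmt := ⟨bound 13⟩

abbrev inlNeInrStmt : Bld :=
  Pi (U 0) fun X => Pi X fun a => Pi X fun b => Not (Id (Sum X X) (Inl X X a) (Inr X X b))

def inlNeInrProof : Pf inlNeInrStmt :=
  .all fun X => .all fun _ => .all fun _ => .intro fun p =>
    .cast (.transport (SumElim X X (fun _ => U 0) (fun _ => cst .unit) (fun _ => Empty)) p
      -- The family that is the unit type on the left summand and empty on the right one turns the
      -- assumed path into an element of the empty type.
      (Pf.cast ⟨cst .star⟩ (P := cst .unit)))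

def inlNeInrCtx : List Tm :=
  inlNeInrStmt 14 :: inrInjCtx

theorem inlNeInr_derivable : Derivable 13 inlNeInrCtx :=
  inrInj_derivable.check (inlNeInrProof.tm 14)
    (by decide +kernel)

def inlNeInrVar : Pf inlNeInrStmt := ⟨bound 14⟩

abbrev decEqSumStmt : Bld :=
  Pi (U 0) fun X => DecEq X ⇾ DecEq (Sum X X)

def decEqSumProof : Pf decEqSumStmt :=
  .all fun X => .intro fun D => .all fun s => .all fun t =>
    .sumInd (fun s => Dec (Id (Sum X X) s t))
      (fun a => .sumInd (fun t => Dec (Id (Sum X X) (Inl X X a) t))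
        (fun b => .cases (D.app a |>.app b : Pf (Dec (Id X a b))) (fun _ => _)
          (fun p => .inl (.congr (Inl X X) p))
          (fun n => .inr (.intro fun p => n.mp (.mp (inlInjVar.app X |>.app a |>.app b) p))))
        (fun b => .inr (inlNeInrVar.app X |>.app a |>.app b)) t)
      (fun a => .sumInd (fun t => Dec (Id (Sum X X) (Inr X X a) t))
        (fun b => .inr (.intro fun p => .mp (inlNeInrVar.app X |>.app b |>.app a) (.symm p)))
        (fun b => .cases (D.app a |>.app b : Pf (Dec (Id X a b))) (fun _ => _)
          (fun p => .inl (.congr (Inr X X) p))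
          (fun n => .inr (.intro fun p => n.mp (.mp (inrInjVar.app X |>.app a |>.app b) p)))) t) s

def decEqSumCtx : List Tm :=
  decEqSumStmt 15 :: inlNeInrCtx

theorem decEqSum_derivable : Derivable 14 decEqSumCtx :=
  inlNeInr_derivable.check (decEqSumProof.tm 15)
    (by decide +kernel)

def decEqSumVar : Pf decEqSumStmt := ⟨bound 15⟩

abbrev nilNeConsStmt : Bld :=
  Pi (U 0) fun X => Pi X fun a => Pi (List' X) fun l => Not (Id (List' X) (Nil X) (Cons X a l))

def nilNeConsProof : Pf nilNeConsStmt :=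
  .all fun X => .all fun _ => .all fun _ => .intro fun p =>
    .cast (.transport (ListElim X (fun _ => U 0) (cst .unit) (fun _ _ _ => Empty)) p
      (Pf.cast ⟨cst .star⟩ (P := cst .unit)))

def nilNeConsCtx : List Tm :=
  nilNeConsStmt 16 :: decEqSumCtx

theorem nilNeCons_derivable : Derivable 15 nilNeConsCtx :=
  decEqSum_derivable.check (nilNeConsProof.tm 16)
    (by decide +kernel)

def nilNeConsVar : Pf nilNeConsStmt := ⟨bound 16⟩

abbrev headEqStmt : Bld :=
  Pi (U 0) fun X => Pi X fun a => Pi (List' X) fun l => Pi X fun b => Pi (List' X) fun m =>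
    Id (List' X) (Cons X a l) (Cons X b m) ⇾ Id X a b

def headEqProof : Pf headEqStmt :=
  .all fun X => .all fun a => .all fun _ => .all fun _ => .all fun _ => .intro fun p =>
    -- The value `a` on the empty list is arbitrary; both lists are nonempty.
    .cast (.congr (Y := X) (ListElim X (fun _ => X) a (fun a _ _ => a)) p)

def headEqCtx : List Tm :=
  headEqStmt 17 :: nilNeConsCtx

theorem headEq_derivable : Derivable 16 headEqCtx :=
  nilNeCons_derivable.check (headEqProof.tm 17)
    (by decide +kernel)

def headEqVar : Pf headEqStmt := ⟨bound 17⟩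

abbrev tailEqStmt : Bld :=
  Pi (U 0) fun X => Pi X fun a => Pi (List' X) fun l => Pi X fun b => Pi (List' X) fun m =>
    Id (List' X) (Cons X a l) (Cons X b m) ⇾ Id (List' X) l m

def tailEqProof : Pf tailEqStmt :=
  .all fun X => .all fun _ => .all fun _ => .all fun _ => .all fun _ => .intro fun p =>
    .cast (.congr (Y := List' X) (ListElim X (fun _ => List' X) (Nil X) (fun _ l _ => l)) p)

def tailEqCtx : List Tm :=
  tailEqStmt 18 :: headEqCtx

theorem tailEq_derivable : Derivable 17 tailEqCtx :=
  headEq_derivable.check (tailEqProof.tm 18)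
    (by decide +kernel)

def tailEqVar : Pf tailEqStmt := ⟨bound 18⟩

namespace Pf

variable {P X a b l m : Bld}

def nilNeCons (p : Pf (Id (List' X) (Nil X) (Cons X a l))) : Pf P :=
  .absurd ((nilNeConsVar.app X |>.app a |>.app l).mp p)

def headEq (p : Pf (Id (List' X) (Cons X a l) (Cons X b m))) : Pf (Id X a b) :=
  (headEqVar.app X |>.app a |>.app l |>.app b |>.app m).mp p

def tailEq (p : Pf (Id (List' X) (Cons X a l) (Cons X b m))) : Pf (Id (List' X) l m) :=
  (tailEqVar.app X |>.app a |>.app l |>.app b |>.app m).mp p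

end Pf

/-! ### Decidable equality of lists, subtypes and retracts -/

abbrev decEqListStmt : Bld :=
  Pi (U 0) fun X => DecEq X ⇾ DecEq (List' X)

def decEqListProof : Pf decEqListStmt :=
  .all fun X => .intro fun D => .all fun l =>
    .listInd (fun l => Pi (List' X) fun m => Dec (Id (List' X) l m))
      (.all fun m => .listInd (fun m => Dec (Id (List' X) (Nil X) m)) (.inl .rfl)
        (fun _ _ _ => .inr (.intro fun p => .nilNeCons p)) m)
      (fun a l ih => .all fun m => .listInd (fun m => Dec (Id (List' X) (Cons X a l) m))
        (.inr (.intro fun p => .nilNeCons p.symm))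
        (fun b m _ => .cases (D.app a |>.app b : Pf (Dec (Id X a b))) (fun _ => _)
          (fun p => .cases (ih.app m) (fun _ => _)
            (fun q => .inl (.trans (.congr (fun a => Cons X a l) p) (.congr (Cons X b) q)))
            (fun n => .inr (.intro fun q => n.mp q.tailEq)))
          (fun n => .inr (.intro fun q => n.mp q.headEq))) m) l

def decEqListCtx : List Tm :=
  decEqListStmt 19 :: tailEqCtx

theorem decEqList_derivable : Derivable 18 decEqListCtx :=
  tailEq_derivable.check (decEqListProof.tm 19)
    (by decide +kernel)

def decEqListVar : Pf decEqListStmt := ⟨bound 19⟩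

abbrev decEqSigStmt : Bld :=
  Pi (U 0) fun X => Pi (X ⇾ U 0) fun P => (Pi X fun x => IsProp (P ⬝ x)) ⇾ DecEq X ⇾
    DecEq (Sig X fun x => P ⬝ x)

def decEqSigProof : Pf decEqSigStmt :=
  .all fun X => .all fun P => .intro fun hP => .intro fun D => .all fun u => .all fun v =>
    let F := Fst X fun x => P ⬝ x
    .cases (D.app (F u) |>.app (F v) : Pf (Dec (Id X (F u) (F v)))) (fun _ => _)
      (fun p => .inl (((sigEqVar.app X |>.app P).mp hP |>.app u |>.app v).mp p))
      (fun n => .inr (.intro fun p => n.mp (.congr F p)))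

def decEqSigCtx : List Tm :=
  decEqSigStmt 20 :: decEqListCtx

theorem decEqSig_derivable : Derivable 19 decEqSigCtx :=
  decEqList_derivable.check (decEqSigProof.tm 20)
    (by decide +kernel)

def decEqSigVar : Pf decEqSigStmt := ⟨bound 20⟩

/-- A map with a left inverse both preserves and reflects equality. Nothing is assumed about
truncation of the source, which allows an application to `F A`. -/
abbrev decEqOfRetractStmt : Bld :=
  Pi (U 0) fun X => Pi (U 0) fun Y => Pi (X ⇾ Y) fun f => Pi (Y ⇾ X) fun g =>
    LeftInv X f g ⇾ DecEq Y ⇾ DecEq X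

def decEqOfRetractProof : Pf decEqOfRetractStmt :=
  .all fun X => .all fun Y => .all fun f => .all fun g => .intro fun h => .intro fun D =>
    .all fun x => .all fun y =>
      .cases (D.app (f ⬝ x) |>.app (f ⬝ y) : Pf (Dec (Id Y (f ⬝ x) (f ⬝ y)))) (fun _ => _)
        (fun p => .inl (.trans (h.app x).symm (.trans (.congr (fun y => g ⬝ y) p) (h.app y))))
        (fun n => .inr (.intro fun p => n.mp (.congr (fun x => f ⬝ x) p)))

def decEqOfRetractCtx : List Tm :=
  decEqOfRetractStmt 21 :: decEqSigCtx

theorem decEqOfRetract_derivable : Derivable 20 decEqOfRetractCtx :=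
  decEqSig_derivable.check (decEqOfRetractProof.tm 21)
    (by decide +kernel)

def decEqOfRetractVar : Pf decEqOfRetractStmt := ⟨bound 21⟩

/-- The half-adjoint condition compares parallel paths in the codomain, so it is free when that is a
set. -/
abbrev isEquivOfIsSetStmt : Bld :=
  Pi (U 0) fun X => Pi (U 0) fun Y => Pi (X ⇾ Y) fun f => Pi (Y ⇾ X) fun g =>
    IsSet Y ⇾ LeftInv X f g ⇾ RightInv Y f g ⇾ IsEquiv X Y f

def isEquivOfIsSetProof : Pf isEquivOfIsSetStmt :=
  .all fun X => .all fun Y => .all fun f => .all fun g => .intro fun hY =>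
    .intro fun η => .intro fun ε =>
    ⟨Pair (Y ⇾ X) (fun g => Sig (LeftInv X f g) fun η => Sig (RightInv Y f g) fun ε =>
        HalfAdj X Y f g η ε) g <|
      Pair (LeftInv X f g) (fun η => Sig (RightInv Y f g) fun ε => HalfAdj X Y f g η ε) η.tm <|
      Pair (RightInv Y f g) (fun ε => HalfAdj X Y f g η.tm ε) ε.tm <|
      Lam fun x => hY.tm ⬝ (f ⬝ (g ⬝ (f ⬝ x))) ⬝ (f ⬝ x) ⬝
        apf X Y f (g ⬝ (f ⬝ x)) x (η.tm ⬝ x) ⬝ (ε.tm ⬝ (f ⬝ x))⟩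

def isEquivOfIsSetCtx : List Tm :=
  isEquivOfIsSetStmt 22 :: decEqOfRetractCtx

theorem isEquivOfIsSet_derivable : Derivable 21 isEquivOfIsSetCtx :=
  decEqOfRetract_derivable.check (isEquivOfIsSetProof.tm 22)
    (by decide +kernel)

def isEquivOfIsSetVar : Pf isEquivOfIsSetStmt := ⟨bound 22⟩

/-! ### Words in normal form -/

/-- The type of generators, and the proof that its equality is decidable. -/
def gens : Bld := bound 0
def decGens : Pf (DecEq gens) := ⟨bound 1⟩

abbrev Letter : Bld := Signed gens
abbrev Word : Bld := Words gens
abbrev inv (s : Bld) : Bld := flip gens s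
abbrev word (s w : Bld) : Bld := consWord gens s w
abbrev nil : Bld := Nil Letter
abbrev Normal (w : Bld) : Bld := IsNormal gens w

def Pf.letterInd (C : Bld → Bld) (l : (a : Bld) → Pf (C (Inl gens gens a)))
    (r : (a : Bld) → Pf (C (Inr gens gens a))) (s : Bld) : Pf (C s) :=
  .sumInd C l r s

def Pf.wordInd (C : Bld → Bld) (n : Pf (C nil)) (c : (s w : Bld) → Pf (C w) → Pf (C (word s w)))
    (w : Bld) : Pf (C w) :=
  .listInd (X := Letter) C n c w

abbrev decEqLetterStmt : Bld :=
  DecEq Letter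

def decEqLetterProof : Pf decEqLetterStmt :=
  (decEqSumVar.app gens).mp decGens

def decEqLetterCtx : List Tm :=
  decEqLetterStmt 23 :: isEquivOfIsSetCtx

theorem decEqLetter_derivable : Derivable 22 decEqLetterCtx :=
  isEquivOfIsSet_derivable.check (decEqLetterProof.tm 23)
    (by decide +kernel)

def decEqLetterVar : Pf decEqLetterStmt := ⟨bound 23⟩

def letterEq (s t : Bld) : Pf (Dec (Id Letter s t)) :=
  (decEqLetterVar : Pf (DecEq Letter)).app s |>.app t

/-- The decision is a parameter so that proofs about `step` can generalise over it and then compute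
in each case. -/
def stepCases (s t w d : Bld) : Bld :=
  SumElim (Id Letter t (inv s)) (Not (Id Letter t (inv s))) (fun _ => Word) (fun _ => w)
    (fun _ => word s (word t w)) d

/-- The product of a letter and a word: cancel `s` against the first letter of `w`, or prepend it. -/
def step (s w : Bld) : Bld :=
  ListElim Letter (fun _ => Word) (word s nil)
    (fun t w _ => stepCases s t w (letterEq t (inv s)).tm) w

abbrev invInvStmt : Bld :=
  Pi Letter fun s => Id Letter (inv (inv s)) s

def invInvProof : Pf invInvStmt :=
  .all fun s => .letterInd (fun s => Id Letter (inv (inv s)) s) (fun _ => .rfl) (fun _ => .rfl) s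

def invInvCtx : List Tm :=
  invInvStmt 24 :: decEqLetterCtx

theorem invInv_derivable : Derivable 23 invInvCtx :=
  decEqLetter_derivable.check (invInvProof.tm 24)
    (by decide +kernel)

def invInvVar : Pf invInvStmt := ⟨bound 24⟩

abbrev stepYesStmt : Bld :=
  Pi Letter fun s => Pi Letter fun t => Pi Word fun w =>
    Id Letter t (inv s) ⇾ Id Word (step s (word t w)) w

def stepYesProof : Pf stepYesStmt :=
  .all fun s => .all fun t => .all fun w => .intro fun e =>
    .cast (.cases (letterEq t (inv s)) (fun d => Id Word (stepCases s t w d) w)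
      (fun _ => .rfl) (fun n => .absurd (n.mp e)))

def stepYesCtx : List Tm :=
  stepYesStmt 25 :: invInvCtx

theorem stepYes_derivable : Derivable 24 stepYesCtx :=
  invInv_derivable.check (stepYesProof.tm 25)
    (by decide +kernel)

def stepYesVar : Pf stepYesStmt := ⟨bound 25⟩

/-! ### Normal words and the action of letters -/

abbrev normalNilStmt : Bld :=
  Normal nil

def normalNilProof : Pf normalNilStmt :=
  .all fun x => .all fun s => .all fun y =>
    let r := word s (word (inv s) y)
    .wordInd (fun x => Id Word nil (append gens x r) ⇾ Empty)
      (.intro fun p => .nilNeCons (p.cast : Pf (Id (List' Letter) (Nil Letter) (Cons Letter s (word (inv s) y)))))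
      (fun t x _ => .intro fun p =>
        .nilNeCons (p.cast : Pf (Id (List' Letter) (Nil Letter) (Cons Letter t (append gens x r))))) x

def normalNilCtx : List Tm :=
  normalNilStmt 26 :: stepYesCtx

theorem normalNil_derivable : Derivable 25 normalNilCtx :=
  stepYes_derivable.check (normalNilProof.tm 26)
    (by decide +kernel)

def normalNilVar : Pf normalNilStmt := ⟨bound 26⟩

abbrev normalTailStmt : Bld :=
  Pi Letter fun s => Pi Word fun w => Normal (word s w) ⇾ Normal w

def normalTailProof : Pf normalTailStmt :=
  .all fun s => .all fun w => .intro fun h => .all fun x => .all fun t => .all fun y => .intro fun p =>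
    (h.app (word s x) |>.app t |>.app y).mp (.cast (.congr (Y := Word) (word s) p))

def normalTailCtx : List Tm :=
  normalTailStmt 27 :: normalNilCtx

theorem normalTail_derivable : Derivable 26 normalTailCtx :=
  normalNil_derivable.check (normalTailProof.tm 27)
    (by decide +kernel)

def normalTailVar : Pf normalTailStmt := ⟨bound 27⟩

abbrev normalNeStmt : Bld :=
  Pi Letter fun s => Pi Word fun w => Not (Normal (word s (word (inv s) w)))

def normalNeProof : Pf normalNeStmt :=
  .all fun s => .all fun w => .intro fun h => (h.app nil |>.app s |>.app w).mp .rfl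

def normalNeCtx : List Tm :=
  normalNeStmt 28 :: normalTailCtx

theorem normalNe_derivable : Derivable 27 normalNeCtx :=
  normalTail_derivable.check (normalNeProof.tm 28)
    (by decide +kernel)

def normalNeVar : Pf normalNeStmt := ⟨bound 28⟩

/-- A redex at the front would force the second letter to be the inverse of the first; any other
redex lies in the tail. -/
abbrev normalConsStmt : Bld :=
  Pi Letter fun s => Pi Letter fun t => Pi Word fun w =>
    Normal (word t w) ⇾ Not (Id Letter t (inv s)) ⇾ Normal (word s (word t w))

def normalConsProof : Pf normalConsStmt :=
  .all fun s => .all fun t => .all fun w => .intro fun h => .intro fun n =>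
    .all fun x => .all fun r => .all fun y =>
    let z := word r (word (inv r) y)
    .wordInd (fun x => Id Word (word s (word t w)) (append gens x z) ⇾ Empty)
      (.intro fun p =>
        let p : Pf (Id (List' Letter) (Cons Letter s (word t w)) (Cons Letter r (word (inv r) y))) := p.cast
        let q : Pf (Id (List' Letter) (Cons Letter t w) (Cons Letter (inv r) y)) := p.tailEq
        n.mp (.trans q.headEq (.congr inv p.headEq.symm)))
      (fun u x _ => .intro fun p =>
        let p : Pf (Id (List' Letter) (Cons Letter s (word t w)) (Cons Letter u (append gens x z))) := p.cast
        (h.app x |>.app r |>.app y).mp p.tailEq) x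

def normalConsCtx : List Tm :=
  normalConsStmt 29 :: normalNeCtx

theorem normalCons_derivable : Derivable 28 normalConsCtx :=
  normalNe_derivable.check (normalConsProof.tm 29)
    (by decide +kernel)

def normalConsVar : Pf normalConsStmt := ⟨bound 29⟩

abbrev normalSingleStmt : Bld :=
  Pi Letter fun s => Normal (word s nil)

def normalSingleProof : Pf normalSingleStmt :=
  .all fun s => .all fun x => .all fun r => .all fun y =>
    let z := word r (word (inv r) y)
    .wordInd (fun x => Id Word (word s nil) (append gens x z) ⇾ Empty)
      (.intro fun p =>
        let p : Pf (Id (List' Letter) (Cons Letter s nil) (Cons Letter r (word (inv r) y))) := p.cast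
        .nilNeCons (p.tailEq : Pf (Id (List' Letter) (Nil Letter) (Cons Letter (inv r) y))))
      (fun u x _ => .intro fun p =>
        let p : Pf (Id (List' Letter) (Cons Letter s nil) (Cons Letter u (append gens x z))) := p.cast
        (normalNilVar.app x |>.app r |>.app y).mp p.tailEq) x

def normalSingleCtx : List Tm :=
  normalSingleStmt 30 :: normalConsCtx

theorem normalSingle_derivable : Derivable 29 normalSingleCtx :=
  normalCons_derivable.check (normalSingleProof.tm 30)
    (by decide +kernel)

def normalSingleVar : Pf normalSingleStmt := ⟨bound 30⟩

abbrev normalStepStmt : Bld :=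
  Pi Letter fun s => Pi Word fun w => Normal w ⇾ Normal (step s w)

def normalStepProof : Pf normalStepStmt :=
  .all fun s => .all fun w =>
    .wordInd (fun w => Normal w ⇾ Normal (step s w)) (.intro fun _ => (normalSingleVar.app s).cast)
      (fun t w _ => .intro fun h => .cast (.cases (letterEq t (inv s))
        (fun d => Normal (stepCases s t w d)) (fun _ => .cast ((normalTailVar.app t |>.app w).mp h))
        (fun n => .cast (((normalConsVar.app s |>.app t |>.app w).mp h).mp n)))) w

def normalStepCtx : List Tm :=
  normalStepStmt 31 :: normalSingleCtx

theorem normalStep_derivable : Derivable 30 normalStepCtx :=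
  normalSingle_derivable.check (normalStepProof.tm 31)
    (by decide +kernel)

def normalStepVar : Pf normalStepStmt := ⟨bound 31⟩

/-- A cancellation would mean that the prepended word starts with a redex. -/
abbrev stepNormalStmt : Bld :=
  Pi Letter fun s => Pi Word fun w => Normal (word s w) ⇾ Id Word (step s w) (word s w)

def stepNormalProof : Pf stepNormalStmt :=
  .all fun s => .all fun w =>
    .wordInd (fun w => Normal (word s w) ⇾ Id Word (step s w) (word s w)) (.intro fun _ => .rfl)
      (fun t w _ => .intro fun h => .cast (.cases (letterEq t (inv s))
        (fun d => Id Word (stepCases s t w d) (word s (word t w)))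
        (fun e => .absurd ((normalNeVar.app s |>.app w).mp
          (.transport (fun t => Normal (word s (word t w))) e h)))
        (fun _ => .rfl))) w

def stepNormalCtx : List Tm :=
  stepNormalStmt 32 :: normalStepCtx

theorem stepNormal_derivable : Derivable 31 stepNormalCtx :=
  normalStep_derivable.check (stepNormalProof.tm 32)
    (by decide +kernel)

def stepNormalVar : Pf stepNormalStmt := ⟨bound 32⟩

/-- If the first step cancels, normality of the original word ensures that the second one prepends
the lost letter again. If the first step prepends, the second cancels, as inversion of letters is an
involution. -/
abbrev stepStepStmt : Bld :=
  Pi Letter fun s => Pi Word fun w => Normal w ⇾ Id Word (step (inv s) (step s w)) w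

def stepStepProof : Pf stepStepStmt :=
  .all fun s => .all fun w =>
    .wordInd (fun w => Normal w ⇾ Id Word (step (inv s) (step s w)) w)
      (.intro fun _ => .cast
        ((stepYesVar.app (inv s) |>.app s |>.app nil).mp (invInvVar.app s).symm))
      (fun t w _ => .intro fun h => .cast (.cases (letterEq t (inv s))
        (fun d => Id Word (step (inv s) (stepCases s t w d)) (word t w))
        -- Rewriting the first letter by `e` turns the hypothesis on the word into normality of the
        -- inverse of `s` followed by `w`.
        (fun e => .cast (.trans ((stepNormalVar.app (inv s) |>.app w).mp
            (.transport (fun t => Normal (word t w)) e h))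
          (.congr (fun t => word t w) e.symm)))
        (fun _ => .cast
          ((stepYesVar.app (inv s) |>.app s |>.app (word t w)).mp (invInvVar.app s).symm)))) w

def stepStepCtx : List Tm :=
  stepStepStmt 33 :: stepNormalCtx

theorem stepStep_derivable : Derivable 32 stepStepCtx :=
  stepNormal_derivable.check (stepStepProof.tm 33)
    (by decide +kernel)

def stepStepVar : Pf stepStepStmt := ⟨bound 33⟩

/-- Normality is a family of functions into the empty type, so function extensionality applies. -/
abbrev isPropNormalStmt : Bld :=
  Pi Word fun w => IsProp (Normal w)

def isPropNormalProof : Pf isPropNormalStmt :=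
  .all fun w => .all fun h => .all fun k =>
    .funext fun x => .funext fun s => .funext fun y => .funext fun p => .absurd ⟨h ⬝ x ⬝ s ⬝ y ⬝ p⟩

def isPropNormalCtx : List Tm :=
  isPropNormalStmt 34 :: stepStepCtx

theorem isPropNormal_derivable : Derivable 33 isPropNormalCtx :=
  stepStep_derivable.check (isPropNormalProof.tm 34)
    (by decide +kernel)

def isPropNormalVar : Pf isPropNormalStmt := ⟨bound 34⟩

/-! ### The set of normal words -/

abbrev Reduced : Bld := NormalWords gens

abbrev reducedExtStmt : Bld :=
  let F := Fst Word Normal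
  Pi Reduced fun u => Pi Reduced fun v => Id Word (F u) (F v) ⇾ Id Reduced u v

def reducedExtProof : Pf reducedExtStmt :=
  ((sigEqVar.app Word |>.app (Lam Normal)).mp isPropNormalVar.cast).cast

def reducedExtCtx : List Tm :=
  reducedExtStmt 35 :: isPropNormalCtx

theorem reducedExt_derivable : Derivable 34 reducedExtCtx :=
  isPropNormal_derivable.check (reducedExtProof.tm 35)
    (by decide +kernel)

def reducedExtVar : Pf reducedExtStmt := ⟨bound 35⟩

abbrev decEqReducedStmt : Bld :=
  DecEq Reduced

def decEqReducedProof : Pf decEqReducedStmt :=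
  .cast (((decEqSigVar.app Word |>.app (Lam Normal)).mp isPropNormalVar.cast).mp
    ((decEqListVar.app Letter).mp decEqLetterVar))

def decEqReducedCtx : List Tm :=
  decEqReducedStmt 36 :: reducedExtCtx

theorem decEqReduced_derivable : Derivable 35 decEqReducedCtx :=
  reducedExt_derivable.check (decEqReducedProof.tm 36)
    (by decide +kernel)

def decEqReducedVar : Pf decEqReducedStmt := ⟨bound 36⟩

abbrev isSetReducedStmt : Bld :=
  IsSet Reduced

def isSetReducedProof : Pf isSetReducedStmt :=
  (isSetOfDecEqVar.app Reduced).mp decEqReducedVar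

def isSetReducedCtx : List Tm :=
  isSetReducedStmt 37 :: decEqReducedCtx

theorem isSetReduced_derivable : Derivable 36 isSetReducedCtx :=
  decEqReduced_derivable.check (isSetReducedProof.tm 37)
    (by decide +kernel)

def isSetReducedVar : Pf isSetReducedStmt := ⟨bound 37⟩

def reduced (w : Bld) (h : Pf (Normal w)) : Bld := Pair Word Normal w h.tm
def wordOf (n : Bld) : Bld := Fst Word Normal n
def normalOf (n : Bld) : Pf (Normal (wordOf n)) := ⟨Snd Word Normal n⟩

/-- Only the underlying word is kept in the characteristic property: the normality proof is
irrelevant by `reducedExt`. -/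
abbrev stepReducedType : Bld :=
  Letter ⇾ Reduced ⇾ Reduced

abbrev stepReducedSpec (f : Bld) : Bld :=
  Pi Letter fun s => Pi Reduced fun n => Id Word (wordOf (f ⬝ s ⬝ n)) (step s (wordOf n))

def stepReducedValue : Bld :=
  Lam fun s => Lam fun n =>
    reduced (step s (wordOf n)) ((normalStepVar.app s |>.app (wordOf n)).mp (normalOf n))

def stepReducedProof : Pf (stepReducedSpec stepReducedValue) :=
  .all fun s => .all fun n => .cast (.rfl : Pf (Id Word (step s (wordOf n)) (step s (wordOf n))))

def stepReducedCtx : List Tm :=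
  stepReducedSpec (bound 38) 39 :: stepReducedType 38 :: isSetReducedCtx

theorem stepReduced_derivable : Derivable 38 stepReducedCtx :=
  isSetReduced_derivable.opaqueDef (stepReducedValue 38) (stepReducedProof.tm 38)
    (by decide +kernel)

def stepReducedFn : Bld := bound 38
def stepReducedEq : Pf (stepReducedSpec stepReducedFn) := ⟨bound 39⟩

def stepReduced (s n : Bld) : Bld := stepReducedFn ⬝ s ⬝ n

def wordOfStepReduced (s n : Bld) : Pf (Id Word (wordOf (stepReduced s n)) (step s (wordOf n))) :=
  stepReducedEq.app s |>.app n

abbrev stepReducedStepStmt : Bld :=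
  Pi Letter fun s => Pi Reduced fun n => Id Reduced (stepReduced (inv s) (stepReduced s n)) n

def stepReducedStepProof : Pf stepReducedStepStmt :=
  .all fun s => .all fun n =>
    (reducedExtVar.app (stepReduced (inv s) (stepReduced s n)) |>.app n).mp
      (.cast (.trans (wordOfStepReduced (inv s) (stepReduced s n))
        (.trans (.congr (step (inv s)) (wordOfStepReduced s n))
          ((stepStepVar.app s |>.app (wordOf n)).mp (normalOf n)))))

def stepReducedStepCtx : List Tm :=
  stepReducedStepStmt 40 :: stepReducedCtx

theorem stepReducedStep_derivable : Derivable 39 stepReducedStepCtx :=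
  stepReduced_derivable.check (stepReducedStepProof.tm 40)
    (by decide +kernel)

def stepReducedStepVar : Pf stepReducedStepStmt := ⟨bound 40⟩

/-! ### Induction for the free infinity-group -/

abbrev Free : Bld := FF gens
abbrev one : Bld := Funit gens
abbrev cons (a x : Bld) : Bld := Fcons gens a x
abbrev icons (a x : Bld) : Bld := Ficons gens a x
abbrev iconsCons (a x : Bld) : Bld := icons a (cons a x)
abbrev Lam₂ (f : Bld → Bld → Bld) : Bld := Lam fun a => Lam fun x => f a x
abbrev Lam₃ (f : Bld → Bld → Bld → Bld) : Bld := Lam fun a => Lam fun x => Lam fun y => f a x y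

/-- Every value of `f` is attained. -/
def Section (X Y f : Bld) : Bld := Pi Y fun y => Sig X fun x => Id Y (f ⬝ x) y
/-- Every path between values of `f` is the image of a path. -/
def PathSection (X Y f : Bld) : Bld :=
  Pi X fun x => Pi X fun y => Pi (Id Y (f ⬝ x) (f ⬝ y)) fun r =>
    Sig (Id X x y) fun q => Id (Id Y (f ⬝ x) (f ⬝ y)) (apf X Y f x y q) r

abbrev transportSectionStmt : Bld :=
  Pi (U 0) fun X => Pi (X ⇾ U 0) fun P => Pi X fun x => Pi X fun y => Pi (Id X x y) fun p =>
    Pi (P ⬝ y) fun v => Sig (P ⬝ x) fun u => PathOver X P x y p u v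

def transportSectionProof : Pf transportSectionStmt :=
  .all fun X => .all fun P => .all fun x => .all fun y => .intro fun p =>
    .pathInd (fun y p => Pi (P ⬝ y) fun v => Sig (P ⬝ x) fun u => PathOver X P x y p u v)
      (.all fun v => ⟨Pair (P ⬝ x) (fun u => Id (P ⬝ x) u v) v (Refl (P ⬝ x) v)⟩) p

def transportSectionCtx : List Tm :=
  transportSectionStmt 41 :: stepReducedStepCtx

theorem transportSection_derivable : Derivable 40 transportSectionCtx :=
  stepReducedStep_derivable.check (transportSectionProof.tm 41)
    (by decide +kernel)

def transportSectionVar : Pf transportSectionStmt := ⟨bound 41⟩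

/-- A split surjection onto one fibre remains split surjective after transport to another; path
induction reduces this to the hypothesis. It will supply the operation over `icons_a`. -/
abbrev pathOverSectionStmt : Bld :=
  Pi (U 0) fun X => Pi (X ⇾ U 0) fun P => Pi X fun x => Pi X fun y => Pi (Id X x y) fun p =>
    Pi (U 0) fun Y => Pi (Y ⇾ P ⬝ x) fun f => Section Y (P ⬝ x) f ⇾
    Pi (P ⬝ y) fun v => Sig Y fun u => PathOver X P x y p (f ⬝ u) v

def pathOverSectionProof : Pf pathOverSectionStmt :=
  .all fun X => .all fun P => .all fun x => .all fun y => .intro fun p =>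
    .all fun Y => .all fun f => .intro fun h =>
    .pathInd (fun y p => Pi (P ⬝ y) fun v => Sig Y fun u => PathOver X P x y p (f ⬝ u) v) h.cast p

def pathOverSectionCtx : List Tm :=
  pathOverSectionStmt 42 :: transportSectionCtx

theorem pathOverSection_derivable : Derivable 41 pathOverSectionCtx :=
  transportSection_derivable.check (pathOverSectionProof.tm 42)
    (by decide +kernel)

def pathOverSectionVar : Pf pathOverSectionStmt := ⟨bound 42⟩

/-- The type of the operation `c` of a family `P`. -/
def ConsOp (P : Bld) : Bld := Pi gens fun a => Pi Free fun x => P ⬝ x ⇾ P ⬝ cons a x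
def IconsOp (P : Bld) : Bld := Pi gens fun a => Pi Free fun x => P ⬝ x ⇾ P ⬝ icons a x
def ConsSection (P c : Bld) : Bld :=
  Pi gens fun a => Pi Free fun x => Section (P ⬝ x) (P ⬝ cons a x) (c ⬝ a ⬝ x)
def ConsPathSection (P c : Bld) : Bld :=
  Pi gens fun a => Pi Free fun x => PathSection (P ⬝ x) (P ⬝ cons a x) (c ⬝ a ⬝ x)

/-- The lifting of paths extends from paths within a fibre to paths over a base path, because over
`refl` the map `consOver` is the action of `c` on paths. -/
abbrev consOverSectionStmt : Bld :=
  Pi (Free ⇾ U 0) fun P => Pi (ConsOp P) fun c => ConsPathSection P c ⇾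
    Pi gens fun a => Pi Free fun x => Pi Free fun z => Pi (Id Free x z) fun p =>
    Pi (P ⬝ x) fun w => Pi (P ⬝ z) fun y =>
    let T := PathOver Free P (cons a x) (cons a z) (apCons gens a x z p) (c ⬝ a ⬝ x ⬝ w) (c ⬝ a ⬝ z ⬝ y)
    Pi T fun r => Sig (PathOver Free P x z p w y) fun q => Id T (consOver gens P c a x z p w y q) r

def consOverSectionProof : Pf consOverSectionStmt :=
  .all fun P => .all fun c => .intro fun h => .all fun a => .all fun x => .all fun z => .intro fun p =>
    .all fun w => .pathInd (fun z p =>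
      let T (y : Bld) := PathOver Free P (cons a x) (cons a z) (apCons gens a x z p)
        (c ⬝ a ⬝ x ⬝ w) (c ⬝ a ⬝ z ⬝ y)
      Pi (P ⬝ z) fun y => Pi (T y) fun r =>
        Sig (PathOver Free P x z p w y) fun q => Id (T y) (consOver gens P c a x z p w y q) r)
      (h.app a |>.app x |>.app w).cast p

def consOverSectionCtx : List Tm :=
  consOverSectionStmt 43 :: pathOverSectionCtx

theorem consOverSection_derivable : Derivable 42 consOverSectionCtx :=
  pathOverSection_derivable.check (consOverSectionProof.tm 43)
    (by decide +kernel)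

def consOverSectionVar : Pf consOverSectionStmt := ⟨bound 43⟩

/-- A path over `μ₂` is pulled back along `μ` to a path over `ap_{cons_a}(μ₁)` and from there lifted
to one over `μ₁`. The composite equation is the one required by the `μ` clause of induction. -/
abbrev muSectionStmt : Bld :=
  Pi (Free ⇾ U 0) fun P => Pi (ConsOp P) fun c => ConsPathSection P c ⇾
    Pi gens fun a => Pi Free fun x => Pi (P ⬝ iconsCons a x) fun w => Pi (P ⬝ x) fun y =>
    let x' := iconsCons a x
    let T := PathOver Free P (cons a x') (cons a x) (Fmu2 gens a (cons a x))
      (c ⬝ a ⬝ x' ⬝ w) (c ⬝ a ⬝ x ⬝ y)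
    Pi T fun r => Sig (PathOver Free P x' x (Fmu1 gens a x) w y) fun q =>
      Id T (trMu gens P a x (c ⬝ a ⬝ x' ⬝ w) (c ⬝ a ⬝ x ⬝ y)
        (consOver gens P c a x' x (Fmu1 gens a x) w y q)) r

def muSectionProof : Pf muSectionStmt :=
  .all fun P => .all fun c => .intro fun h => .all fun a => .all fun x => .all fun w => .all fun y =>
    let x' := iconsCons a x
    let v := c ⬝ a ⬝ x' ⬝ w
    let v' := c ⬝ a ⬝ x ⬝ y
    let C := cons a x
    let C' := cons a x'
    let μ₁ := Fmu1 gens a x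
    let μ₂ := Fmu2 gens a C
    let T (p : Bld) := PathOver Free P C' C p v v'
    let S := PathOver Free P x' x μ₁ w y
    let ov (q : Bld) := consOver gens P c a x' x μ₁ w y q
    .all fun r =>
      let R := Sig S fun q => Id (T μ₂) (trMu gens P a x v v' (ov q)) r
      let p := apCons gens a x' x μ₁
      .sigInd (X := T p) (B := fun u => PathOver (Id Free C' C) (Lam T) p μ₂ (Fmu gens a x) u r)
        (fun _ => R) (fun u hu =>
          .sigInd (X := S) (B := fun q => Id (T p) (ov q) u) (fun _ => R) (fun q hq =>
            let hq : Pf (Id (T p) (ov q) u) := ⟨hq⟩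
            ⟨Pair S (fun q => Id (T μ₂) (trMu gens P a x v v' (ov q)) r) q
              (Pf.trans (.congr (trMu gens P a x v v') hq)
                (⟨hu⟩ : Pf (Id (T μ₂) (trMu gens P a x v v' u) r))).tm⟩)
            (consOverSectionVar.tm ⬝ P ⬝ c ⬝ h.tm ⬝ a ⬝ x' ⬝ x ⬝ μ₁ ⬝ w ⬝ y ⬝ u))
        (transportSectionVar.tm ⬝ Id Free C' C ⬝ Lam T ⬝ p ⬝ μ₂ ⬝ Fmu gens a x ⬝ r)

def muSectionCtx : List Tm :=
  muSectionStmt 44 :: consOverSectionCtx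

theorem muSection_derivable : Derivable 43 muSectionCtx :=
  consOverSection_derivable.check (muSectionProof.tm 44)
    (by decide +kernel)

def muSectionVar : Pf muSectionStmt := ⟨bound 44⟩

/-- Induction reduced to the unit and the `cons` operation. The two section hypotheses are what is
needed of `c` being a fibrewise equivalence: surjectivity on points supplies the inverse operation
and `m₂`, surjectivity on paths supplies `m₁` and `m`. -/
abbrev freeIndStmt : Bld :=
  Pi (Free ⇾ U 0) fun P => P ⬝ one ⇾ Pi (ConsOp P) fun c =>
    ConsSection P c ⇾ ConsPathSection P c ⇾ Pi Free fun x => P ⬝ x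

def freeIndProof : Pf freeIndStmt :=
  .all fun P => .intro fun u => .all fun c => .intro fun h => .intro fun k =>
    let over₂ (a x y w : Bld) :=
      PathOver Free P (cons a (icons a x)) x (Fmu2 gens a x) (c ⬝ a ⬝ icons a x ⬝ w) y
    let s (a x y : Bld) := pathOverSectionVar.tm ⬝ Free ⬝ P ⬝ cons a (icons a x) ⬝ x ⬝ Fmu2 gens a x ⬝
      (P ⬝ icons a x) ⬝ (c ⬝ a ⬝ icons a x) ⬝ (h.tm ⬝ a ⬝ icons a x) ⬝ y
    -- The chosen preimage of `y` under `c`, over `μ₂`; the path accompanying it is `m₂`.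
    let d (a x y : Bld) := Fst (P ⬝ icons a x) (over₂ a x y) (s a x y)
    let m₂ (a x y : Bld) := Snd (P ⬝ icons a x) (over₂ a x y) (s a x y)
    let y' (a x y : Bld) := c ⬝ a ⬝ x ⬝ y
    let w (a x y : Bld) := d a (cons a x) (y' a x y)
    let over₁ (a x y : Bld) := PathOver Free P (iconsCons a x) x (Fmu1 gens a x) (w a x y) y
    let v (a x y : Bld) := c ⬝ a ⬝ iconsCons a x ⬝ w a x y
    let ov (a x y q : Bld) :=
      Id (PathOver Free P (cons a (iconsCons a x)) (cons a x) (Fmu2 gens a (cons a x))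
          (v a x y) (y' a x y))
        (trMu gens P a x (v a x y) (y' a x y)
          (consOver gens P c a (iconsCons a x) x (Fmu1 gens a x) (w a x y) y q))
        (m₂ a (cons a x) (y' a x y))
    -- Lifting the already chosen `m₂` gives `m₁` as first and `m` as second component.
    let t (a x y : Bld) := muSectionVar.tm ⬝ P ⬝ c ⬝ k.tm ⬝ a ⬝ x ⬝ w a x y ⬝ y ⬝ m₂ a (cons a x) (y' a x y)
    ⟨Find gens P u c (Lam₃ d) (Lam₃ fun a x y => Fst (over₁ a x y) (ov a x y) (t a x y)) (Lam₃ m₂)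
      (Lam₃ fun a x y => Snd (over₁ a x y) (ov a x y) (t a x y))⟩

def freeIndCtx : List Tm :=
  freeIndStmt 45 :: muSectionCtx

theorem freeInd_derivable : Derivable 44 freeIndCtx :=
  muSection_derivable.check (freeIndProof.tm 45)
    (by decide +kernel)

def freeIndVar : Pf freeIndStmt := ⟨bound 45⟩

/-! ### Transport in the universe, and univalence -/

def coe (X Y Q u : Bld) : Bld := tr (U 0) (Lam fun X => X) X Y Q u

abbrev coeSectionStmt : Bld :=
  Pi (U 0) fun X => Pi (U 0) fun Y => Pi (Id (U 0) X Y) fun Q => Section X Y (Lam (coe X Y Q))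

def coeSectionProof : Pf coeSectionStmt :=
  .all fun X => .all fun Y => .intro fun Q =>
    .pathInd (fun Y Q => Section X Y (Lam (coe X Y Q)))
      (.all fun x => ⟨Pair X (fun u => Id X u x) x (Refl X x)⟩) Q

def coeSectionCtx : List Tm :=
  coeSectionStmt 46 :: freeIndCtx

theorem coeSection_derivable : Derivable 45 coeSectionCtx :=
  freeInd_derivable.check (coeSectionProof.tm 46)
    (by decide +kernel)

def coeSectionVar : Pf coeSectionStmt := ⟨bound 46⟩

abbrev apfIdStmt : Bld :=
  Pi (U 0) fun X => Pi X fun x => Pi X fun y => Pi (Id X x y) fun p =>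
    Id (Id X x y) (apf X X (Lam fun x => x) x y p) p

def apfIdProof : Pf apfIdStmt :=
  .all fun X => .all fun x => .all fun y => .intro fun p =>
    .pathInd (fun y p => Id (Id X x y) (apf X X (Lam fun x => x) x y p) p) .rfl p

def apfIdCtx : List Tm :=
  apfIdStmt 47 :: coeSectionCtx

theorem apfId_derivable : Derivable 46 apfIdCtx :=
  coeSection_derivable.check (apfIdProof.tm 47)
    (by decide +kernel)

def apfIdVar : Pf apfIdStmt := ⟨bound 47⟩

/-- By path induction the coercion may be taken to be the identity, whose action on paths is the
identity by `apfId`. -/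
abbrev coePathSectionStmt : Bld :=
  Pi (U 0) fun X => Pi (U 0) fun Y => Pi (Id (U 0) X Y) fun Q => PathSection X Y (Lam (coe X Y Q))

def coePathSectionProof : Pf coePathSectionStmt :=
  .all fun X => .all fun Y => .intro fun Q =>
    .pathInd (fun Y Q => PathSection X Y (Lam (coe X Y Q)))
      (.all fun x => .all fun y => .all fun r =>
        ⟨Pair (Id X x y) (fun q => Id (Id X x y) (apf X X (Lam fun x => x) x y q) r) r
          (apfIdVar.tm ⬝ X ⬝ x ⬝ y ⬝ r)⟩) Q

def coePathSectionCtx : List Tm :=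
  coePathSectionStmt 48 :: apfIdCtx

theorem coePathSection_derivable : Derivable 47 coePathSectionCtx :=
  apfId_derivable.check (coePathSectionProof.tm 48)
    (by decide +kernel)

def coePathSectionVar : Pf coePathSectionStmt := ⟨bound 48⟩

/-- With equalities of types instead of maps, both section hypotheses of `freeInd` follow by path
induction. -/
abbrev freeIndOfPathStmt : Bld :=
  Pi (Free ⇾ U 0) fun P => P ⬝ one ⇾
    (Pi gens fun a => Pi Free fun x => Id (U 0) (P ⬝ x) (P ⬝ cons a x)) ⇾ Pi Free fun x => P ⬝ x

def freeIndOfPathProof : Pf freeIndOfPathStmt :=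
  .all fun P => .intro fun u => .intro fun Q =>
    ⟨freeIndVar.tm ⬝ P ⬝ u ⬝ (Lam₂ fun a x => Lam (coe (P ⬝ x) (P ⬝ cons a x) (Q.tm ⬝ a ⬝ x))) ⬝
      (Lam₂ fun a x => coeSectionVar.tm ⬝ (P ⬝ x) ⬝ (P ⬝ cons a x) ⬝ (Q.tm ⬝ a ⬝ x)) ⬝
      (Lam₂ fun a x => coePathSectionVar.tm ⬝ (P ⬝ x) ⬝ (P ⬝ cons a x) ⬝ (Q.tm ⬝ a ⬝ x))⟩

def freeIndOfPathCtx : List Tm :=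
  freeIndOfPathStmt 49 :: coePathSectionCtx

theorem freeIndOfPath_derivable : Derivable 48 freeIndOfPathCtx :=
  coePathSection_derivable.check (freeIndOfPathProof.tm 49)
    (by decide +kernel)

def freeIndOfPathVar : Pf freeIndOfPathStmt := ⟨bound 49⟩

abbrev pathOfPathStmt : Bld :=
  Pi (U 0) fun X => Pi (U 0) fun Y => Pi (Id (U 0) X Y) fun E => Pi X fun x => Pi X fun y =>
    let f := Fst (X ⇾ Y) (IsEquiv X Y) (idToEquivalence 0 X Y ⬝ E)
    Id (U 0) (Id X x y) (Id Y (f ⬝ x) (f ⬝ y))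

def pathOfPathProof : Pf pathOfPathStmt :=
  .all fun X => .all fun Y => .intro fun E => .all fun x => .all fun y =>
    let f (Y E : Bld) := Fst (X ⇾ Y) (IsEquiv X Y) (idToEquivalence 0 X Y ⬝ E)
    .pathInd (fun Y E => Id (U 0) (Id X x y) (Id Y (f Y E ⬝ x) (f Y E ⬝ y))) .rfl E

def pathOfPathCtx : List Tm :=
  pathOfPathStmt 50 :: freeIndOfPathCtx

theorem pathOfPath_derivable : Derivable 49 pathOfPathCtx :=
  freeIndOfPath_derivable.check (pathOfPathProof.tm 50)
    (by decide +kernel)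

def pathOfPathVar : Pf pathOfPathStmt := ⟨bound 50⟩

/-- Stated one level up, because it is applied to the type of equalities between small types. -/
abbrev rightInverseStmt : Bld :=
  Pi (U 1) fun X => Pi (U 1) fun Y => Pi (X ⇾ Y) fun f => IsEquiv X Y f ⇾
    Sig (Y ⇾ X) fun g => RightInv Y f g

def rightInverseProof : Pf rightInverseStmt :=
  .all fun X => .all fun Y => .all fun f => .intro fun e =>
    let R := Sig (Y ⇾ X) fun g => RightInv Y f g
    .sigInd (X := Y ⇾ X) (B := fun g => Sig (LeftInv X f g) fun η => Sig (RightInv Y f g) fun ε =>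
        HalfAdj X Y f g η ε) (fun _ => R) (fun g e =>
      .sigInd (X := LeftInv X f g) (B := fun η => Sig (RightInv Y f g) fun ε => HalfAdj X Y f g η ε)
        (fun _ => R) (fun η e =>
          .sigInd (X := RightInv Y f g) (B := fun ε => HalfAdj X Y f g η ε)
            (fun _ => R) (fun ε _ => ⟨Pair (Y ⇾ X) (fun g => RightInv Y f g) g ε⟩) e) e) e

def rightInverseCtx : List Tm :=
  rightInverseStmt 51 :: pathOfPathCtx

theorem rightInverse_derivable : Derivable 50 rightInverseCtx :=
  pathOfPath_derivable.check (rightInverseProof.tm 51)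
    (by decide +kernel)

def rightInverseVar : Pf rightInverseStmt := ⟨bound 51⟩

/-- Univalence allows an equivalence to be replaced by one induced by an equality of types, where
path induction makes the claim trivial (`pathOfPath`). -/
abbrev pathOfEquivStmt : Bld :=
  Pi (U 0) fun X => Pi (U 0) fun Y => Pi (X ⇾ Y) fun f => IsEquiv X Y f ⇾ Pi X fun x => Pi X fun y =>
    Id (U 0) (Id X x y) (Id Y (f ⬝ x) (f ⬝ y))

def pathOfEquivProof : Pf pathOfEquivStmt :=
  .all fun X => .all fun Y => .all fun f => .intro fun e => .all fun x => .all fun y =>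
    let S := Id (U 0) X Y
    let T := Equivalence X Y
    let i := idToEquivalence 0 X Y
    let fn (k : Bld) := Fst (X ⇾ Y) (IsEquiv X Y) k
    let k := Pair (X ⇾ Y) (IsEquiv X Y) f e
    .sigInd (X := T ⇾ S) (B := fun g => RightInv T i g)
      (fun _ => Id (U 0) (Id X x y) (Id Y (f ⬝ x) (f ⬝ y)))
      -- The path `ε k` leads from the equivalence induced by `g k` to `k` itself.
      (fun g ε => .cast (.pathInd (X := T) (x := i ⬝ (g ⬝ k)) (y := k)
        (fun k _ => Id (U 0) (Id X x y) (Id Y (fn k ⬝ x) (fn k ⬝ y)))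
        (pathOfPathVar.app X |>.app Y |>.app (g ⬝ k) |>.app x |>.app y) ⟨ε ⬝ k⟩))
      (rightInverseVar.tm ⬝ S ⬝ T ⬝ i ⬝ (cst (.univalence 0) ⬝ X ⬝ Y))

def pathOfEquivCtx : List Tm :=
  pathOfEquivStmt 52 :: rightInverseCtx

theorem pathOfEquiv_derivable : Derivable 51 pathOfEquivCtx :=
  rightInverse_derivable.check (pathOfEquivProof.tm 52)
    (by decide +kernel)

def pathOfEquivVar : Pf pathOfEquivStmt := ⟨bound 52⟩

/-- The constructors `μ₁`, `μ₂` and `μ` are exactly the data of a half-adjoint equivalence. -/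
abbrev consPathStmt : Bld :=
  Pi gens fun a => Pi Free fun x => Pi Free fun y =>
    Id (U 0) (Id Free x y) (Id Free (cons a x) (cons a y))

def consPathProof : Pf consPathStmt :=
  .all fun a =>
    let f := cst .fcons ⬝ gens ⬝ a
    let g := cst .ficons ⬝ gens ⬝ a
    let η := cst .fmu1 ⬝ gens ⬝ a
    let ε := cst .fmu2 ⬝ gens ⬝ a
    ⟨pathOfEquivVar.tm ⬝ Free ⬝ Free ⬝ f ⬝
      (Pair (Free ⇾ Free) (fun g => Sig (LeftInv Free f g) fun η => Sig (RightInv Free f g) fun ε =>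
          HalfAdj Free Free f g η ε) g <|
        Pair (LeftInv Free f g) (fun η => Sig (RightInv Free f g) fun ε =>
          HalfAdj Free Free f g η ε) η <|
        Pair (RightInv Free f g) (fun ε => HalfAdj Free Free f g η ε) ε (cst .fmu ⬝ gens ⬝ a))⟩

def consPathCtx : List Tm :=
  consPathStmt 53 :: pathOfEquivCtx

theorem consPath_derivable : Derivable 52 consPathCtx :=
  pathOfEquiv_derivable.check (consPathProof.tm 53)
    (by decide +kernel)

def consPathVar : Pf consPathStmt := ⟨bound 53⟩

/-! ### Recursion into sets -/

abbrev constOverStmt : Bld :=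
  Pi (U 0) fun X => Pi (U 0) fun Y => Pi X fun x => Pi X fun y => Pi (Id X x y) fun p =>
    Pi Y fun u => Pi Y fun v => Id Y u v ⇾ PathOver X (Lam fun _ => Y) x y p u v

def constOverProof : Pf constOverStmt :=
  .all fun X => .all fun Y => .all fun x => .all fun y => .intro fun p => .all fun u => .all fun v =>
    .intro fun q => .pathInd (fun y p => PathOver X (Lam fun _ => Y) x y p u v) q.cast p

def constOverCtx : List Tm :=
  constOverStmt 54 :: consPathCtx

theorem constOver_derivable : Derivable 53 constOverCtx :=
  consPath_derivable.check (constOverProof.tm 54)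
    (by decide +kernel)

def constOverVar : Pf constOverStmt := ⟨bound 54⟩

/-- The clause for `μ` is an equation between parallel paths in a fibre, hence automatic for
families of sets. -/
abbrev setMuStmt : Bld :=
  Pi (Free ⇾ U 0) fun P => (Pi Free fun x => IsSet (P ⬝ x)) ⇾
    Pi (ConsOp P) fun c => Pi (IconsOp P) fun d =>
    Pi (Pi gens fun a => Pi Free fun x => Pi (P ⬝ x) fun y =>
      PathOver Free P (iconsCons a x) x (Fmu1 gens a x) (d ⬝ a ⬝ cons a x ⬝ (c ⬝ a ⬝ x ⬝ y)) y) fun m₁ =>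
    Pi (Pi gens fun a => Pi Free fun x => Pi (P ⬝ x) fun y =>
      PathOver Free P (cons a (icons a x)) x (Fmu2 gens a x) (c ⬝ a ⬝ icons a x ⬝ (d ⬝ a ⬝ x ⬝ y)) y) fun m₂ =>
    Pi gens fun a => Pi Free fun x => Pi (P ⬝ x) fun y =>
      let x' := iconsCons a x
      let y' := d ⬝ a ⬝ cons a x ⬝ (c ⬝ a ⬝ x ⬝ y)
      let v := c ⬝ a ⬝ x' ⬝ y'
      let v' := c ⬝ a ⬝ x ⬝ y
      Id (PathOver Free P (cons a x') (cons a x) (Fmu2 gens a (cons a x)) v v')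
        (trMu gens P a x v v' (consOver gens P c a x' x (Fmu1 gens a x) y' y (m₁ ⬝ a ⬝ x ⬝ y)))
        (m₂ ⬝ a ⬝ cons a x ⬝ v')

def setMuProof : Pf setMuStmt :=
  .all fun P => .intro fun h => .all fun c => .all fun d => .all fun m₁ => .all fun m₂ =>
    .all fun a => .all fun x => .all fun y =>
      let x' := iconsCons a x
      let y' := d ⬝ a ⬝ cons a x ⬝ (c ⬝ a ⬝ x ⬝ y)
      let v := c ⬝ a ⬝ x' ⬝ y'
      let v' := c ⬝ a ⬝ x ⬝ y
      ⟨h.tm ⬝ cons a x ⬝ tr Free P (cons a x') (cons a x) (Fmu2 gens a (cons a x)) v ⬝ v' ⬝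
        trMu gens P a x v v' (consOver gens P c a x' x (Fmu1 gens a x) y' y (m₁ ⬝ a ⬝ x ⬝ y)) ⬝
        (m₂ ⬝ a ⬝ cons a x ⬝ v')⟩

def setMuCtx : List Tm :=
  setMuStmt 55 :: constOverCtx

theorem setMu_derivable : Derivable 54 setMuCtx :=
  constOver_derivable.check (setMuProof.tm 55)
    (by decide +kernel)

def setMuVar : Pf setMuStmt := ⟨bound 55⟩

/-- The equations of the function `f` that is given by `u`, `c` and `d`. -/
def RecEqs (X : Bld) (f : Bld → Bld) (u : Bld) (c d : Bld → Bld → Bld) : Bld :=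
  Prod (Id X (f one) u) <|
    Prod (Pi gens fun a => Pi Free fun x => Id X (f (cons a x)) (c a (f x)))
      (Pi gens fun a => Pi Free fun x => Id X (f (icons a x)) (d a (f x)))

/-- The type of families `T` indexed by a set `X` with an element and mutually inverse operations. -/
def PiRec (T : (X hX u c d h₁ h₂ : Bld) → Bld) : Bld :=
  Pi (U 0) fun X => Pi (IsSet X) fun hX => Pi X fun u =>
    Pi (gens ⇾ X ⇾ X) fun c => Pi (gens ⇾ X ⇾ X) fun d =>
    Pi (Pi gens fun a => Pi X fun y => Id X (d ⬝ a ⬝ (c ⬝ a ⬝ y)) y) fun h₁ =>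
    Pi (Pi gens fun a => Pi X fun y => Id X (c ⬝ a ⬝ (d ⬝ a ⬝ y)) y) fun h₂ => T X hX u c d h₁ h₂

def LamRec (t : (X hX u c d h₁ h₂ : Bld) → Bld) : Bld :=
  Lam fun X => Lam fun hX => Lam fun u => Lam fun c => Lam fun d => Lam fun h₁ => Lam fun h₂ =>
    t X hX u c d h₁ h₂

/-- The function from the free infinity-group to a set `X` that is given by `u : X` and by mutually
inverse operations `c` and `d`. -/
def recursor (X hX u c d h₁ h₂ : Bld) : Bld :=
  let P := Lam fun _ => X
  let C := Lam₃ fun a _ y => c ⬝ a ⬝ y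
  let D := Lam₃ fun a _ y => d ⬝ a ⬝ y
  let m₁ := Lam₃ fun a x y => constOverVar.tm ⬝ Free ⬝ X ⬝ iconsCons a x ⬝ x ⬝ Fmu1 gens a x ⬝
    (d ⬝ a ⬝ (c ⬝ a ⬝ y)) ⬝ y ⬝ (h₁ ⬝ a ⬝ y)
  let m₂ := Lam₃ fun a x y => constOverVar.tm ⬝ Free ⬝ X ⬝ cons a (icons a x) ⬝ x ⬝ Fmu2 gens a x ⬝
    (c ⬝ a ⬝ (d ⬝ a ⬝ y)) ⬝ y ⬝ (h₂ ⬝ a ⬝ y)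
  Lam fun x => Find gens P u C D m₁ m₂ (setMuVar.tm ⬝ P ⬝ (Lam fun _ => hX) ⬝ C ⬝ D ⬝ m₁ ⬝ m₂) ⬝ x

abbrev freeRecType : Bld :=
  PiRec fun X _ _ _ _ _ _ => Free ⇾ X

abbrev freeRecSpec (f : Bld) : Bld :=
  PiRec fun X hX u c d h₁ h₂ => RecEqs X (fun x => f ⬝ X ⬝ hX ⬝ u ⬝ c ⬝ d ⬝ h₁ ⬝ h₂ ⬝ x) u
    (fun a y => c ⬝ a ⬝ y) (fun a y => d ⬝ a ⬝ y)

def freeRecValue : Bld :=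
  LamRec recursor

def freeRecProof : Pf (freeRecSpec freeRecValue) :=
  ⟨LamRec fun X hX u c d h₁ h₂ =>
    let f (x : Bld) := recursor X hX u c d h₁ h₂ ⬝ x
    let E₁ := Pi gens fun a => Pi Free fun x => Id X (f (cons a x)) (c ⬝ a ⬝ f x)
    let E₂ := Pi gens fun a => Pi Free fun x => Id X (f (icons a x)) (d ⬝ a ⬝ f x)
    let p : Pf (Prod (Id X (f one) u) (Prod E₁ E₂)) :=
      .and .rfl (.and (.all fun _ => .all fun _ => .rfl) (.all fun _ => .all fun _ => .rfl))
    p.tm⟩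

def freeRecCtx : List Tm :=
  freeRecSpec (bound 56) 57 :: freeRecType 56 :: setMuCtx

theorem freeRec_derivable : Derivable 56 freeRecCtx :=
  setMu_derivable.opaqueDef (freeRecValue 56) (freeRecProof.tm 56)
    (by decide +kernel)

def freeRecFn : Bld := bound 56
def freeRecEq : Pf (freeRecSpec freeRecFn) := ⟨bound 57⟩

/-- `F` applied to a set `X` with an element and mutually inverse operations. -/
def recArgs (X : Bld) (hX : Pf (IsSet X)) (u : Bld) (c d : Bld → Bld → Bld)
    (h₁ : (a y : Bld) → Pf (Id X (d a (c a y)) y)) (h₂ : (a y : Bld) → Pf (Id X (c a (d a y)) y))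
    (F : Bld) : Bld :=
  F ⬝ X ⬝ hX.tm ⬝ u ⬝ Lam₂ c ⬝ Lam₂ d ⬝ (Lam₂ fun a y => (h₁ a y).tm) ⬝ (Lam₂ fun a y => (h₂ a y).tm)

namespace Pf

variable {X u x : Bld} {f : Bld → Bld} {c d : Bld → Bld → Bld}

def recOne (p : Pf (RecEqs X f u c d)) : Pf (Id X (f one) u) := fst p

def recCons (p : Pf (RecEqs X f u c d)) (a x : Bld) : Pf (Id X (f (cons a x)) (c a (f x))) :=
  fst (snd p) |>.app a |>.app x

def recIcons (p : Pf (RecEqs X f u c d)) (a x : Bld) : Pf (Id X (f (icons a x)) (d a (f x))) :=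
  snd (snd p) |>.app a |>.app x

end Pf

/-- Equality of two values in a set is a proposition, so the clauses for all path constructors are
automatic. -/
abbrev freeExtStmt : Bld :=
  Pi (U 0) fun X => IsSet X ⇾ Pi (Free ⇾ X) fun f => Pi (Free ⇾ X) fun g =>
    let P := Lam fun x => Id X (f ⬝ x) (g ⬝ x)
    P ⬝ one ⇾ ConsOp P ⇾ IconsOp P ⇾ Pi Free fun x => P ⬝ x

def freeExtProof : Pf freeExtStmt :=
  .all fun X => .intro fun h => .all fun f => .all fun g => .intro fun u => .intro fun c => .intro fun d =>
    let P := Lam fun x => Id X (f ⬝ x) (g ⬝ x)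
    let m₁ := Lam₃ fun a x y => h.tm ⬝ (f ⬝ x) ⬝ (g ⬝ x) ⬝
      tr Free P (iconsCons a x) x (Fmu1 gens a x) (d.tm ⬝ a ⬝ cons a x ⬝ (c.tm ⬝ a ⬝ x ⬝ y)) ⬝ y
    let m₂ := Lam₃ fun a x y => h.tm ⬝ (f ⬝ x) ⬝ (g ⬝ x) ⬝
      tr Free P (cons a (icons a x)) x (Fmu2 gens a x) (c.tm ⬝ a ⬝ icons a x ⬝ (d.tm ⬝ a ⬝ x ⬝ y)) ⬝ y
    let hP := Lam fun x => isSetOfIsPropVar.tm ⬝ Id X (f ⬝ x) (g ⬝ x) ⬝ (h.tm ⬝ (f ⬝ x) ⬝ (g ⬝ x))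
    ⟨Find gens P u c d m₁ m₂ (setMuVar.tm ⬝ P ⬝ hP ⬝ c ⬝ d ⬝ m₁ ⬝ m₂)⟩

def freeExtCtx : List Tm :=
  freeExtStmt 58 :: freeRecCtx

theorem freeExt_derivable : Derivable 57 freeExtCtx :=
  freeRec_derivable.check (freeExtProof.tm 58)
    (by decide +kernel)

def freeExtVar : Pf freeExtStmt := ⟨bound 58⟩

/-! ### Normal forms -/

abbrev eval (w : Bld) : Bld := evalWord gens w

/-- The product of a letter and an element of the free infinity-group. -/
def act (s x : Bld) : Bld := SumElim gens gens (fun _ => Free) (fun a => cons a x) (fun a => icons a x) s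

/-- For a positive letter this is `μ₂`, for a negative one `μ₁`. -/
abbrev actActStmt : Bld :=
  Pi Letter fun s => Pi Free fun x => Id Free (act s (act (inv s) x)) x

def actActProof : Pf actActStmt :=
  .all fun s => .all fun x => .letterInd (fun s => Id Free (act s (act (inv s) x)) x)
    (fun a => ⟨Fmu2 gens a x⟩) (fun a => ⟨Fmu1 gens a x⟩) s

def actActCtx : List Tm :=
  actActStmt 59 :: freeExtCtx

theorem actAct_derivable : Derivable 58 actActCtx :=
  freeExt_derivable.check (actActProof.tm 59)
    (by decide +kernel)

def actActVar : Pf actActStmt := ⟨bound 59⟩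

/-- No normality is needed: a cancellation of words is matched by the cancellation law in `F A`. -/
abbrev evalStepStmt : Bld :=
  Pi Letter fun s => Pi Word fun w => Id Free (eval (step s w)) (act s (eval w))

def evalStepProof : Pf evalStepStmt :=
  .all fun s => .all fun w =>
    .wordInd (fun w => Id Free (eval (step s w)) (act s (eval w))) .rfl
      (fun t w _ => .cast (.cases (letterEq t (inv s))
        (fun d => Id Free (eval (stepCases s t w d)) (act s (act t (eval w))))
        (fun e => .cast (.trans (actActVar.app s |>.app (eval w)).symm
          (.congr (fun t => act s (act t (eval w))) e.symm)))
        (fun _ => .rfl))) w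

def evalStepCtx : List Tm :=
  evalStepStmt 60 :: actActCtx

theorem evalStep_derivable : Derivable 59 evalStepCtx :=
  actAct_derivable.check (evalStepProof.tm 60)
    (by decide +kernel)

def evalStepVar : Pf evalStepStmt := ⟨bound 60⟩

/-- The recursor requires `cons` and `icons` to act on normal words by mutually inverse operations,
which is `stepReducedStep` for positive and negative letters. -/
abbrev normalFormType : Bld :=
  Free ⇾ Reduced

abbrev normalFormSpec (f : Bld) : Bld :=
  RecEqs Reduced (fun x => f ⬝ x) (reduced nil normalNilVar.cast)
    (fun a n => stepReduced (Inl gens gens a) n) (fun a n => stepReduced (Inr gens gens a) n)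

def normalFormValue : Bld :=
  recArgs Reduced isSetReducedVar.cast (reduced nil normalNilVar.cast)
    (fun a n => stepReduced (Inl gens gens a) n) (fun a n => stepReduced (Inr gens gens a) n)
    (fun a n => (stepReducedStepVar.app (Inl gens gens a) |>.app n).cast)
    (fun a n => (stepReducedStepVar.app (Inr gens gens a) |>.app n).cast) freeRecFn

def normalFormProof : Pf (normalFormSpec normalFormValue) :=
  ⟨recArgs Reduced isSetReducedVar.cast (reduced nil normalNilVar.cast)
    (fun a n => stepReduced (Inl gens gens a) n) (fun a n => stepReduced (Inr gens gens a) n)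
    (fun a n => (stepReducedStepVar.app (Inl gens gens a) |>.app n).cast)
    (fun a n => (stepReducedStepVar.app (Inr gens gens a) |>.app n).cast) freeRecEq.tm⟩

def normalFormCtx : List Tm :=
  normalFormSpec (bound 61) 62 :: normalFormType 61 :: evalStepCtx

theorem normalForm_derivable : Derivable 61 normalFormCtx :=
  evalStep_derivable.opaqueDef (normalFormValue 61) (normalFormProof.tm 61)
    (by decide +kernel)

def normalFormFn : Bld := bound 61
def normalFormEq : Pf (normalFormSpec normalFormFn) := ⟨bound 62⟩

/-- The normal form of an element of the free infinity-group. -/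
abbrev normalForm (x : Bld) : Bld := normalFormFn ⬝ x

abbrev normalFormActStmt : Bld :=
  Pi Letter fun s => Pi Free fun x => Id Reduced (normalForm (act s x)) (stepReduced s (normalForm x))

def normalFormActProof : Pf normalFormActStmt :=
  .all fun s => .all fun x =>
    .letterInd (fun s => Id Reduced (normalForm (act s x)) (stepReduced s (normalForm x)))
      (fun a => (normalFormEq.recCons a x).cast) (fun a => (normalFormEq.recIcons a x).cast) s

def normalFormActCtx : List Tm :=
  normalFormActStmt 63 :: normalFormCtx

theorem normalFormAct_derivable : Derivable 62 normalFormActCtx :=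
  normalForm_derivable.check (normalFormActProof.tm 63)
    (by decide +kernel)

def normalFormActVar : Pf normalFormActStmt := ⟨bound 63⟩

/-- The word of the normal form. -/
abbrev normalWord (x : Bld) : Bld := wordOf (normalForm x)

abbrev normalWordOneStmt : Bld :=
  Id Word (normalWord one) nil

def normalWordOneProof : Pf normalWordOneStmt :=
  .cast (.congr (Y := Word) wordOf normalFormEq.recOne)

def normalWordOneCtx : List Tm :=
  normalWordOneStmt 64 :: normalFormActCtx

theorem normalWordOne_derivable : Derivable 63 normalWordOneCtx :=
  normalFormAct_derivable.check (normalWordOneProof.tm 64)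
    (by decide +kernel)

def normalWordOneVar : Pf normalWordOneStmt := ⟨bound 64⟩

abbrev normalWordActStmt : Bld :=
  Pi Letter fun s => Pi Free fun x => Id Word (normalWord (act s x)) (step s (normalWord x))

def normalWordActProof : Pf normalWordActStmt :=
  .all fun s => .all fun x => .trans (.congr wordOf (normalFormActVar.app s |>.app x))
    (wordOfStepReduced s (normalForm x))

def normalWordActCtx : List Tm :=
  normalWordActStmt 65 :: normalWordOneCtx

theorem normalWordAct_derivable : Derivable 64 normalWordActCtx :=
  normalWordOne_derivable.check (normalWordActProof.tm 65)
    (by decide +kernel)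

def normalWordActVar : Pf normalWordActStmt := ⟨bound 65⟩

/-- Induction on the word: tails of normal words are normal, and on them the action of the first
letter is prepending. -/
abbrev wordOfNormalFormStmt : Bld :=
  Pi Word fun w => Normal w ⇾ Id Word (normalWord (eval w)) w

def wordOfNormalFormProof : Pf wordOfNormalFormStmt :=
  .all fun w => .wordInd (fun w => Normal w ⇾ Id Word (normalWord (eval w)) w)
    (.intro fun _ => normalWordOneVar.cast)
    (fun s w ih => .intro fun h =>
      .trans (normalWordActVar.app s |>.app (eval w)).cast
        (.trans (.congr (step s) (ih.mp ((normalTailVar.app s |>.app w).mp h)))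
          ((stepNormalVar.app s |>.app w).mp h))) w

def wordOfNormalFormCtx : List Tm :=
  wordOfNormalFormStmt 66 :: normalWordActCtx

theorem wordOfNormalForm_derivable : Derivable 65 wordOfNormalFormCtx :=
  normalWordAct_derivable.check (wordOfNormalFormProof.tm 66)
    (by decide +kernel)

def wordOfNormalFormVar : Pf wordOfNormalFormStmt := ⟨bound 66⟩

abbrev normalFormEvalStmt : Bld :=
  LeftInv Reduced (evalNormal gens) normalFormFn

def normalFormEvalProof : Pf normalFormEvalStmt :=
  .all fun n => (reducedExtVar.app (normalForm (evalNormal gens ⬝ n)) |>.app n).mp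
    ((wordOfNormalFormVar.app (wordOf n)).mp (normalOf n)).cast

def normalFormEvalCtx : List Tm :=
  normalFormEvalStmt 67 :: wordOfNormalFormCtx

theorem normalFormEval_derivable : Derivable 66 normalFormEvalCtx :=
  wordOfNormalForm_derivable.check (normalFormEvalProof.tm 67)
    (by decide +kernel)

def normalFormEvalVar : Pf normalFormEvalStmt := ⟨bound 67⟩

abbrev evalForm (x : Bld) : Bld := eval (normalWord x)

abbrev evalFormConsStmt : Bld :=
  Pi gens fun a => Pi Free fun x => Id Free (evalForm (cons a x)) (cons a (evalForm x))

def evalFormConsProof : Pf evalFormConsStmt :=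
  .all fun a => .all fun x => .cast (.trans
    (.congr (Y := Free) eval (normalWordActVar.app (Inl gens gens a) |>.app x))
    (evalStepVar.app (Inl gens gens a) |>.app (normalWord x)))

def evalFormConsCtx : List Tm :=
  evalFormConsStmt 68 :: normalFormEvalCtx

theorem evalFormCons_derivable : Derivable 67 evalFormConsCtx :=
  normalFormEval_derivable.check (evalFormConsProof.tm 68)
    (by decide +kernel)

def evalFormConsVar : Pf evalFormConsStmt := ⟨bound 68⟩

/-- This combines the equivalence `cons_a` on path types with the fact that normalising and
evaluating commutes with `cons_a`. -/
abbrev evalFormPathStmt : Bld :=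
  Pi gens fun a => Pi Free fun x =>
    Id (U 0) (Id Free (evalForm x) x) (Id Free (evalForm (cons a x)) (cons a x))

def evalFormPathProof : Pf evalFormPathStmt :=
  .all fun a => .all fun x =>
    .pathInd (fun z _ => Id (U 0) (Id Free (evalForm x) x) (Id Free z (cons a x)))
      (consPathVar.app a |>.app (evalForm x) |>.app x) (evalFormConsVar.app a |>.app x).symm

def evalFormPathCtx : List Tm :=
  evalFormPathStmt 69 :: evalFormConsCtx

theorem evalFormPath_derivable : Derivable 68 evalFormPathCtx :=
  evalFormCons_derivable.check (evalFormPathProof.tm 69)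
    (by decide +kernel)

def evalFormPathVar : Pf evalFormPathStmt := ⟨bound 69⟩

/-- The crucial inverse law. It is proved while `F A` is not yet known to be a set, so `freeExt` is
not applicable and `freeIndOfPath` takes its place. -/
abbrev evalNormalFormStmt : Bld :=
  RightInv Free (evalNormal gens) normalFormFn

def evalNormalFormProof : Pf evalNormalFormStmt :=
  let p : Pf (Id Free (evalForm one) (eval nil)) := .congr eval normalWordOneVar
  ⟨freeIndOfPathVar.tm ⬝ (Lam fun x => Id Free (evalForm x) x) ⬝ p.tm ⬝ evalFormPathVar.tm⟩

def evalNormalFormCtx : List Tm :=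
  evalNormalFormStmt 70 :: evalFormPathCtx

theorem evalNormalForm_derivable : Derivable 69 evalNormalFormCtx :=
  evalFormPath_derivable.check (evalNormalFormProof.tm 70)
    (by decide +kernel)

def evalNormalFormVar : Pf evalNormalFormStmt := ⟨bound 70⟩

abbrev decEqFreeStmt : Bld :=
  DecEq Free

def decEqFreeProof : Pf decEqFreeStmt :=
  ((decEqOfRetractVar.app Free |>.app Reduced |>.app normalFormFn |>.app (evalNormal gens)).mp
    evalNormalFormVar.cast).mp decEqReducedVar

def decEqFreeCtx : List Tm :=
  decEqFreeStmt 71 :: evalNormalFormCtx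

theorem decEqFree_derivable : Derivable 70 decEqFreeCtx :=
  evalNormalForm_derivable.check (decEqFreeProof.tm 71)
    (by decide +kernel)

def decEqFreeVar : Pf decEqFreeStmt := ⟨bound 71⟩

abbrev isSetFreeStmt : Bld :=
  IsSet Free

def isSetFreeProof : Pf isSetFreeStmt :=
  (isSetOfDecEqVar.app Free).mp decEqFreeVar

def isSetFreeCtx : List Tm :=
  isSetFreeStmt 72 :: decEqFreeCtx

theorem isSetFree_derivable : Derivable 71 isSetFreeCtx :=
  decEqFree_derivable.check (isSetFreeProof.tm 72)
    (by decide +kernel)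

def isSetFreeVar : Pf isSetFreeStmt := ⟨bound 72⟩

abbrev isEquivEvalNormalStmt : Bld :=
  IsEquiv Reduced Free (evalNormal gens)

def isEquivEvalNormalProof : Pf isEquivEvalNormalStmt :=
  (((isEquivOfIsSetVar.app Reduced |>.app Free |>.app (evalNormal gens) |>.app normalFormFn).mp
    isSetFreeVar).mp normalFormEvalVar).mp evalNormalFormVar

def isEquivEvalNormalCtx : List Tm :=
  isEquivEvalNormalStmt 73 :: isSetFreeCtx

theorem isEquivEvalNormal_derivable : Derivable 72 isEquivEvalNormalCtx :=
  isSetFree_derivable.check (isEquivEvalNormalProof.tm 73)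
    (by decide +kernel)

def isEquivEvalNormalVar : Pf isEquivEvalNormalStmt := ⟨bound 73⟩

/-! ### The set-truncated free group -/

abbrev Group : Bld := GG gens
abbrev eta (a : Bld) : Bld := Geta gens a
abbrev gmul (x y : Bld) : Bld := Gmul gens x y
abbrev gone : Bld := Gone gens
abbrev ginv (x : Bld) : Bld := Ginv gens x

def isSetGroup : Pf (IsSet Group) := ⟨cst .gtrunc ⬝ gens⟩
def gassoc (x y z : Bld) : Pf (Id Group (gmul x (gmul y z)) (gmul (gmul x y) z)) :=
  ⟨cst .gassoc ⬝ gens ⬝ x ⬝ y ⬝ z⟩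
def gmulOne (x : Bld) : Pf (Id Group (gmul x gone) x) := ⟨cst .gmulOne ⬝ gens ⬝ x⟩
def goneMul (x : Bld) : Pf (Id Group (gmul gone x) x) := ⟨cst .goneMul ⬝ gens ⬝ x⟩
def gmulInv (x : Bld) : Pf (Id Group (gmul x (ginv x)) gone) := ⟨cst .gmulInv ⬝ gens ⬝ x⟩
def ginvMul (x : Bld) : Pf (Id Group (gmul (ginv x) x) gone) := ⟨cst .ginvMul ⬝ gens ⬝ x⟩

/-! ### Cancellation in the free group -/

abbrev ginvMulCancelStmt : Bld :=
  Pi Group fun x => Pi Group fun y => Id Group (gmul (ginv x) (gmul x y)) y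

def ginvMulCancelProof : Pf ginvMulCancelStmt :=
  .all fun x => .all fun y => .trans (gassoc (ginv x) x y)
    (.trans (.congr (fun z => gmul z y) (ginvMul x)) (goneMul y))

def ginvMulCancelCtx : List Tm :=
  ginvMulCancelStmt 74 :: isEquivEvalNormalCtx

theorem ginvMulCancel_derivable : Derivable 73 ginvMulCancelCtx :=
  isEquivEvalNormal_derivable.check (ginvMulCancelProof.tm 74)
    (by decide +kernel)

def ginvMulCancelVar : Pf ginvMulCancelStmt := ⟨bound 74⟩

abbrev gmulInvCancelStmt : Bld :=
  Pi Group fun x => Pi Group fun y => Id Group (gmul x (gmul (ginv x) y)) y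

def gmulInvCancelProof : Pf gmulInvCancelStmt :=
  .all fun x => .all fun y => .trans (gassoc x (ginv x) y)
    (.trans (.congr (fun z => gmul z y) (gmulInv x)) (goneMul y))

def gmulInvCancelCtx : List Tm :=
  gmulInvCancelStmt 75 :: ginvMulCancelCtx

theorem gmulInvCancel_derivable : Derivable 74 gmulInvCancelCtx :=
  ginvMulCancel_derivable.check (gmulInvCancelProof.tm 75)
    (by decide +kernel)

def gmulInvCancelVar : Pf gmulInvCancelStmt := ⟨bound 75⟩

abbrev ginvUniqueStmt : Bld :=
  Pi Group fun x => Pi Group fun y => Id Group (gmul x y) gone ⇾ Id Group y (ginv x)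

def ginvUniqueProof : Pf ginvUniqueStmt :=
  .all fun x => .all fun y => .intro fun p =>
    .trans (ginvMulCancelVar.app x |>.app y).symm
      (.trans (.congr (gmul (ginv x)) p) (gmulOne (ginv x)))

def ginvUniqueCtx : List Tm :=
  ginvUniqueStmt 76 :: gmulInvCancelCtx

theorem ginvUnique_derivable : Derivable 75 ginvUniqueCtx :=
  gmulInvCancel_derivable.check (ginvUniqueProof.tm 76)
    (by decide +kernel)

def ginvUniqueVar : Pf ginvUniqueStmt := ⟨bound 76⟩

/-- The two cancellation laws make left multiplication by a generator and by its inverse mutually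
inverse, as recursion requires. -/
abbrev toGroupType : Bld :=
  Free ⇾ Group

abbrev toGroupSpec (f : Bld) : Bld :=
  RecEqs Group (fun x => f ⬝ x) gone (fun a x => gmul (eta a) x) (fun a x => gmul (ginv (eta a)) x)

def toGroupValue : Bld :=
  recArgs Group isSetGroup gone (fun a x => gmul (eta a) x)
      (fun a x => gmul (ginv (eta a)) x)
      (fun a x => ginvMulCancelVar.app (eta a) |>.app x)
      (fun a x => gmulInvCancelVar.app (eta a) |>.app x) freeRecFn

def toGroupProof : Pf (toGroupSpec toGroupValue) :=
  ⟨recArgs Group isSetGroup gone (fun a x => gmul (eta a) x)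
      (fun a x => gmul (ginv (eta a)) x)
      (fun a x => ginvMulCancelVar.app (eta a) |>.app x)
      (fun a x => gmulInvCancelVar.app (eta a) |>.app x) freeRecEq.tm⟩

def toGroupCtx : List Tm :=
  toGroupSpec (bound 77) 78 :: toGroupType 77 :: ginvUniqueCtx

theorem toGroup_derivable : Derivable 77 toGroupCtx :=
  ginvUnique_derivable.opaqueDef (toGroupValue 77) (toGroupProof.tm 77)
    (by decide +kernel)

def toGroupFn : Bld := bound 77
def toGroupEq : Pf (toGroupSpec toGroupFn) := ⟨bound 78⟩

/-- The homomorphism from the free infinity-group to the free group. -/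
abbrev toGroup (x : Bld) : Bld := toGroupFn ⬝ x

/-! ### The group structure of the free infinity-group -/

/-- Recursion on the first factor, with values in `F A` itself; this is available now that `F A` is
a set. -/
abbrev mulType : Bld :=
  Free ⇾ Free ⇾ Free

abbrev mulSpec (f : Bld) : Bld :=
  Pi Free fun y => RecEqs Free (fun x => f ⬝ x ⬝ y) y cons icons

def mulValue : Bld :=
  Lam₂ fun x y =>
    recArgs Free isSetFreeVar.cast y cons icons (fun a x => ⟨Fmu1 gens a x⟩)
      (fun a x => ⟨Fmu2 gens a x⟩) freeRecFn ⬝ x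

def mulProof : Pf (mulSpec mulValue) :=
  .all fun y => ⟨recArgs Free isSetFreeVar.cast y cons icons (fun a x => ⟨Fmu1 gens a x⟩)
    (fun a x => ⟨Fmu2 gens a x⟩) freeRecEq.tm⟩

def mulCtx : List Tm :=
  mulSpec (bound 79) 80 :: mulType 79 :: toGroupCtx

theorem mul_derivable : Derivable 79 mulCtx :=
  toGroup_derivable.opaqueDef (mulValue 79) (mulProof.tm 79)
    (by decide +kernel)

def mulFn : Bld := bound 79
def mulEq : Pf (mulSpec mulFn) := ⟨bound 80⟩

abbrev mul (x y : Bld) : Bld := mulFn ⬝ x ⬝ y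

abbrev oneMulStmt : Bld :=
  Pi Free fun y => Id Free (mul one y) y

def oneMulProof : Pf oneMulStmt :=
  .all fun y => (mulEq.app y).recOne

def oneMulCtx : List Tm :=
  oneMulStmt 81 :: mulCtx

theorem oneMul_derivable : Derivable 80 oneMulCtx :=
  mul_derivable.check (oneMulProof.tm 81)
    (by decide +kernel)

def oneMulVar : Pf oneMulStmt := ⟨bound 81⟩

abbrev consMulStmt : Bld :=
  Pi gens fun a => Pi Free fun x => Pi Free fun y => Id Free (mul (cons a x) y) (cons a (mul x y))

def consMulProof : Pf consMulStmt :=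
  .all fun a => .all fun x => .all fun y => (mulEq.app y).recCons a x

def consMulCtx : List Tm :=
  consMulStmt 82 :: oneMulCtx

theorem consMul_derivable : Derivable 81 consMulCtx :=
  oneMul_derivable.check (consMulProof.tm 82)
    (by decide +kernel)

def consMulVar : Pf consMulStmt := ⟨bound 82⟩

abbrev iconsMulStmt : Bld :=
  Pi gens fun a => Pi Free fun x => Pi Free fun y => Id Free (mul (icons a x) y) (icons a (mul x y))

def iconsMulProof : Pf iconsMulStmt :=
  .all fun a => .all fun x => .all fun y => (mulEq.app y).recIcons a x

def iconsMulCtx : List Tm :=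
  iconsMulStmt 83 :: consMulCtx

theorem iconsMul_derivable : Derivable 82 iconsMulCtx :=
  consMul_derivable.check (iconsMulProof.tm 83)
    (by decide +kernel)

def iconsMulVar : Pf iconsMulStmt := ⟨bound 83⟩

namespace Pf

def oneMul (y : Bld) : Pf (Id Free (mul one y) y) := oneMulVar.app y

def consMul (a x y : Bld) : Pf (Id Free (mul (cons a x) y) (cons a (mul x y))) :=
  consMulVar.app a |>.app x |>.app y

def iconsMul (a x y : Bld) : Pf (Id Free (mul (icons a x) y) (icons a (mul x y))) :=
  iconsMulVar.app a |>.app x |>.app y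

end Pf

/-- Induction for equations in a set. -/
def Pf.freeExt {X : Bld} (hX : Pf (IsSet X)) (f g : Bld → Bld) (h₁ : Pf (Id X (f one) (g one)))
    (h₂ : (a x : Bld) → Pf (Id X (f x) (g x)) → Pf (Id X (f (cons a x)) (g (cons a x))))
    (h₃ : (a x : Bld) → Pf (Id X (f x) (g x)) → Pf (Id X (f (icons a x)) (g (icons a x)))) (x : Bld) :
    Pf (Id X (f x) (g x)) :=
  ⟨freeExtVar.tm ⬝ X ⬝ hX.tm ⬝ Lam f ⬝ Lam g ⬝ h₁.tm ⬝ (Lam₃ fun a x p => (h₂ a x ⟨p⟩).tm) ⬝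
    (Lam₃ fun a x p => (h₃ a x ⟨p⟩).tm) ⬝ x⟩

abbrev mulAssocStmt : Bld :=
  Pi Free fun x => Pi Free fun y => Pi Free fun z => Id Free (mul x (mul y z)) (mul (mul x y) z)

def mulAssocProof : Pf mulAssocStmt :=
  .all fun x => .all fun y => .all fun z =>
    .freeExt isSetFreeVar (fun x => mul x (mul y z)) (fun x => mul (mul x y) z)
      (.trans (.oneMul (mul y z)) (.symm (.congr (fun u => mul u z) (.oneMul y))))
      (fun a x p => .trans (.consMul a x (mul y z)) (.trans (.congr (cons a) p)
        (.symm (.trans (.congr (fun u => mul u z) (.consMul a x y)) (.consMul a (mul x y) z)))))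
      (fun a x p => .trans (.iconsMul a x (mul y z)) (.trans (.congr (icons a) p)
        (.symm (.trans (.congr (fun u => mul u z) (.iconsMul a x y)) (.iconsMul a (mul x y) z))))) x

def mulAssocCtx : List Tm :=
  mulAssocStmt 84 :: iconsMulCtx

theorem mulAssoc_derivable : Derivable 83 mulAssocCtx :=
  iconsMul_derivable.check (mulAssocProof.tm 84)
    (by decide +kernel)

def mulAssocVar : Pf mulAssocStmt := ⟨bound 84⟩

def Pf.mulAssoc (x y z : Bld) : Pf (Id Free (mul x (mul y z)) (mul (mul x y) z)) :=
  mulAssocVar.app x |>.app y |>.app z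

abbrev mulOneStmt : Bld :=
  Pi Free fun x => Id Free (mul x one) x

def mulOneProof : Pf mulOneStmt :=
  .all fun x => .freeExt isSetFreeVar (fun x => mul x one) (fun x => x) (.oneMul one)
    (fun a x p => .trans (.consMul a x one) (.congr (cons a) p))
    (fun a x p => .trans (.iconsMul a x one) (.congr (icons a) p)) x

def mulOneCtx : List Tm :=
  mulOneStmt 85 :: mulAssocCtx

theorem mulOne_derivable : Derivable 84 mulOneCtx :=
  mulAssoc_derivable.check (mulOneProof.tm 85)
    (by decide +kernel)

def mulOneVar : Pf mulOneStmt := ⟨bound 85⟩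

abbrev gen (a : Bld) : Bld := cons a one
abbrev igen (a : Bld) : Bld := icons a one

abbrev genMulStmt : Bld :=
  Pi gens fun a => Pi Free fun x => Id Free (mul (gen a) x) (cons a x)

def genMulProof : Pf genMulStmt :=
  .all fun a => .all fun x => .trans (.consMul a one x) (.congr (cons a) (.oneMul x))

def genMulCtx : List Tm :=
  genMulStmt 86 :: mulOneCtx

theorem genMul_derivable : Derivable 85 genMulCtx :=
  mulOne_derivable.check (genMulProof.tm 86)
    (by decide +kernel)

def genMulVar : Pf genMulStmt := ⟨bound 86⟩

abbrev igenMulStmt : Bld :=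
  Pi gens fun a => Pi Free fun x => Id Free (mul (igen a) x) (icons a x)

def igenMulProof : Pf igenMulStmt :=
  .all fun a => .all fun x => .trans (.iconsMul a one x) (.congr (icons a) (.oneMul x))

def igenMulCtx : List Tm :=
  igenMulStmt 87 :: genMulCtx

theorem igenMul_derivable : Derivable 86 igenMulCtx :=
  genMul_derivable.check (igenMulProof.tm 87)
    (by decide +kernel)

def igenMulVar : Pf igenMulStmt := ⟨bound 87⟩

namespace Pf

def genMul (a x : Bld) : Pf (Id Free (mul (gen a) x) (cons a x)) := genMulVar.app a |>.app x

def igenMul (a x : Bld) : Pf (Id Free (mul (igen a) x) (icons a x)) := igenMulVar.app a |>.app x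

def iconsCons (a x : Bld) : Pf (Id Free (icons a (cons a x)) x) := ⟨Fmu1 gens a x⟩

def consIcons (a x : Bld) : Pf (Id Free (cons a (icons a x)) x) := ⟨Fmu2 gens a x⟩

end Pf

abbrev mulGenIgenStmt : Bld :=
  Pi gens fun a => Pi Free fun x => Id Free (mul (mul x (gen a)) (igen a)) x

def mulGenIgenProof : Pf mulGenIgenStmt :=
  .all fun a => .all fun x => .trans (.symm (.mulAssoc x (gen a) (igen a)))
    (.trans (.congr (mul x) (.trans (.genMul a (igen a)) (.consIcons a one))) (mulOneVar.app x))

def mulGenIgenCtx : List Tm :=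
  mulGenIgenStmt 88 :: igenMulCtx

theorem mulGenIgen_derivable : Derivable 87 mulGenIgenCtx :=
  igenMul_derivable.check (mulGenIgenProof.tm 88)
    (by decide +kernel)

def mulGenIgenVar : Pf mulGenIgenStmt := ⟨bound 88⟩

abbrev mulIgenGenStmt : Bld :=
  Pi gens fun a => Pi Free fun x => Id Free (mul (mul x (igen a)) (gen a)) x

def mulIgenGenProof : Pf mulIgenGenStmt :=
  .all fun a => .all fun x => .trans (.symm (.mulAssoc x (igen a) (gen a)))
    (.trans (.congr (mul x) (.trans (.igenMul a (gen a)) (.iconsCons a one))) (mulOneVar.app x))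

def mulIgenGenCtx : List Tm :=
  mulIgenGenStmt 89 :: mulGenIgenCtx

theorem mulIgenGen_derivable : Derivable 88 mulIgenGenCtx :=
  mulGenIgen_derivable.check (mulIgenGenProof.tm 89)
    (by decide +kernel)

def mulIgenGenVar : Pf mulIgenGenStmt := ⟨bound 89⟩

/-- Inversion reverses products, so `cons_a` becomes right multiplication by the inverse generator.
The two preceding lemmas say that these right multiplications are mutually inverse. -/
abbrev inverseType : Bld :=
  Free ⇾ Free

abbrev inverseSpec (f : Bld) : Bld :=
  RecEqs Free (fun x => f ⬝ x) one (fun a r => mul r (igen a)) (fun a r => mul r (gen a))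

def inverseValue : Bld :=
  recArgs Free isSetFreeVar.cast one (fun a r => mul r (igen a))
      (fun a r => mul r (gen a))
      (fun a x => mulIgenGenVar.app a |>.app x)
      (fun a x => mulGenIgenVar.app a |>.app x) freeRecFn

def inverseProof : Pf (inverseSpec inverseValue) :=
  ⟨recArgs Free isSetFreeVar.cast one (fun a r => mul r (igen a))
      (fun a r => mul r (gen a))
      (fun a x => mulIgenGenVar.app a |>.app x)
      (fun a x => mulGenIgenVar.app a |>.app x) freeRecEq.tm⟩

def inverseCtx : List Tm :=
  inverseSpec (bound 90) 91 :: inverseType 90 :: mulIgenGenCtx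

theorem inverse_derivable : Derivable 90 inverseCtx :=
  mulIgenGen_derivable.opaqueDef (inverseValue 90) (inverseProof.tm 90)
    (by decide +kernel)

def inverseFn : Bld := bound 90
def inverseEq : Pf (inverseSpec inverseFn) := ⟨bound 91⟩

abbrev inverse (x : Bld) : Bld := inverseFn ⬝ x

abbrev mulInverseStmt : Bld :=
  Pi Free fun x => Id Free (mul x (inverse x)) one

def mulInverseProof : Pf mulInverseStmt :=
  .all fun x => .freeExt isSetFreeVar (fun x => mul x (inverse x)) (fun _ => one)
    (.trans (.oneMul (inverse one)) inverseEq.recOne)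
    (fun a x p => .trans (.congr (mul (cons a x)) (inverseEq.recCons a x))
      (.trans (.consMul a x (mul (inverse x) (igen a)))
      (.trans (.congr (cons a) (.mulAssoc x (inverse x) (igen a)))
      (.trans (.congr (fun y => cons a (mul y (igen a))) p)
      (.trans (.congr (cons a) (.oneMul (igen a))) (.consIcons a one))))))
    (fun a x p => .trans (.congr (mul (icons a x)) (inverseEq.recIcons a x))
      (.trans (.iconsMul a x (mul (inverse x) (gen a)))
      (.trans (.congr (icons a) (.mulAssoc x (inverse x) (gen a)))
      (.trans (.congr (fun y => icons a (mul y (gen a))) p)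
      (.trans (.congr (icons a) (.oneMul (gen a))) (.iconsCons a one)))))) x

def mulInverseCtx : List Tm :=
  mulInverseStmt 92 :: inverseCtx

theorem mulInverse_derivable : Derivable 91 mulInverseCtx :=
  inverse_derivable.check (mulInverseProof.tm 92)
    (by decide +kernel)

def mulInverseVar : Pf mulInverseStmt := ⟨bound 92⟩

abbrev inverseMulStmt : Bld :=
  Pi Free fun x => Id Free (mul (inverse x) x) one

def inverseMulProof : Pf inverseMulStmt :=
  .all fun x => .freeExt isSetFreeVar (fun x => mul (inverse x) x) (fun _ => one)
    (.trans (mulOneVar.app (inverse one)) inverseEq.recOne)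
    (fun a x p => .trans (.congr (fun y => mul y (cons a x)) (inverseEq.recCons a x))
      (.trans (.symm (.mulAssoc (inverse x) (igen a) (cons a x)))
      (.trans (.congr (mul (inverse x)) (.trans (.igenMul a (cons a x)) (.iconsCons a x))) p)))
    (fun a x p => .trans (.congr (fun y => mul y (icons a x)) (inverseEq.recIcons a x))
      (.trans (.symm (.mulAssoc (inverse x) (gen a) (icons a x)))
      (.trans (.congr (mul (inverse x)) (.trans (.genMul a (icons a x)) (.consIcons a x))) p))) x

def inverseMulCtx : List Tm :=
  inverseMulStmt 93 :: mulInverseCtx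

theorem inverseMul_derivable : Derivable 92 inverseMulCtx :=
  mulInverse_derivable.check (inverseMulProof.tm 93)
    (by decide +kernel)

def inverseMulVar : Pf inverseMulStmt := ⟨bound 93⟩

/-! ### The equivalence -/

/-- Equations in the set `F₀ A` are propositions, so only the point constructors leave something to
prove. -/
abbrev groupExtStmt : Bld :=
  Pi (Group ⇾ Group) fun f =>
    let P := Lam fun x => Id Group (f ⬝ x) x
    (Pi gens fun a => P ⬝ eta a) ⇾ (Pi Group fun x => Pi Group fun y => P ⬝ x ⇾ P ⬝ y ⇾ P ⬝ gmul x y) ⇾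
    P ⬝ gone ⇾ (Pi Group fun x => P ⬝ x ⇾ P ⬝ ginv x) ⇾ Pi Group fun x => P ⬝ x

def groupExtProof : Pf groupExtStmt :=
  .all fun f => .intro fun h => .intro fun m => .intro fun e => .intro fun i =>
    let P := Lam fun x => Id Group (f ⬝ x) x
    let hP := Lam fun x => isSetOfIsPropVar.tm ⬝ Id Group (f ⬝ x) x ⬝ (isSetGroup.tm ⬝ (f ⬝ x) ⬝ x)
    let ov (x y p u v : Bld) := isSetGroup.tm ⬝ (f ⬝ y) ⬝ y ⬝ tr Group P x y p u ⬝ v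
    ⟨cst .gElim ⬝ gens ⬝ P ⬝ hP ⬝ h ⬝ m ⬝ e ⬝ i ⬝
      (Lam₃ fun x y z => Lam₃ fun u v w => ov (gmul x (gmul y z)) (gmul (gmul x y) z)
        (gassoc x y z).tm (m.tm ⬝ x ⬝ gmul y z ⬝ u ⬝ (m.tm ⬝ y ⬝ z ⬝ v ⬝ w))
        (m.tm ⬝ gmul x y ⬝ z ⬝ (m.tm ⬝ x ⬝ y ⬝ u ⬝ v) ⬝ w)) ⬝
      (Lam₂ fun x u => ov (gmul x gone) x (gmulOne x).tm (m.tm ⬝ x ⬝ gone ⬝ u ⬝ e.tm) u) ⬝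
      (Lam₂ fun x u => ov (gmul gone x) x (goneMul x).tm (m.tm ⬝ gone ⬝ x ⬝ e.tm ⬝ u) u) ⬝
      (Lam₂ fun x u => ov (gmul x (ginv x)) gone (gmulInv x).tm
        (m.tm ⬝ x ⬝ ginv x ⬝ u ⬝ (i.tm ⬝ x ⬝ u)) e.tm) ⬝
      (Lam₂ fun x u => ov (gmul (ginv x) x) gone (ginvMul x).tm
        (m.tm ⬝ ginv x ⬝ x ⬝ (i.tm ⬝ x ⬝ u) ⬝ u) e.tm)⟩

def groupExtCtx : List Tm :=
  groupExtStmt 94 :: inverseMulCtx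

theorem groupExt_derivable : Derivable 93 groupExtCtx :=
  inverseMul_derivable.check (groupExtProof.tm 94)
    (by decide +kernel)

def groupExtVar : Pf groupExtStmt := ⟨bound 94⟩

/-- The homomorphism from the free group to the free infinity-group, as an instance of the
eliminator. -/
def groupRec : Bld :=
  let ov (x y p u v : Bld) (h : Pf (Id Free u v)) :=
    constOverVar.tm ⬝ Group ⬝ Free ⬝ x ⬝ y ⬝ p ⬝ u ⬝ v ⬝ h.tm
  cst .gElim ⬝ gens ⬝ (Lam fun _ => Free) ⬝ (Lam fun _ => isSetFreeVar.tm) ⬝ Lam gen ⬝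
    (Lam₂ fun _ _ => Lam₂ mul) ⬝ one ⬝ (Lam₂ fun _ u => inverse u) ⬝
    (Lam₃ fun x y z => Lam₃ fun u v w => ov (gmul x (gmul y z)) (gmul (gmul x y) z) (gassoc x y z).tm
      (mul u (mul v w)) (mul (mul u v) w) (.mulAssoc u v w)) ⬝
    (Lam₂ fun x u => ov (gmul x gone) x (gmulOne x).tm (mul u one) u (mulOneVar.app u)) ⬝
    (Lam₂ fun x u => ov (gmul gone x) x (goneMul x).tm (mul one u) u (.oneMul u)) ⬝
    (Lam₂ fun x u => ov (gmul x (ginv x)) gone (gmulInv x).tm (mul u (inverse u)) one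
      (mulInverseVar.app u)) ⬝
    (Lam₂ fun x u => ov (gmul (ginv x) x) gone (ginvMul x).tm (mul (inverse u) u) one
      (inverseMulVar.app u))

abbrev ofGroupType : Bld :=
  Group ⇾ Free

abbrev ofGroupSpec (f : Bld) : Bld :=
  Prod (Pi gens fun a => Id Free (f ⬝ eta a) (gen a)) <| Prod (Id Free (f ⬝ gone) one) <|
    Prod (Pi Group fun x => Pi Group fun y => Id Free (f ⬝ gmul x y) (mul (f ⬝ x) (f ⬝ y)))
      (Pi Group fun x => Id Free (f ⬝ ginv x) (inverse (f ⬝ x)))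

def ofGroupValue : Bld :=
  groupRec

def ofGroupProof : Pf (ofGroupSpec ofGroupValue) :=
  .and (.all fun _ => .rfl) (.and .rfl (.and (.all fun _ => .all fun _ => .rfl) (.all fun _ => .rfl)))

def ofGroupCtx : List Tm :=
  ofGroupSpec (bound 95) 96 :: ofGroupType 95 :: groupExtCtx

theorem ofGroup_derivable : Derivable 95 ofGroupCtx :=
  groupExt_derivable.opaqueDef (ofGroupValue 95) (ofGroupProof.tm 95)
    (by decide +kernel)

def ofGroupFn : Bld := bound 95
def ofGroupEq : Pf (ofGroupSpec ofGroupFn) := ⟨bound 96⟩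

abbrev ofGroup (x : Bld) : Bld := ofGroupFn ⬝ x

namespace Pf

def ofEta (a : Bld) : Pf (Id Free (ofGroup (eta a)) (gen a)) := ofGroupEq.fst.app a

def ofGone : Pf (Id Free (ofGroup gone) one) := ofGroupEq.snd.fst

def ofGmul (x y : Bld) : Pf (Id Free (ofGroup (gmul x y)) (mul (ofGroup x) (ofGroup y))) :=
  ofGroupEq.snd.snd.fst.app x |>.app y

def ofGinv (x : Bld) : Pf (Id Free (ofGroup (ginv x)) (inverse (ofGroup x))) :=
  ofGroupEq.snd.snd.snd.app x

end Pf

/-- This relates the formal inverse of a generator to `icons`, and is used in the `icons` case of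
the next lemma. -/
abbrev ofGinvEtaStmt : Bld :=
  Pi gens fun a => Id Free (ofGroup (ginv (eta a))) (igen a)

def ofGinvEtaProof : Pf ofGinvEtaStmt :=
  .all fun a => .trans (.ofGinv (eta a)) (.trans (.congr inverse (.ofEta a))
    (.trans (inverseEq.recCons a one) (.trans (.congr (fun y => mul y (igen a)) inverseEq.recOne)
      (.oneMul (igen a)))))

def ofGinvEtaCtx : List Tm :=
  ofGinvEtaStmt 97 :: ofGroupCtx

theorem ofGinvEta_derivable : Derivable 96 ofGinvEtaCtx :=
  ofGroup_derivable.check (ofGinvEtaProof.tm 97)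
    (by decide +kernel)

def ofGinvEtaVar : Pf ofGinvEtaStmt := ⟨bound 97⟩

abbrev ofGroupToGroupStmt : Bld :=
  LeftInv Free toGroupFn ofGroupFn

def ofGroupToGroupProof : Pf ofGroupToGroupStmt :=
  .all fun x => .freeExt isSetFreeVar (fun x => ofGroup (toGroup x)) (fun x => x)
    (.trans (.congr ofGroup toGroupEq.recOne) .ofGone)
    (fun a x p => .trans (.congr ofGroup (toGroupEq.recCons a x))
      (.trans (.ofGmul (eta a) (toGroup x))
      (.trans (.congr (fun y => mul y (ofGroup (toGroup x))) (.ofEta a))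
      (.trans (.genMul a (ofGroup (toGroup x))) (.congr (cons a) p)))))
    (fun a x p => .trans (.congr ofGroup (toGroupEq.recIcons a x))
      (.trans (.ofGmul (ginv (eta a)) (toGroup x))
      (.trans (.congr (fun y => mul y (ofGroup (toGroup x))) (ofGinvEtaVar.app a))
      (.trans (.igenMul a (ofGroup (toGroup x))) (.congr (icons a) p))))) x

def ofGroupToGroupCtx : List Tm :=
  ofGroupToGroupStmt 98 :: ofGinvEtaCtx

theorem ofGroupToGroup_derivable : Derivable 97 ofGroupToGroupCtx :=
  ofGinvEta_derivable.check (ofGroupToGroupProof.tm 98)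
    (by decide +kernel)

def ofGroupToGroupVar : Pf ofGroupToGroupStmt := ⟨bound 98⟩

abbrev toGroupMulStmt : Bld :=
  Pi Free fun x => Pi Free fun y => Id Group (toGroup (mul x y)) (gmul (toGroup x) (toGroup y))

def toGroupMulProof : Pf toGroupMulStmt :=
  .all fun x => .all fun y =>
    .freeExt isSetGroup (fun x => toGroup (mul x y)) (fun x => gmul (toGroup x) (toGroup y))
      (.trans (.congr toGroup (.oneMul y)) (.symm (.trans
        (.congr (fun z => gmul z (toGroup y)) toGroupEq.recOne) (goneMul (toGroup y)))))
      (fun a x p => .trans (.congr toGroup (.consMul a x y))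
        (.trans (toGroupEq.recCons a (mul x y)) (.trans (.congr (gmul (eta a)) p)
        (.trans (gassoc (eta a) (toGroup x) (toGroup y))
        (.congr (fun z => gmul z (toGroup y)) (toGroupEq.recCons a x).symm)))))
      (fun a x p => .trans (.congr toGroup (.iconsMul a x y))
        (.trans (toGroupEq.recIcons a (mul x y)) (.trans (.congr (gmul (ginv (eta a))) p)
        (.trans (gassoc (ginv (eta a)) (toGroup x) (toGroup y))
        (.congr (fun z => gmul z (toGroup y)) (toGroupEq.recIcons a x).symm))))) x

def toGroupMulCtx : List Tm :=
  toGroupMulStmt 99 :: ofGroupToGroupCtx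

theorem toGroupMul_derivable : Derivable 98 toGroupMulCtx :=
  ofGroupToGroup_derivable.check (toGroupMulProof.tm 99)
    (by decide +kernel)

def toGroupMulVar : Pf toGroupMulStmt := ⟨bound 99⟩

/-- A multiplicative map that preserves the unit preserves inverses, by their uniqueness. -/
abbrev toGroupInverseStmt : Bld :=
  Pi Free fun x => Id Group (toGroup (inverse x)) (ginv (toGroup x))

def toGroupInverseProof : Pf toGroupInverseStmt :=
  .all fun x => (ginvUniqueVar.app (toGroup x) |>.app (toGroup (inverse x))).mp
    (.trans (toGroupMulVar.app x |>.app (inverse x)).symm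
      (.trans (.congr toGroup (mulInverseVar.app x)) toGroupEq.recOne))

def toGroupInverseCtx : List Tm :=
  toGroupInverseStmt 100 :: toGroupMulCtx

theorem toGroupInverse_derivable : Derivable 99 toGroupInverseCtx :=
  toGroupMul_derivable.check (toGroupInverseProof.tm 100)
    (by decide +kernel)

def toGroupInverseVar : Pf toGroupInverseStmt := ⟨bound 100⟩

abbrev toGroupOfGroupStmt : Bld :=
  RightInv Group toGroupFn ofGroupFn

def toGroupOfGroupProof : Pf toGroupOfGroupStmt :=
  let f (x : Bld) := toGroup (ofGroup x)
  -- The composite fixes generators and respects the three operations, hence is the identity.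
  let h (a : Bld) : Pf (Id Group (f (eta a)) (eta a)) :=
    .trans (.congr toGroup (.ofEta a)) (.trans (toGroupEq.recCons a one)
      (.trans (.congr (gmul (eta a)) toGroupEq.recOne) (gmulOne (eta a))))
  let m (x y : Bld) (p : Pf (Id Group (f x) x)) (q : Pf (Id Group (f y) y)) :
      Pf (Id Group (f (gmul x y)) (gmul x y)) :=
    .trans (.congr toGroup (.ofGmul x y)) (.trans (toGroupMulVar.app (ofGroup x) |>.app (ofGroup y))
      (.trans (.congr (fun z => gmul z (f y)) p) (.congr (gmul x) q)))
  let e : Pf (Id Group (f gone) gone) := .trans (.congr toGroup .ofGone) toGroupEq.recOne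
  let i (x : Bld) (p : Pf (Id Group (f x) x)) : Pf (Id Group (f (ginv x)) (ginv x)) :=
    .trans (.congr toGroup (.ofGinv x)) (.trans (toGroupInverseVar.app (ofGroup x)) (.congr ginv p))
  ⟨groupExtVar.tm ⬝ Lam f ⬝ (Lam fun a => (h a).tm) ⬝
    (Lam₂ fun x y => Lam₂ fun p q => (m x y ⟨p⟩ ⟨q⟩).tm) ⬝ e.tm ⬝
    (Lam₂ fun x p => (i x ⟨p⟩).tm)⟩

def toGroupOfGroupCtx : List Tm :=
  toGroupOfGroupStmt 101 :: toGroupInverseCtx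

theorem toGroupOfGroup_derivable : Derivable 100 toGroupOfGroupCtx :=
  toGroupInverse_derivable.check (toGroupOfGroupProof.tm 101)
    (by decide +kernel)

def toGroupOfGroupVar : Pf toGroupOfGroupStmt := ⟨bound 101⟩

abbrev canonicalEquivalenceStmt : Bld :=
  CanonicalEquivalence gens

def canonicalEquivalenceProof : Pf canonicalEquivalenceStmt :=
  let E (h : Bld) := IsEquiv Free Group h
  let C₁ (h : Bld) := Id Group (h ⬝ one) gone
  let C₂ (h : Bld) := Pi gens fun a => Pi Free fun x =>
    Id Group (h ⬝ cons a x) (gmul (eta a) (h ⬝ x))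
  ⟨Pair (Free ⇾ Group) (fun h => Prod (E h) (Prod (C₁ h) (C₂ h))) toGroupFn <|
    Pair (E toGroupFn) (fun _ => Prod (C₁ toGroupFn) (C₂ toGroupFn))
      (isEquivOfIsSetVar.tm ⬝ Free ⬝ Group ⬝ toGroupFn ⬝ ofGroupFn ⬝ isSetGroup.tm ⬝
        ofGroupToGroupVar.tm ⬝ toGroupOfGroupVar.tm) <|
    Pair (C₁ toGroupFn) (fun _ => C₂ toGroupFn) toGroupEq.recOne.tm
      (Lam₂ fun a x => (toGroupEq.recCons a x).tm)⟩

def canonicalEquivalenceCtx : List Tm :=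
  canonicalEquivalenceStmt 102 :: toGroupOfGroupCtx

theorem canonicalEquivalence_derivable : Derivable 101 canonicalEquivalenceCtx :=
  toGroupOfGroup_derivable.check (canonicalEquivalenceProof.tm 102)
    (by decide +kernel)

def canonicalEquivalenceVar : Pf canonicalEquivalenceStmt := ⟨bound 102⟩

/-- What is derived from a type `gens` in the lowest universe with decidable equality holds for the
types in every universe. -/
theorem provable_of_hasType {T : Bld → Bld} {t : Tm} (h : HasType baseCtx t (T gens 2)) (i : ℕ)
    (hi : (Pi (U 0) (fun A => DecEq A ⇾ T A) 0).shift i = Pi (U i) (fun A => DecEq A ⇾ T A) 0) :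
    Provable (Pi (U i) fun A => DecEq A ⇾ T A) := by
  obtain ⟨_, l, hl⟩ : WfCtx [.univ 0] ∧ IsType [.univ 0] (DecEq (bound 0) 1) := by
    cases wfCtx_baseCtx with
    | cons h₁ h₂ => exact ⟨h₁, h₂⟩
  refine ⟨(Tm.lam (.lam t)).shift i, hi ▸ ?_⟩
  exact HasType.shift (.lam (.univ 0) (.lam hl h)) i

/-! ### Closed inhabitants at every universe level -/

theorem provable_decEq_free (i : ℕ) : Provable (Pi (U i) fun A => DecEq A ⇾ DecEq (FF A)) := by
  obtain ⟨t, ht⟩ := decEqFree_derivable.exists_of_checks (T := DecEq (FF gens) 2)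
    -- The desired statement is the most recent entry of its context.
    (.var 0) (by decide +kernel)
  exact provable_of_hasType (T := fun A => DecEq (FF A)) ht i rfl

theorem provable_canonicalEquivalence_and_normalForms (i : ℕ) :
    Provable (Pi (U i) fun A => DecEq A ⇾
      Prod (CanonicalEquivalence A) (IsEquiv (NormalWords A) (FF A) (evalNormal A))) := by
  let T (A : Bld) := Prod (CanonicalEquivalence A) (IsEquiv (NormalWords A) (FF A) (evalNormal A))
  obtain ⟨t, ht⟩ := canonicalEquivalence_derivable.exists_of_checks (T := T gens 2)
    ((canonicalEquivalenceVar.and isEquivEvalNormalVar).tm 103) (by decide +kernel)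
  exact provable_of_hasType (T := T) ht i rfl

end HoTT

theorem mainTheorem5 (i : ℕ) :
    HoTT.Provable (HoTT.Bld.Pi (HoTT.Bld.U i) fun A =>
      HoTT.Bld.arr (HoTT.DecEq A) (HoTT.DecEq (HoTT.FF A))) ∧
    HoTT.Provable (HoTT.Bld.Pi (HoTT.Bld.U i) fun A =>
      HoTT.Bld.arr (HoTT.DecEq A) (HoTT.Prod (HoTT.CanonicalEquivalence A)
        (HoTT.IsEquiv (HoTT.NormalWords A) (HoTT.FF A) (HoTT.evalNormal A)))) :=
  ⟨HoTT.provable_decEq_free i, HoTT.provable_canonicalEquivalence_and_normalForms i⟩
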